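/- **Setting.** Fix integers $n,k',r'\ge 1$ and put $d=(2k'+3)r'$. Let $$\mathsf{IMM}_{n,d}=\sum_{i_1,\dots,i_{d-1}\in[n]}x^{(1)}_{1,i_1}x^{(2)}_{i_1,i_2}\cdots x^{(d)}_{i_{d-1},1}$$ be the top left entry of the product of $d$ generic $n\times n$ matrices. Divide the $d$ matrices into $r'$ contiguous blocks of $2k'+3$ matrices, and name those of block $i$, in order, $$X^{(i,L,k'+1)},\dots,X^{(i,L,1)},\;X^{(i)},\;X^{(i,R,1)},\dots,X^{(i,R,k'+1)}.$$ A random restriction $V$ acts on every block $i$ as follows. In $X^{(i,L,k'+1)}$ the first row is set to $1$ and all other entries to $0$; in $X^{(i,R,k'+1)}$ the first column is set to $1$ and all other entries to $0$. The entries of $X^{(i)}$ become distinct $Y$-variables. For $1\le j\le k'$, in each column of $X^{(i,L,j)}$ and in each row of $X^{(i,R,j)}$, a uniformly random set of exactly $w_j$ entries is kept, and the kept entries become distinct $Z$-variables; all other entries are set to $0$. Here $$w_1=\lfloor n^{0.05}\rfloor,\qquad w_j=2\ \text{ for } 2\le j\le k'-0.34\log_2 n,\qquad w_j=1\ \text{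 for the other } j\ge 2,$$ and all choices are independent. Let $P|_V\in\mathbb F[Y\sqcup Z]$ be the polynomial obtained from $\mathsf{IMM}_{n,d}$ by applying $V$, where $Z$ is the set of $Z$-variables kept by $V$. A depth four circuit over $\mathbb F$ computes an expression $\sum_i\prod_j Q_{i,j}$, where every $Q_{i,j}$ is computed as a linear combination of monomials at bottom product gates (gates may be shared); its size is its number of gates. It is syntactically multi-$\delta$-ic if at each product gate every variable appears in at most $\delta$ of the operands, and the degrees of the operands in that variable add up to at most $\delta$. Its bottom $Z$-support is at most $t$ if every monomial of every $Q_{i,j}$ contains at most $t$ distinct $Z$-variables. **Theorem.** There are absolute constants $c>0$, $K>0$ and $n_0$ such that the following holds for every field $\mathbb F$ and all integers $n\ge n_0$, $k'\ge K\log_2 n$, $r'\ge K$ and $\delta\ge 0$ with $d=(2k'+3)r'\le n^{0.01}$ and $\delta\le n^{0.016}$. For every restriction $V$ as above, $P|_V$ has at most $n^{3}$ variables $Y\sqcup Z$ and has degree $d-2r'=(2k'+1)r'$. Moreover, with probability at least $0.9$ over $V$, every syntactically multi-$\delta$-ic depth four circuit of bottom $Z$-support at most $t=2\cdot10^{-5}k'$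 that computes $P|_V$ has size at least $n^{c\,r'}$. -/

import Mathlib

/-- A depth four circuit (sum of products of sums of products) over the variables `σ`, as a layered
directed acyclic graph of unbounded fan-in in which gates may be shared. -/
structure DepthFour (F σ : Type*) where
  /-- number of bottom product gates -/
  numBot : ℕ
  /-- number of inner sum gates -/
  numSum : ℕ
  /-- number of top product gates -/
  numProd : ℕ
  /-- the variables multiplied (with repetition) by a bottom product gate -/
  bot : Fin numBot → Multiset σ
  /-- the field constants on the wires from bottom product gates into an inner sum gate;
  the constant `0` means that there is no wire -/
  sumWire : Fin numSum → Fin numBot → F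
  /-- the inner sum gates multiplied (with repetition) by a top product gate -/
  prod : Fin numProd → Multiset (Fin numSum)
  /-- the field constants on the wires from the top product gates into the output sum gate -/
  outWire : Fin numProd → F

namespace DepthFour

variable {F σ : Type*} [Field F]

/-- The polynomial computed at a bottom product gate. -/
noncomputable def botPoly (C : DepthFour F σ) (b : Fin C.numBot) : MvPolynomial σ F :=
  ((C.bot b).map MvPolynomial.X).prod

/-- The polynomial computed at an inner sum gate. -/
noncomputable def sumPoly (C : DepthFour F σ) (j : Fin C.numSum) : MvPolynomial σ F :=
  ∑ b, MvPolynomial.C (C.sumWire j b) * C.botPoly b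

/-- The polynomial computed at a top product gate. -/
noncomputable def prodPoly (C : DepthFour F σ) (i : Fin C.numProd) : MvPolynomial σ F :=
  ((C.prod i).map C.sumPoly).prod

/-- The polynomial computed by the circuit. -/
noncomputable def eval (C : DepthFour F σ) : MvPolynomial σ F :=
  ∑ i, MvPolynomial.C (C.outWire i) * C.prodPoly i

/-- The size of a circuit: its number of gates, including the output gate (leaves not counted). -/
def size (C : DepthFour F σ) : ℕ := C.numBot + C.numSum + C.numProd + 1

/-- The variable `x` appears in the subcircuit rooted at the inner sum gate `j`. -/
def Appears (C : DepthFour F σ) (x : σ) (j : Fin C.numSum) : Prop :=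
  ∃ b, C.sumWire j b ≠ 0 ∧ x ∈ C.bot b

open Classical in
/-- Syntactically multi-`δ`-ic: at every product gate, every variable appears in at most `δ` of the
operands, and the degrees of the operands in that variable add up to at most `δ`. For a bottom
product gate, whose operands are variables, both conditions bound the multiplicity. -/
def IsMultiIc (C : DepthFour F σ) (δ : ℕ) : Prop :=
  (∀ b x, (C.bot b).count x ≤ δ) ∧
  ∀ i x, ((C.prod i).filter (C.Appears x)).card ≤ δ ∧
    ((C.prod i).map fun j => (C.sumPoly j).degreeOf x).sum ≤ δ

end DepthFour

/-- Over variables `Y ⊔ Z`: every monomial of every polynomial computed at an inner sum gate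
contains at most `t` distinct `Z`-variables. -/
def DepthFour.HasBottomZSupportLE {F Y Z : Type*} [Field F] (C : DepthFour F (Y ⊕ Z)) (t : ℝ) :
    Prop :=
  ∀ j, ∀ e ∈ (C.sumPoly j).support, ((e.support.filter fun v => v.isRight).card : ℝ) ≤ t

/-- The iterated matrix multiplication polynomial: the top left entry of the product of `d` generic
`n × n` matrices, where `(q, a, b)` is the variable in row `a` and column `b` of matrix `q`. -/
noncomputable def IMM (F : Type*) [Field F] (n d : ℕ) :
    MvPolynomial (Fin d × Fin n × Fin n) F :=
  ∑ p : Fin (d + 1) → Fin n with (p 0).val = 0 ∧ (p (Fin.last d)).val = 0,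
    ∏ q : Fin d, MvPolynomial.X (q, p q.castSucc, p q.succ)

/-- The two sides of a block of `2k + 3` matrices
`X^(L,k+1), …, X^(L,1), X, X^(R,1), …, X^(R,k+1)`. -/
inductive BlockSide where
  | left : BlockSide
  | right : BlockSide
  deriving DecidableEq

instance : Fintype BlockSide where
  elems := {BlockSide.left, BlockSide.right}
  complete := by
    intro s
    cases s
    · exact Finset.mem_insert_self _ _
    · exact Finset.mem_insert_of_mem (Finset.mem_singleton_self _)

/-- The number of entries kept alive in each column of the `j`-th left matrix and in each row of the
`j`-th right matrix of a block, `1 ≤ j ≤ k`. -/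
noncomputable def keepCount (n k j : ℕ) : ℕ :=
  open Classical in
  if j = 1 then ⌊(n : ℝ) ^ (0.05 : ℝ)⌋₊
  else if (j : ℝ) ≤ (k : ℝ) - 0.34 * Real.logb 2 n then 2
  else 1

/-- A restriction. For block `i`, side `b` and `j : Fin k` (which stands for the index `j + 1`), and
for each line `c` (a column on the left side, a row on the right side) of the corresponding matrix,
it gives the set of positions kept alive in that line. -/
abbrev Restriction (n k r : ℕ) : Type :=
  Fin r → BlockSide → ∀ j : Fin k, Fin n →
    {S : Finset (Fin n) // S.card = keepCount n k (j.val + 1)}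

namespace Restriction

variable {n k r : ℕ}

/-- The probability of an event when, independently for all blocks, sides, matrices and lines, the
set of kept positions is uniform among the sets of the prescribed size, that is, when the
restriction is uniform among all restrictions. -/
noncomputable def prob (E : Set (Restriction n k r)) : ℝ :=
  (Nat.card E : ℝ) / (Nat.card (Restriction n k r) : ℝ)

/-- The entry in row `a` and column `b` of the matrix with block, side and index `i, s, j` is kept
alive. -/
def Keeps (V : Restriction n k r) (i : Fin r) (s : BlockSide) (j : Fin k) (a b : Fin n) : Prop :=
  match s with
  | .left => a ∈ (V i .left j b).val
  | .right => b ∈ (V i .right j a).val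

/-- The `Y`-variables: the entries of the middle matrices of the blocks. -/
abbrev YVar (n r : ℕ) : Type := Fin r × Fin n × Fin n

/-- The `Z`-variables that are kept alive by the restriction `V`. -/
abbrev ZVar (V : Restriction n k r) : Type :=
  {z : Fin r × BlockSide × Fin k × Fin n × Fin n //
    V.Keeps z.1 z.2.1 z.2.2.1 z.2.2.2.1 z.2.2.2.2}

open Classical in
/-- The value of an entry of a matrix `Z^(i,s,j)`: a `Z`-variable if it is kept alive, and `0`
otherwise. -/
noncomputable def zValue (F : Type*) [Field F] (V : Restriction n k r)
    (i : Fin r) (s : BlockSide) (j : Fin k) (a b : Fin n) :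
    MvPolynomial (YVar n r ⊕ V.ZVar) F :=
  if h : V.Keeps i s j a b then MvPolynomial.X (Sum.inr ⟨(i, s, j, a, b), h⟩) else 0

/-- The value given by the restriction `V` to the variable in row `a` and column `b` of the `q`-th of
the `r * (2k + 3)` matrices. That matrix is at position `p = q mod (2k + 3)` of the block
`i = q / (2k + 3)`. Positions `0`, `1 … k`, `k + 1`, `k + 2 … 2k + 1`, `2k + 2` hold the matrix
`X^(L,k+1)` (first row set to one, the rest to zero), the matrices `X^(L,k), …, X^(L,1)`, the matrix
of `Y`-variables, the matrices `X^(R,1), …, X^(R,k)`, and the matrix `X^(R,k+1)` (first column set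
to one, the rest to zero). -/
noncomputable def value (F : Type*) [Field F] (V : Restriction n k r)
    (x : Fin (r * (2 * k + 3)) × Fin n × Fin n) : MvPolynomial (YVar n r ⊕ V.ZVar) F :=
  let i : Fin r := x.1.divNat
  let p : ℕ := x.1.modNat.val
  let a : Fin n := x.2.1
  let b : Fin n := x.2.2
  if p = 0 then (if a.val = 0 then 1 else 0)
  else if hL : 1 ≤ p ∧ p ≤ k then V.zValue F i .left ⟨k - p, by omega⟩ a b
  else if p = k + 1 then MvPolynomial.X (Sum.inl (i, a, b))
  else if hR : k + 2 ≤ p ∧ p ≤ 2 * k + 1 then V.zValue F i .right ⟨p - (k + 2), by omega⟩ a b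
  else (if b.val = 0 then 1 else 0)

/-- The restricted polynomial `P|_V`, obtained from the iterated matrix multiplication polynomial of
`r * (2k + 3)` matrices by applying the restriction `V`. -/
noncomputable def restrictedIMM (F : Type*) [Field F] (V : Restriction n k r) :
    MvPolynomial (YVar n r ⊕ V.ZVar) F :=
  MvPolynomial.aeval (V.value F) (IMM F n (r * (2 * k + 3)))

end Restriction

/-!
The proof measures a polynomial by the dimension of the space spanned by the following vectors: take
the coefficient, a polynomial in the `Z`-variables, of a `Y`-monomial of degree `r`, multiply it by
the product of the variables in a set `S` that has exactly `l` elements on each of the `2r` sides of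
blocks, and keep the multilinear monomials only. Write `N` for the number of variables on a side and
`y = (N - l) / l`.

*Circuits have small measure* (`DepthFour.exists_spanning_projShift`). A `Y`-monomial of degree `r`
hits at most `r` of the operands of a top product gate, and the multi-`δ`-ic condition leaves at most
`δ |Z|` operands that involve `Z`-variables. The operands that are hit have support at most `t`, so
together they only enlarge `S` by at most `t r` elements, and the other operands enter through their
`Y`-free parts. Hence each top gate contributes at most `(δ |Z| + 1) ^ r` vectors for each enlargement
of a set `S`, and there are about `(N.choose l) ^ (2r) * y ^ (t r)` enlargements.

*The restricted polynomial has large measure.* The two outer matrices of a block turn it into a sum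
over all starts of walks on the left and on the right, so the coefficient of a `Y`-monomial is a
product, over all sides, of the sum of the monomials of the walks from a prescribed vertex of a layered
graph (`Restriction.coeff_yExp_restrictedIMM`). Vectors with different leading monomials are
independent, and leading monomials are chosen side by side (`prod_card_leadSets_le`). Two
applications of the Cauchy–Schwarz inequality bound the number of leading monomials of a side from
below in terms of pairs of walks, weighted by `θ ^ (number of edges used)`, where `θ` is the
probability that an edge avoids `S`, respectively belongs to a set of `l + k` variables
(`pow_four_le_card_leadSets`).

*Pairs of walks in a random layered graph.* A pair of walks is a walk on pairs of vertices, and the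
expected weight is bounded by a supersolution of the transfer operators
(`LayeredGraph.sum_pairs_le_of_supersolution`). Two walks stay together at a cost of `1 / (w θ)` per
level and meet again with probability `1 / n`, so, as long as the products of `1 / (w θ)` are small
compared to `n`, most pairs behave as independent ones (`LayeredGraph.sum_pairs_bounds`). The sides
are independent, so Markov's inequality for the products over the sides gives the restrictions that
are good (`Restriction.prob_ge_of_sum_le`).

*Parameters.* The size `l` is chosen so that `y ^ k` is between `n ^ 0.58` and twice that
(`exists_shift_size`). Then on average at most one walk from a given vertex avoids `S`, which is
what the numbers `w j` are made for (`survival_le_one`), and the number of leading monomials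
of a side is `N.choose l * n ^ 0.58` up to factors polynomial in `k`. As there are two sides in a block,
the measure of `P|_V` exceeds `(N.choose l) ^ (2r)` by a factor `n ^ (1.16 r)`, up to such factors, and
the measure of a gate by a factor of about `(δ |Z|) ^ r ≤ n ^ (1.08 r)`. The margin in the exponent
absorbs all the other factors (`size_bound_of_pow_le`).
-/

/-! ### Polynomials in the `Y`-variables with coefficients in the `Z`-variables -/

section Coefficients

open MvPolynomial

variable {F Y Z : Type*} [Field F]

theorem sumAlgEquiv_monomial (u : Y ⊕ Z →₀ ℕ) (c : F) :
    sumAlgEquiv F Y Z (monomial u c) =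
      monomial (Finsupp.sumFinsuppAddEquivProdFinsupp u).1
        (monomial (Finsupp.sumFinsuppAddEquivProdFinsupp u).2 c) := by
  simp [sumAlgEquiv, monomial]

theorem coeff_coeff_sumAlgEquiv (f : MvPolynomial (Y ⊕ Z) F) (a : Y →₀ ℕ) (e : Z →₀ ℕ) :
    coeff e (coeff a (sumAlgEquiv F Y Z f)) = coeff (Finsupp.sumElim a e) f := by
  classical
  induction f using MvPolynomial.induction_on' with
  | monomial u c =>
    rw [sumAlgEquiv_monomial]
    have h1 : u = Finsupp.sumElim (Finsupp.sumFinsuppAddEquivProdFinsupp u).1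
        (Finsupp.sumFinsuppAddEquivProdFinsupp u).2 := by
      ext x; cases x <;> simp
    have h2 : (u = Finsupp.sumElim a e) ↔ ((Finsupp.sumFinsuppAddEquivProdFinsupp u).1 = a ∧
        (Finsupp.sumFinsuppAddEquivProdFinsupp u).2 = e) := by
      constructor
      · rintro rfl
        constructor <;> ext x <;> simp
      · rintro ⟨rfl, rfl⟩
        exact h1
    simp only [coeff_monomial, h2]
    split_ifs <;> simp_all [coeff_monomial]
  | add p q hp hq => simp [hp, hq]

/-- Every monomial of `f` contains at most `t` distinct variables. -/
def SuppLE (t : ℕ) (f : MvPolynomial Z F) : Prop :=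
  ∀ e ∈ f.support, e.support.card ≤ t

theorem SuppLE.mono {s t : ℕ} (h : s ≤ t) {f : MvPolynomial Z F} (hf : SuppLE s f) :
    SuppLE t f := fun e he => (hf e he).trans h

theorem SuppLE.mul {s t : ℕ} {f g : MvPolynomial Z F} (hf : SuppLE s f) (hg : SuppLE t g) :
    SuppLE (s + t) (f * g) := by
  classical
  intro e he
  obtain ⟨a, ha, b, hb, rfl⟩ := Finset.mem_add.1 (support_mul f g he)
  exact (Finset.card_le_card Finsupp.support_add).trans
    ((Finset.card_union_le _ _).trans (add_le_add (hf a ha) (hg b hb)))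

theorem SuppLE.sum {ι : Type*} {s : Finset ι} {t : ℕ} {f : ι → MvPolynomial Z F}
    (hf : ∀ i ∈ s, SuppLE t (f i)) : SuppLE t (∑ i ∈ s, f i) := by
  classical
  intro e he
  obtain ⟨i, hi, h⟩ := Finset.mem_biUnion.1 (support_sum he)
  exact hf i hi e h

/-- Every monomial of every coefficient of `Q`, a polynomial in `Y` over the polynomials in `Z`,
contains at most `t` distinct `Z`-variables. -/
def CoeffSuppLE (t : ℕ) (Q : MvPolynomial Y (MvPolynomial Z F)) : Prop :=
  ∀ a, SuppLE t (coeff a Q)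

theorem CoeffSuppLE.mul {s t : ℕ} {P Q : MvPolynomial Y (MvPolynomial Z F)}
    (hP : CoeffSuppLE s P) (hQ : CoeffSuppLE t Q) : CoeffSuppLE (s + t) (P * Q) := by
  classical
  intro a
  rw [coeff_mul]
  exact SuppLE.sum fun p _ => (hP p.1).mul (hQ p.2)

theorem CoeffSuppLE.one : CoeffSuppLE 0 (1 : MvPolynomial Y (MvPolynomial Z F)) := by
  classical
  intro a e he
  rw [coeff_one] at he
  split_ifs at he
  · have : e = 0 := by
      by_contra hne
      exact (mem_support_iff.1 he) (by rw [coeff_one, if_neg (Ne.symm hne)])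
    simp [this]
  · simp at he

theorem CoeffSuppLE.prod {ι : Type*} {s : Finset ι} {t : ℕ}
    {Q : ι → MvPolynomial Y (MvPolynomial Z F)} (hQ : ∀ i ∈ s, CoeffSuppLE t (Q i)) :
    CoeffSuppLE (s.card * t) (∏ i ∈ s, Q i) := by
  classical
  induction s using Finset.induction_on with
  | empty => simpa using CoeffSuppLE.one
  | insert i s hi ih =>
    rw [Finset.prod_insert hi, Finset.card_insert_of_notMem hi, add_mul, one_mul, add_comm]
    exact (hQ i (by simp)).mul (ih fun j hj => hQ j (by simp [hj]))

/-- A product of `m` polynomials without constant term has no monomial of degree less than `m`. -/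
theorem coeff_prod_eq_zero_of_degree_lt {R ι : Type*} [CommRing R] {s : Finset ι}
    {Q : ι → MvPolynomial Y R} (hQ : ∀ i ∈ s, coeff 0 (Q i) = 0)
    {a : Y →₀ ℕ} (ha : a.degree < s.card) : coeff a (∏ i ∈ s, Q i) = 0 := by
  classical
  induction s using Finset.induction_on generalizing a with
  | empty => simp at ha
  | insert i s hi ih =>
    rw [Finset.prod_insert hi, coeff_mul]
    refine Finset.sum_eq_zero fun p hp => ?_
    rw [Finset.HasAntidiagonal.mem_antidiagonal] at hp
    by_cases h0 : p.1 = 0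
    · rw [h0, hQ i (by simp), zero_mul]
    · have h1 : 0 < p.1.degree := by
        rw [Nat.pos_iff_ne_zero]
        exact fun h => h0 ((Finsupp.degree_eq_zero_iff _).1 h)
      have h2 : a.degree = p.1.degree + p.2.degree := by rw [← hp, map_add]
      rw [ih (fun j hj => hQ j (by simp [hj])), mul_zero]
      rw [Finset.card_insert_of_notMem hi] at ha
      omega

/-- The coefficient of a `Y`-monomial of degree at most `r` in a product of factors, where only the
factors in `J` involve `Z`-variables: all but at most `r` of the factors in `J` contribute their
`Y`-free part. -/
theorem exists_coeff_prod_eq_sum {ι : Type*} [Fintype ι] [DecidableEq ι]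
    (Q : ι → MvPolynomial Y (MvPolynomial Z F)) (J : Finset ι) {t r : ℕ}
    (hJ : ∀ j ∉ J, CoeffSuppLE 0 (Q j)) (hQ : ∀ j, CoeffSuppLE t (Q j))
    {a : Y →₀ ℕ} (ha : a.degree ≤ r) :
    ∃ g : Finset ι → MvPolynomial Z F, (∀ A, A.card ≤ r → SuppLE (t * r) (g A)) ∧
      coeff a (∏ j, Q j) = ∑ A ∈ J.powerset with A.card ≤ r,
        g A * ∏ j ∈ J \ A, coeff 0 (Q j) := by
  classical
  let R : ι → MvPolynomial Y (MvPolynomial Z F) := fun j => Q j - C (coeff 0 (Q j))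
  let G : MvPolynomial Y (MvPolynomial Z F) := ∏ j ∈ Finset.univ \ J, Q j
  have hR : ∀ j, CoeffSuppLE t (R j) := by
    intro j b
    by_cases hb : b = 0
    · subst hb
      intro e he
      simp [R] at he
    · have : coeff b (R j) = coeff b (Q j) := by
        simp [R, coeff_C, Ne.symm hb]
      rw [this]
      exact hQ j b
  have hG : CoeffSuppLE 0 G := by
    have := CoeffSuppLE.prod (s := Finset.univ \ J) (t := 0) (Q := Q)
      (fun j hj => hJ j (Finset.mem_sdiff.1 hj).2)
    rwa [mul_zero] at this
  refine ⟨fun A => coeff a (G * ∏ j ∈ A, R j), ?_, ?_⟩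
  · intro A hA
    have h := hG.mul (CoeffSuppLE.prod (s := A) (t := t) (Q := R) fun j _ => hR j)
    refine (h a).mono ?_
    rw [zero_add, mul_comm]
    exact Nat.mul_le_mul_left _ hA
  · have h1 : ∏ j, Q j = G * ∏ j ∈ J, (R j + C (coeff 0 (Q j))) := by
      have : ∀ j, R j + C (coeff 0 (Q j)) = Q j := fun j => by simp [R]
      simp only [this]
      exact (Finset.prod_sdiff (Finset.subset_univ J)).symm
    rw [h1, Finset.prod_add, Finset.mul_sum, coeff_sum, Finset.sum_filter]
    refine Finset.sum_congr rfl fun A _ => ?_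
    rw [← mul_assoc, ← map_prod, mul_comm _ (C _), coeff_C_mul, mul_comm (∏ j ∈ J \ A, coeff 0 (Q j))]
    split_ifs with hA
    · rfl
    · have h0 : coeff a (G * ∏ j ∈ A, R j) = 0 := by
        rw [coeff_mul]
        refine Finset.sum_eq_zero fun p hp => ?_
        rw [Finset.HasAntidiagonal.mem_antidiagonal] at hp
        have h2 : a.degree = p.1.degree + p.2.degree := by rw [← hp, map_add]
        rw [coeff_prod_eq_zero_of_degree_lt (s := A) (Q := R), mul_zero]
        · intro i _
          simp [R]
        · omega
      rw [h0, zero_mul]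

end Coefficients

/-! ### Multilinear projections of shifts -/

section Multilinear

open MvPolynomial

variable {F Z : Type*} [Field F]

/-- The exponent of the multilinear monomial with the set `T` of variables. -/
noncomputable def indExp (T : Finset Z) : Z →₀ ℕ := ∑ z ∈ T, Finsupp.single z 1

theorem monomial_indExp (T : Finset Z) :
    (monomial (indExp T) 1 : MvPolynomial Z F) = ∏ z ∈ T, X z := by
  simp only [indExp, X, monomial_sum_one]

/-- The coefficients of the multilinear monomials. Its kernel is the ideal generated by the squares
of the variables. -/
noncomputable def multilinearPart : MvPolynomial Z F →ₗ[F] (Finset Z → F) :=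
  LinearMap.pi fun T => lcoeff F (indExp T)

theorem multilinearPart_apply (f : MvPolynomial Z F) (T : Finset Z) :
    multilinearPart f T = coeff (indExp T) f := rfl

/-- The multilinear projection of the product of `f` with the monomial of the set `S`. -/
noncomputable def projShift (S : Finset Z) (f : MvPolynomial Z F) : Finset Z → F :=
  multilinearPart (monomial (indExp S) 1 * f)

theorem projShift_sum {ι : Type*} (S : Finset Z) (s : Finset ι) (f : ι → MvPolynomial Z F) :
    projShift S (∑ i ∈ s, f i) = ∑ i ∈ s, projShift S (f i) := by
  simp [projShift, Finset.mul_sum]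

theorem projShift_smul (S : Finset Z) (c : F) (f : MvPolynomial Z F) :
    projShift S (c • f) = c • projShift S f := by
  simp [projShift]

variable [DecidableEq Z]

theorem indExp_apply (T : Finset Z) (z : Z) : indExp T z = if z ∈ T then 1 else 0 := by
  simp [indExp, Finsupp.single_apply]

theorem support_indExp (T : Finset Z) : (indExp T).support = T := by
  ext z
  simp [indExp_apply]

theorem indExp_injective : Function.Injective (indExp : Finset Z → Z →₀ ℕ) := fun S T h => by
  rw [← support_indExp S, h, support_indExp]

theorem indExp_le_iff {S T : Finset Z} : indExp S ≤ indExp T ↔ S ⊆ T := by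
  constructor
  · intro h z hz
    have := h z
    simp only [indExp_apply, hz, if_true] at this
    by_contra hn
    simp [hn] at this
  · intro h z
    simp only [indExp_apply]
    split_ifs with h1 h2
    · exact le_rfl
    · exact absurd (h h1) h2
    · exact Nat.zero_le _
    · exact le_rfl

theorem indExp_sub {S T : Finset Z} : indExp T - indExp S = indExp (T \ S) := by
  ext z
  simp only [Finsupp.tsub_apply, indExp_apply, Finset.mem_sdiff]
  by_cases h1 : z ∈ T <;> by_cases h2 : z ∈ S <;> simp [h1, h2]

theorem indExp_add_of_disjoint {S T : Finset Z} (h : Disjoint S T) :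
    indExp S + indExp T = indExp (S ∪ T) := by
  rw [indExp, indExp, indExp, Finset.sum_union h]

theorem projShift_apply (S : Finset Z) (f : MvPolynomial Z F) (T : Finset Z) :
    projShift S f T = if S ⊆ T then coeff (indExp (T \ S)) f else 0 := by
  rw [projShift, multilinearPart_apply, coeff_monomial_mul']
  simp only [indExp_le_iff, one_mul, indExp_sub]

/-- The shift by `S` of `g * q`, when all monomials of `g` have support at most `τ`, is spanned by
the shifts of `q` by the sets that exceed `S` by at most `τ` elements. -/
theorem projShift_mul_mem_span {τ : ℕ} {S : Finset Z} {g : MvPolynomial Z F} (hg : SuppLE τ g)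
    (q : MvPolynomial Z F) {E : Finset (Finset Z)}
    (hE : ∀ U, Disjoint S U → U.card ≤ τ → S ∪ U ∈ E) :
    projShift S (g * q) ∈ Submodule.span F ((fun T => projShift T q) '' (E : Set (Finset Z))) := by
  rw [g.as_sum, Finset.sum_mul, projShift_sum]
  refine Submodule.sum_mem _ fun e he => ?_
  by_cases hsq : ∃ U, Disjoint S U ∧ e = indExp U
  · obtain ⟨U, hU, rfl⟩ := hsq
    have h1 : projShift S (monomial (indExp U) (coeff (indExp U) g) * q) =
        coeff (indExp U) g • projShift (S ∪ U) q := by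
      rw [projShift, projShift, ← map_smul, ← mul_assoc, monomial_mul, one_mul,
        indExp_add_of_disjoint hU, ← smul_mul_assoc, smul_monomial, smul_eq_mul, mul_one]
    rw [h1]
    refine Submodule.smul_mem _ _ (Submodule.subset_span ⟨S ∪ U, ?_, rfl⟩)
    exact hE U hU (by simpa [support_indExp] using hg _ he)
  · have h0 : projShift S (monomial e (coeff e g) * q) = 0 := by
      funext T
      rw [projShift, multilinearPart_apply, ← mul_assoc, monomial_mul, coeff_monomial_mul',
        if_neg, Pi.zero_apply]
      intro hle
      refine hsq ⟨e.support, ?_, ?_⟩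
      · rw [Finset.disjoint_left]
        intro z hzS hze
        have h2 := hle z
        rw [Finsupp.add_apply, indExp_apply, indExp_apply, if_pos hzS] at h2
        have h3 := Finsupp.mem_support_iff.1 hze
        split_ifs at h2 <;> omega
      · ext z
        have h2 := hle z
        rw [Finsupp.add_apply, indExp_apply, indExp_apply] at h2
        rw [indExp_apply]
        simp only [Finsupp.mem_support_iff]
        split_ifs at h2 ⊢ <;> omega
    rw [h0]
    exact Submodule.zero_mem _

end Multilinear

/-! ### The rank bound for circuits -/

section CircuitBound

open MvPolynomial

variable {F Y Z : Type*} [Field F]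

/-- Variables of monomials of `sumPoly` appear syntactically; the converse may fail by cancellation. -/
theorem DepthFour.appears_of_mem_support {σ : Type*} (Φ : DepthFour F σ) {j : Fin Φ.numSum}
    {e : σ →₀ ℕ} (he : e ∈ (Φ.sumPoly j).support) {x : σ} (hx : e x ≠ 0) : Φ.Appears x j := by
  classical
  obtain ⟨b, -, hb⟩ := Finset.mem_biUnion.1 (support_sum he)
  have hbot : Φ.botPoly b = monomial (Multiset.toFinsupp (Φ.bot b)) 1 := by
    unfold DepthFour.botPoly
    induction Φ.bot b using Multiset.induction_on with
    | empty => simp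
    | cons x s ih =>
      rw [Multiset.map_cons, Multiset.prod_cons, ih, X, monomial_mul, one_mul,
        ← Multiset.singleton_add, map_add, Multiset.toFinsupp_singleton]
  rw [hbot, C_mul_monomial, mul_one, mem_support_iff, coeff_monomial] at hb
  split_ifs at hb with h
  · refine ⟨b, hb, ?_⟩
    rw [← h, Multiset.toFinsupp_apply] at hx
    exact Multiset.count_ne_zero.1 hx
  · exact absurd rfl hb

theorem coeffSuppLE_sumAlgEquiv {t : ℕ} {f : MvPolynomial (Y ⊕ Z) F}
    (hf : ∀ e ∈ f.support, (e.support.filter fun v => v.isRight).card ≤ t) :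
    CoeffSuppLE t (sumAlgEquiv F Y Z f) := by
  classical
  intro a e he
  rw [mem_support_iff, coeff_coeff_sumAlgEquiv, ← mem_support_iff] at he
  refine le_trans ?_ (hf _ he)
  rw [← Finset.card_map Function.Embedding.inr (s := e.support) (α := Z)
    (β := Y ⊕ Z)]
  refine Finset.card_le_card fun v hv => ?_
  obtain ⟨z, hz, rfl⟩ := Finset.mem_map.1 hv
  simpa using hz

/-- A multiset is the image of a finite index type. -/
theorem Multiset.exists_eq_univ_map {α : Type*} (m : Multiset α) :
    ∃ (l : ℕ) (f : Fin l → α), m = (Finset.univ : Finset (Fin l)).val.map f := by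
  induction m using Quotient.inductionOn with
  | h l =>
    refine ⟨l.length, l.get, ?_⟩
    simp [Fin.univ_def, Multiset.map_coe]

theorem card_powerset_filter_card_le {ι : Type*} (J : Finset ι) (r : ℕ) :
    (J.powerset.filter fun A => A.card ≤ r).card ≤ (J.card + 1) ^ r := by
  classical
  have h1 : (J.powerset.filter fun A => A.card ≤ r) ⊆
      (Finset.range (r + 1)).biUnion fun i => J.powersetCard i := by
    intro A hA
    rw [Finset.mem_filter, Finset.mem_powerset] at hA
    rw [Finset.mem_biUnion]
    exact ⟨A.card, by simp; omega, Finset.mem_powersetCard.2 ⟨hA.1, rfl⟩⟩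
  refine (Finset.card_le_card h1).trans (Finset.card_biUnion_le.trans ?_)
  rw [add_pow]
  refine Finset.sum_le_sum fun i hi => ?_
  rw [Finset.card_powersetCard, one_pow, mul_one]
  refine (Nat.choose_le_pow J.card i).trans (Nat.le_mul_of_pos_right _ ?_)
  exact Nat.choose_pos (by simp at hi; omega)

/-- The shifts by `S` in a family `𝒮` of the coefficients of `Y`-monomials of degree at most `r` of
the output of a multi-`δ`-ic circuit of small bottom support lie in the span of few vectors: for each
top gate, one for each choice of the at most `r` operands hit by the `Y`-monomial among the at most
`δ |Z|` operands that involve `Z`-variables, and of an enlargement of some `S ∈ 𝒮`. -/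
theorem DepthFour.exists_spanning_projShift [Fintype Z] [DecidableEq Z]
    (Φ : DepthFour F (Y ⊕ Z)) {δ t r : ℕ} (hδ : Φ.IsMultiIc δ)
    (ht : ∀ j, ∀ e ∈ (Φ.sumPoly j).support, (e.support.filter fun v => v.isRight).card ≤ t)
    {𝒮 E : Finset (Finset Z)}
    (hE : ∀ S ∈ 𝒮, ∀ U, Disjoint S U → U.card ≤ t * r → S ∪ U ∈ E) :
    ∃ G : Finset (Finset Z → F),
      G.card ≤ Φ.numProd * ((δ * Fintype.card Z + 1) ^ r * E.card) ∧
      ∀ S ∈ 𝒮, ∀ a : Y →₀ ℕ, a.degree ≤ r →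
        projShift S (coeff a (sumAlgEquiv F Y Z Φ.eval)) ∈
          Submodule.span F (G : Set (Finset Z → F)) := by
  classical
  choose l f hf using fun i => Multiset.exists_eq_univ_map (Φ.prod i)
  let Q : ∀ i, Fin (l i) → MvPolynomial Y (MvPolynomial Z F) := fun i s =>
    sumAlgEquiv F Y Z (Φ.sumPoly (f i s))
  let J : ∀ i, Finset (Fin (l i)) := fun i =>
    Finset.univ.filter fun s => ∃ z : Z, Φ.Appears (Sum.inr z) (f i s)
  have hJcard : ∀ i, (J i).card ≤ δ * Fintype.card Z := by
    intro i
    have h1 : J i ⊆ (Finset.univ : Finset Z).biUnion fun z =>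
        Finset.univ.filter fun s => Φ.Appears (Sum.inr z) (f i s) := by
      intro s hs
      simpa [J] using hs
    refine (Finset.card_le_card h1).trans (Finset.card_biUnion_le.trans ?_)
    have h2 : ∀ z : Z, (Finset.univ.filter fun s => Φ.Appears (Sum.inr z) (f i s)).card ≤ δ := by
      intro z
      have := (hδ.2 i (Sum.inr z)).1
      rw [hf i, Multiset.filter_map, Multiset.card_map] at this
      exact this
    refine (Finset.sum_le_sum fun z _ => h2 z).trans ?_
    simp [mul_comm]
  have hQJ : ∀ i, ∀ s ∉ J i, CoeffSuppLE 0 (Q i s) := by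
    intro i s hs
    refine coeffSuppLE_sumAlgEquiv fun e he => ?_
    rw [Nat.le_zero, Finset.card_eq_zero, Finset.filter_eq_empty_iff]
    rintro (y | z) hv
    · simp
    · exfalso
      refine hs ?_
      simp only [J, Finset.mem_filter, Finset.mem_univ, true_and]
      exact ⟨z, Φ.appears_of_mem_support he (Finsupp.mem_support_iff.1 hv)⟩
  have hQt : ∀ i s, CoeffSuppLE t (Q i s) := fun i s => coeffSuppLE_sumAlgEquiv (ht _)
  have hprod : ∀ i, sumAlgEquiv F Y Z (Φ.prodPoly i) = ∏ s, Q i s := by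
    intro i
    rw [DepthFour.prodPoly, hf i, Multiset.map_map]
    change sumAlgEquiv F Y Z (∏ s, Φ.sumPoly (f i s)) = _
    rw [map_prod]
  let V : ∀ i, Finset (Fin (l i)) → Finset Z → (Finset Z → F) := fun i A T =>
    projShift T (∏ s ∈ J i \ A, coeff 0 (Q i s))
  let Gi : Fin Φ.numProd → Finset (Finset Z → F) := fun i =>
    (((J i).powerset.filter fun A => A.card ≤ r) ×ˢ E).image fun p => V i p.1 p.2
  refine ⟨Finset.univ.biUnion Gi, ?_, ?_⟩
  · refine Finset.card_biUnion_le.trans ?_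
    have h1 : ∀ i, (Gi i).card ≤ (δ * Fintype.card Z + 1) ^ r * E.card := by
      intro i
      refine Finset.card_image_le.trans ?_
      rw [Finset.card_product]
      refine Nat.mul_le_mul_right _ ((card_powerset_filter_card_le _ _).trans ?_)
      exact Nat.pow_le_pow_left (Nat.succ_le_succ (hJcard i)) r
    refine (Finset.sum_le_sum fun i _ => h1 i).trans ?_
    simp
  · intro S hS a ha
    have heval : coeff a (sumAlgEquiv F Y Z Φ.eval) =
        ∑ i, Φ.outWire i • coeff a (∏ s, Q i s) := by
      rw [DepthFour.eval, map_sum, coeff_sum]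
      refine Finset.sum_congr rfl fun i _ => ?_
      rw [map_mul, hprod, sumAlgEquiv_C_inl, coeff_C_mul, smul_eq_C_mul]
    rw [heval, projShift_sum]
    refine Submodule.sum_mem _ fun i _ => ?_
    rw [projShift_smul]
    refine Submodule.smul_mem _ _ ?_
    obtain ⟨g, hg, hsum⟩ := exists_coeff_prod_eq_sum (Q i) (J i) (hQJ i) (hQt i) ha
    rw [hsum, projShift_sum]
    refine Submodule.sum_mem _ fun A hA => ?_
    refine Submodule.span_mono ?_ (projShift_mul_mem_span (hg A (Finset.mem_filter.1 hA).2) _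
      (hE S hS))
    rintro _ ⟨T, hT, rfl⟩
    rw [Finset.mem_coe, Finset.mem_biUnion]
    exact ⟨i, Finset.mem_univ _, Finset.mem_image.2 ⟨(A, T), Finset.mem_product.2 ⟨hA, hT⟩, rfl⟩⟩

end CircuitBound

/-! ### Leading sets -/

section Leading

open MvPolynomial

variable {F Z : Type*} [Field F]

/-- Vectors whose leading positions, with respect to an injective weight, are the different elements
of `𝒯` are linearly independent, so there are at most as many as vectors spanning a space that
contains them. -/
theorem card_le_of_leading {ι : Type*} [DecidableEq ι] (wt : ι → ℕ) (hwt : Function.Injective wt)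
    (𝒯 : Finset ι) (G : Finset (ι → F))
    (h : ∀ T ∈ 𝒯, ∃ v ∈ Submodule.span F (G : Set (ι → F)), v T ≠ 0 ∧
      ∀ T', v T' ≠ 0 → wt T' ≤ wt T) : 𝒯.card ≤ G.card := by
  classical
  choose! v hv using h
  have hli : LinearIndependent F fun T : 𝒯 => v T := by
    rw [Fintype.linearIndependent_iff]
    intro c hc
    by_contra hne
    push Not at hne
    obtain ⟨i₀, hi₀⟩ := hne
    obtain ⟨i, hi, hmax⟩ := Finset.exists_max_image (Finset.univ.filter fun i : 𝒯 => c i ≠ 0)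
      (fun i => wt i) ⟨i₀, by simp [hi₀]⟩
    have h1 := congrFun hc i
    rw [Finset.sum_apply, Finset.sum_eq_single i] at h1
    · simp only [Pi.smul_apply, smul_eq_mul, Pi.zero_apply, mul_eq_zero] at h1
      rcases h1 with h1 | h1
      · exact (Finset.mem_filter.1 hi).2 h1
      · exact (hv i i.2).2.1 h1
    · intro j _ hji
      by_cases hcj : c j = 0
      · simp [hcj]
      · have h2 : v j i = 0 := by
          by_contra hvj
          have h3 := (hv j j.2).2.2 i hvj
          have h4 := hmax j (by simp [hcj])
          exact hji (Subtype.ext (hwt (le_antisymm h4 h3)))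
        simp [h2]
    · simp
  have h1 : LinearIndependent F (fun T : 𝒯 =>
      (⟨v T, (hv T T.2).1⟩ : Submodule.span F (G : Set (ι → F)))) := by
    apply LinearIndependent.of_comp (Submodule.subtype _)
    exact hli
  have h2 := h1.fintype_card_le_finrank
  rw [Fintype.card_coe] at h2
  exact h2.trans (finrank_span_finset_le_card G)

end Leading

/-! ### Leading sets of products -/

section Weight

variable {Z : Type*} [Fintype Z]

/-- An injective weight on the subsets of a finite type that is additive on disjoint unions. Comparing
weights plays the role of a monomial order on the multilinear monomials. -/
noncomputable def setWeight (T : Finset Z) : ℕ := ∑ z ∈ T, 2 ^ (Fintype.equivFin Z z).val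

theorem setWeight_injective : Function.Injective (setWeight : Finset Z → ℕ) := by
  intro S T h
  have key : ∀ T : Finset Z, setWeight T =
      ∑ i ∈ T.map ((Fintype.equivFin Z).toEmbedding.trans Fin.valEmbedding), 2 ^ i := by
    intro T
    rw [Finset.sum_map]
    rfl
  rw [key, key] at h
  exact Finset.map_injective _ (Finset.geomSum_injective (le_refl 2) h)

variable [DecidableEq Z]

theorem setWeight_union {S T : Finset Z} (h : Disjoint S T) :
    setWeight (S ∪ T) = setWeight S + setWeight T := Finset.sum_union h

theorem setWeight_biUnion {B : Type*} {s : Finset B} {f : B → Finset Z}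
    (h : ∀ b ∈ s, ∀ c ∈ s, b ≠ c → Disjoint (f b) (f c)) :
    setWeight (s.biUnion f) = ∑ b ∈ s, setWeight (f b) :=
  Finset.sum_biUnion fun b hb c hc hbc => h b hb c hc hbc

end Weight

section Product

open MvPolynomial

variable {F Z B P A : Type*} [Field F] [DecidableEq Z] [Fintype B] [DecidableEq B] [DecidableEq A]

/-- The part of `T` that lies over `b`. -/
def partOver (β : Z → B) (b : B) (T : Finset Z) : Finset Z := T.filter fun z => β z = b

theorem partOver_biUnion {β : Z → B} {f : B → Finset Z} (hf : ∀ b, ∀ z ∈ f b, β z = b) (b : B) :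
    partOver β b (Finset.univ.biUnion f) = f b := by
  ext z
  simp only [partOver, Finset.mem_filter, Finset.mem_biUnion, Finset.mem_univ, true_and]
  constructor
  · rintro ⟨⟨c, hc⟩, hz⟩
    rw [hf c z hc] at hz
    exact hz ▸ hc
  · intro hz
    exact ⟨⟨b, hz⟩, hf b z hz⟩

theorem biUnion_partOver (β : Z → B) (T : Finset Z) :
    (Finset.univ.biUnion fun b => partOver β b T) = T := by
  ext z
  simp [partOver]

/-- The sum of the multilinear monomials given by the tuples of paths `x b ∈ W b` that start in
`α b`. -/
noncomputable def pathPoly (F : Type*) [Field F] (W : B → Finset P) (start : P → A)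
    (m : B → P → Finset Z) (α : B → A) : MvPolynomial Z F :=
  ∑ x ∈ Fintype.piFinset W with ∀ b, start (x b) = α b,
    monomial (indExp (Finset.univ.biUnion fun b => m b (x b))) 1

theorem coeff_pathPoly (W : B → Finset P) (start : P → A) (m : B → P → Finset Z) (α : B → A)
    (T : Finset Z) : coeff (indExp T) (pathPoly F W start m α) =
      ∑ x ∈ Fintype.piFinset W with ∀ b, start (x b) = α b,
        if (Finset.univ.biUnion fun b => m b (x b)) = T then (1 : F) else 0 := by
  rw [pathPoly, coeff_sum]
  refine Finset.sum_congr rfl fun x _ => ?_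
  rw [coeff_monomial]
  simp only [indExp_injective.eq_iff]

/-- Tuples of paths with different edge sets give different monomials. -/
theorem pathPoly_ne_zero {β : Z → B} {W : B → Finset P} {start : P → A} {m : B → P → Finset Z}
    (hm : ∀ b, ∀ x ∈ W b, ∀ z ∈ m b x, β z = b) (hinj : ∀ b, Set.InjOn (m b) (W b))
    {x : B → P} (hx : ∀ b, x b ∈ W b) : pathPoly F W start m (fun b => start (x b)) ≠ 0 := by
  intro h0
  have h := coeff_pathPoly (F := F) W start m (fun b => start (x b))
    (Finset.univ.biUnion fun b => m b (x b))
  rw [h0, coeff_zero, Finset.sum_eq_single x, if_pos rfl] at h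
  · exact zero_ne_one h
  · intro x' hx' hne
    rw [if_neg]
    intro heq
    have hx'W := Fintype.mem_piFinset.1 (Finset.mem_filter.1 hx').1
    refine hne (funext fun b => hinj b (hx'W b) (hx b) ?_)
    rw [← partOver_biUnion (β := β) (f := fun b => m b (x' b)) (fun b => hm b _ (hx'W b)) b,
      ← partOver_biUnion (β := β) (f := fun b => m b (x b)) (fun b => hm b _ (hx b)) b, heq]
  · intro hn
    exact absurd (Finset.mem_filter.2 ⟨Fintype.mem_piFinset.2 hx, fun _ => rfl⟩) hn

variable [Fintype Z]

/-- The sets `S ∪ m x` where `S` has `l` elements and `m x` is disjoint from `S` and of largest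
weight among all sets `m x'` of this kind for which `x'` has the same start as `x`. -/
noncomputable def leadSets (U : Finset Z) (l : ℕ) (W : Finset P) (start : P → A)
    (m : P → Finset Z) : Finset (Finset Z) :=
  open Classical in
  Finset.univ.filter fun T => ∃ S ∈ U.powersetCard l, ∃ x ∈ W, Disjoint (m x) S ∧ T = S ∪ m x ∧
    ∀ x' ∈ W, start x' = start x → Disjoint (m x') S → setWeight (m x') ≤ setWeight (m x)

/-- The number of tuples of leading sets is a lower bound for the dimension of the space spanned by
the projected shifts of the path polynomials. -/
theorem prod_card_leadSets_le {β : Z → B} {l : ℕ} {W : B → Finset P} {start : P → A}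
    {m : B → P → Finset Z} (hm : ∀ b, ∀ x ∈ W b, ∀ z ∈ m b x, β z = b)
    (hinj : ∀ b, Set.InjOn (m b) (W b)) (G : Finset (Finset Z → F))
    (hG : ∀ S : Finset Z, (∀ b, (partOver β b S).card = l) → ∀ α : B → A,
      projShift S (pathPoly F W start m α) ∈ Submodule.span F (G : Set (Finset Z → F))) :
    ∏ b, (leadSets (partOver β b Finset.univ) l (W b) start (m b)).card ≤ G.card := by
  classical
  set Ld : B → Finset (Finset Z) := fun b =>
    leadSets (partOver β b Finset.univ) l (W b) start (m b) with hLd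
  have hLmem : ∀ b, ∀ T ∈ Ld b, ∃ S ∈ (partOver β b Finset.univ).powersetCard l, ∃ x ∈ W b,
      Disjoint (m b x) S ∧ T = S ∪ m b x ∧ ∀ x' ∈ W b, start x' = start x →
        Disjoint (m b x') S → setWeight (m b x') ≤ setWeight (m b x) := by
    intro b T hT
    simpa [hLd, leadSets] using hT
  have hover : ∀ b, ∀ T ∈ Ld b, ∀ z ∈ T, β z = b := by
    intro b T hT z hz
    obtain ⟨S, hS, x, hx, -, rfl, -⟩ := hLmem b T hT
    rcases Finset.mem_union.1 hz with h | h
    · exact (Finset.mem_filter.1 ((Finset.mem_powersetCard.1 hS).1 h)).2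
    · exact hm b x hx z h
  have hcard : ((Fintype.piFinset Ld).image fun T => Finset.univ.biUnion T).card =
      ∏ b, (Ld b).card := by
    rw [Finset.card_image_of_injOn, Fintype.card_piFinset]
    intro T hT T' hT' h
    have hT1 := Fintype.mem_piFinset.1 hT
    have hT2 := Fintype.mem_piFinset.1 hT'
    funext b
    rw [← partOver_biUnion (β := β) (fun b => hover b _ (hT1 b)) b,
      ← partOver_biUnion (β := β) (fun b => hover b _ (hT2 b)) b]
    exact congrArg _ h
  rw [← hcard]
  refine card_le_of_leading setWeight setWeight_injective _ G fun T hT => ?_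
  obtain ⟨t, ht, rfl⟩ := Finset.mem_image.1 hT
  have ht := Fintype.mem_piFinset.1 ht
  choose s hs x hx hdisj hts hmax using fun b => hLmem b (t b) (ht b)
  have hsover : ∀ b, ∀ z ∈ s b, β z = b := fun b z hz =>
    (Finset.mem_filter.1 ((Finset.mem_powersetCard.1 (hs b)).1 hz)).2
  set S := Finset.univ.biUnion s with hSdef
  have hpart : ∀ b, partOver β b S = s b := partOver_biUnion hsover
  let M : (B → P) → Finset Z := fun x => Finset.univ.biUnion fun b => m b (x b)
  -- The tuples of paths that avoid `S` are those whose components avoid the parts of `S`.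
  have hMpart : ∀ x' : B → P, (∀ b, x' b ∈ W b) → ∀ b, partOver β b (M x') = m b (x' b) :=
    fun x' hx' => partOver_biUnion fun b => hm b _ (hx' b)
  have hMS : Disjoint S (M x) := by
    rw [Finset.disjoint_left]
    intro z hz hzM
    have h1 : z ∈ partOver β (β z) S := Finset.mem_filter.2 ⟨hz, rfl⟩
    have h2 : z ∈ partOver β (β z) (M x) := Finset.mem_filter.2 ⟨hzM, rfl⟩
    rw [hpart] at h1
    rw [hMpart x hx] at h2
    exact Finset.disjoint_left.1 (hdisj _) h2 h1
  have hTS : Finset.univ.biUnion t = S ∪ M x := by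
    ext z
    simp only [Finset.mem_biUnion, Finset.mem_union, hSdef, M, hts, Finset.mem_univ, true_and,
      exists_or]
  have hwt : ∀ x' : B → P, (∀ b, x' b ∈ W b) →
      setWeight (M x') = ∑ b, setWeight (m b (x' b)) := by
    intro x' hx'
    refine setWeight_biUnion fun b _ c _ hbc => ?_
    rw [Finset.disjoint_left]
    intro z hz hz'
    exact hbc ((hm b _ (hx' b) z hz).symm.trans (hm c _ (hx' c) z hz'))
  have hcoeff := coeff_pathPoly (F := F) W start m fun b => start (x b)
  refine ⟨_, hG S (fun b => ?_) fun b => start (x b), ?_, ?_⟩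
  · rw [hpart]
    exact (Finset.mem_powersetCard.1 (hs b)).2
  · rw [hTS, projShift_apply, if_pos Finset.subset_union_left, Finset.union_sdiff_cancel_left hMS,
      hcoeff, Finset.sum_eq_single x, if_pos rfl]
    · exact one_ne_zero
    · intro x' hx' hne
      rw [if_neg]
      intro h
      have hx'W := Fintype.mem_piFinset.1 (Finset.mem_filter.1 hx').1
      refine hne (funext fun b => hinj b (hx'W b) (hx b) ?_)
      rw [← hMpart x' hx'W, ← hMpart x hx]
      exact congrArg (partOver β b) h
    · intro h
      exact absurd (Finset.mem_filter.2 ⟨Fintype.mem_piFinset.2 hx, fun _ => rfl⟩) h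
  · intro T' hT'
    rw [projShift_apply] at hT'
    split_ifs at hT' with hST
    · rw [hcoeff] at hT'
      obtain ⟨x', hx', hne⟩ := Finset.exists_ne_zero_of_sum_ne_zero hT'
      have hx'W := Fintype.mem_piFinset.1 (Finset.mem_filter.1 hx').1
      have hM : M x' = T' \ S := by
        by_contra hM
        exact hne (if_neg hM)
      have hT'eq : T' = S ∪ M x' := by rw [hM, Finset.union_sdiff_of_subset hST]
      have hd : Disjoint S (M x') := by
        rw [hM]
        exact Finset.disjoint_sdiff
      rw [hTS, hT'eq, setWeight_union hd, setWeight_union hMS, hwt x' hx'W, hwt x hx]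
      refine Nat.add_le_add_left (Finset.sum_le_sum fun b _ => ?_) _
      refine hmax b (x' b) (hx'W b) ((Finset.mem_filter.1 hx').2 b) ?_
      rw [← hMpart x' hx'W b, ← hpart b]
      exact (hd.symm).mono (Finset.filter_subset _ _) (Finset.filter_subset _ _)
    · exact absurd rfl hT'

/-- The enlargements, by at most `τ` elements, of the sets with `l` elements over each `b`. -/
noncomputable def enlargements (β : Z → B) (l τ : ℕ) : Finset (Finset Z) :=
  open Classical in
  Finset.univ.filter fun T => ∃ S U, (∀ b, (partOver β b S).card = l) ∧ Disjoint S U ∧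
    U.card ≤ τ ∧ T = S ∪ U

theorem card_enlargements_le {β : Z → B} {l τ N : ℕ} {y : ℝ} (hy : 1 ≤ y)
    (hN : ∀ b, (partOver β b Finset.univ).card = N)
    (hch : ∀ u : ℕ, ((N.choose (l + u) : ℕ) : ℝ) ≤ N.choose l * y ^ u) :
    ((enlargements β l τ).card : ℝ) ≤
      ((τ : ℝ) + 1) ^ Fintype.card B * (((N.choose l : ℕ) : ℝ) ^ Fintype.card B * y ^ τ) := by
  classical
  let I : Finset (B → ℕ) :=
    (Fintype.piFinset fun _ : B => Finset.range (τ + 1)).filter fun u => ∑ b, u b ≤ τ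
  let D : (B → ℕ) → Finset (Finset Z) := fun u =>
    Finset.univ.filter fun T => ∀ b, (partOver β b T).card = l + u b
  have hsub : enlargements β l τ ⊆ I.biUnion D := by
    intro T hT
    simp only [enlargements, Finset.mem_filter, Finset.mem_univ, true_and] at hT
    obtain ⟨S, U, hS, hSU, hU, rfl⟩ := hT
    have hsum : ∑ b, (partOver β b U).card ≤ τ := by
      refine le_trans (le_of_eq ?_) hU
      exact (Finset.card_eq_sum_card_fiberwise (f := β) (s := U) (t := Finset.univ)
        fun z _ => Finset.mem_coe.2 (Finset.mem_univ _)).symm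
    rw [Finset.mem_biUnion]
    refine ⟨fun b => (partOver β b U).card, Finset.mem_filter.2 ⟨?_, hsum⟩, ?_⟩
    · refine Fintype.mem_piFinset.2 fun b => Finset.mem_range.2 (Nat.lt_succ_of_le ?_)
      exact (Finset.card_le_card (Finset.filter_subset _ _)).trans hU
    · refine Finset.mem_filter.2 ⟨Finset.mem_univ _, fun b => ?_⟩
      rw [partOver, Finset.filter_union, Finset.card_union_of_disjoint]
      · rw [← hS b]
        rfl
      · exact hSU.mono (Finset.filter_subset _ _) (Finset.filter_subset _ _)
  have hD : ∀ u, (D u).card ≤ ∏ b, N.choose (l + u b) := by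
    intro u
    have h1 : (D u).card ≤ (Fintype.piFinset fun b =>
        (partOver β b Finset.univ).powersetCard (l + u b)).card := by
      refine Finset.card_le_card_of_injOn (fun T b => partOver β b T) ?_ ?_
      · intro T hT
        refine Finset.mem_coe.2 (Fintype.mem_piFinset.2 fun b => Finset.mem_powersetCard.2 ⟨?_, ?_⟩)
        · exact Finset.filter_subset_filter _ (Finset.subset_univ _)
        · exact (Finset.mem_filter.1 hT).2 b
      · intro T _ T' _ h
        rw [← biUnion_partOver β T, ← biUnion_partOver β T']
        exact congrArg _ h
    rw [Fintype.card_piFinset] at h1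
    simpa [Finset.card_powersetCard, hN] using h1
  have hterm : ∀ u ∈ I, ((D u).card : ℝ) ≤ ((N.choose l : ℕ) : ℝ) ^ Fintype.card B * y ^ τ := by
    intro u hu
    have h1 : ((D u).card : ℝ) ≤ ∏ b, ((N.choose (l + u b) : ℕ) : ℝ) := by
      exact_mod_cast hD u
    refine h1.trans ((Finset.prod_le_prod (fun b _ => by positivity) fun b _ => hch (u b)).trans ?_)
    rw [Finset.prod_mul_distrib, Finset.prod_const, Finset.card_univ, Finset.prod_pow_eq_pow_sum]
    have := pow_le_pow_right₀ hy (Finset.mem_filter.1 hu).2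
    gcongr
  have hI : (I.card : ℝ) ≤ ((τ : ℝ) + 1) ^ Fintype.card B := by
    have h1 : I.card ≤ (τ + 1) ^ Fintype.card B := by
      refine (Finset.card_filter_le _ _).trans ?_
      simp
    exact_mod_cast h1
  calc ((enlargements β l τ).card : ℝ) ≤ ((I.biUnion D).card : ℝ) := by
        exact_mod_cast Finset.card_le_card hsub
    _ ≤ ∑ u ∈ I, ((D u).card : ℝ) := by exact_mod_cast Finset.card_biUnion_le
    _ ≤ ∑ u ∈ I, ((N.choose l : ℕ) : ℝ) ^ Fintype.card B * y ^ τ := Finset.sum_le_sum hterm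
    _ = (I.card : ℝ) * (((N.choose l : ℕ) : ℝ) ^ Fintype.card B * y ^ τ) := by
        rw [Finset.sum_const, nsmul_eq_mul]
    _ ≤ _ := by gcongr

end Product

/-! ### Counting sets that avoid or contain given sets -/

section Binomial

/-- An upper bound for the probability that a random set of size `q` contains a fixed set of size `u`. -/
theorem choose_sub_le {N q u : ℕ} (hu : u ≤ q) (hq : q ≤ N) :
    (((N - u).choose (q - u) : ℕ) : ℝ) ≤ N.choose q * ((q : ℝ) / N) ^ u := by
  induction u generalizing N q with
  | zero => simp
  | succ u ih =>
    obtain ⟨q, rfl⟩ : ∃ q', q = q' + 1 := ⟨q - 1, by omega⟩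
    obtain ⟨N, rfl⟩ : ∃ N', N = N' + 1 := ⟨N - 1, by omega⟩
    rw [Nat.add_sub_add_right, Nat.add_sub_add_right]
    have h1 := ih (N := N) (q := q) (by omega) (by omega)
    have h2 : ((N + 1).choose (q + 1) : ℝ) * ((q + 1 : ℕ) : ℝ) = ((N + 1 : ℕ) : ℝ) * N.choose q := by
      exact_mod_cast (Nat.add_one_mul_choose_eq N q).symm
    have hN : (0 : ℝ) < ((N + 1 : ℕ) : ℝ) := by positivity
    have h3 : (q : ℝ) / N ≤ ((q + 1 : ℕ) : ℝ) / ((N + 1 : ℕ) : ℝ) := by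
      rcases Nat.eq_zero_or_pos N with rfl | hN0
      · simp; positivity
      · rw [div_le_div_iff₀ (by exact_mod_cast hN0) hN]
        have : (q : ℝ) ≤ N := by exact_mod_cast (by omega : q ≤ N)
        push_cast
        nlinarith
    calc (((N - u).choose (q - u) : ℕ) : ℝ) ≤ N.choose q * ((q : ℝ) / N) ^ u := h1
      _ ≤ N.choose q * (((q + 1 : ℕ) : ℝ) / ((N + 1 : ℕ) : ℝ)) ^ u := by gcongr
      _ = ((N + 1).choose (q + 1) : ℝ) * (((q + 1 : ℕ) : ℝ) / ((N + 1 : ℕ) : ℝ)) ^ (u + 1) := by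
        rw [pow_succ']
        have h4 : (N.choose q : ℝ) =
            (N + 1).choose (q + 1) * (((q + 1 : ℕ) : ℝ) / ((N + 1 : ℕ) : ℝ)) := by
          rw [mul_div_assoc', h2]
          field_simp
        rw [h4]
        ring

/-- A lower bound for the probability that a random set of size `q` contains a fixed set of size `u`. -/
theorem le_choose_sub {N q u : ℕ} (hu : u ≤ q) (hq : q ≤ N) :
    (N.choose q : ℝ) * (((q - u : ℕ) : ℝ) / N) ^ u ≤ (((N - u).choose (q - u) : ℕ) : ℝ) := by
  induction u generalizing N q with
  | zero => simp
  | succ u ih =>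
    obtain ⟨q, rfl⟩ : ∃ q', q = q' + 1 := ⟨q - 1, by omega⟩
    obtain ⟨N, rfl⟩ : ∃ N', N = N' + 1 := ⟨N - 1, by omega⟩
    rw [Nat.add_sub_add_right, Nat.add_sub_add_right]
    have h1 := ih (N := N) (q := q) (by omega) (by omega)
    have h2 : ((N + 1).choose (q + 1) : ℝ) * ((q + 1 : ℕ) : ℝ) = ((N + 1 : ℕ) : ℝ) * N.choose q := by
      exact_mod_cast (Nat.add_one_mul_choose_eq N q).symm
    have hN : (0 : ℝ) < ((N + 1 : ℕ) : ℝ) := by positivity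
    have h3 : ((q - u : ℕ) : ℝ) / ((N + 1 : ℕ) : ℝ) ≤ ((q - u : ℕ) : ℝ) / N := by
      rcases Nat.eq_zero_or_pos N with rfl | hN0
      · have : q = 0 := by omega
        simp [this]
      · have : (0 : ℝ) < N := by exact_mod_cast hN0
        gcongr
        simp
    have h5 : ((q - u : ℕ) : ℝ) ≤ ((q + 1 : ℕ) : ℝ) := by exact_mod_cast (by omega)
    have h4 : (N.choose q : ℝ) =
        (N + 1).choose (q + 1) * (((q + 1 : ℕ) : ℝ) / ((N + 1 : ℕ) : ℝ)) := by
      rw [mul_div_assoc', h2]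
      field_simp
    refine le_trans ?_ h1
    rw [pow_succ', h4, mul_assoc]
    gcongr

variable {ζ : Type*} [DecidableEq ζ]

theorem card_powersetCard_filter_subset_le {U V : Finset ζ} (hV : V ⊆ U) (q : ℕ) (hq : q ≤ U.card) :
    (((U.powersetCard q).filter fun T => V ⊆ T).card : ℝ) ≤
      U.card.choose q * ((q : ℝ) / U.card) ^ V.card := by
  by_cases hVq : V.card ≤ q
  · refine le_trans ?_ (choose_sub_le hVq hq)
    rw [← Finset.card_sdiff_of_subset hV, ← Finset.card_powersetCard]
    norm_cast
    refine Finset.card_le_card_of_injOn (fun T => T \ V) ?_ ?_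
    · intro T hT
      have hT := Finset.mem_filter.1 hT
      have hTU := Finset.mem_powersetCard.1 hT.1
      refine Finset.mem_coe.2 (Finset.mem_powersetCard.2 ⟨Finset.sdiff_subset_sdiff hTU.1 le_rfl, ?_⟩)
      rw [Finset.card_sdiff_of_subset hT.2, hTU.2]
    · intro T hT T' hT' h
      have hT := (Finset.mem_filter.1 hT).2
      have hT' := (Finset.mem_filter.1 hT').2
      rw [← Finset.sdiff_union_of_subset hT, ← Finset.sdiff_union_of_subset hT']
      exact congrArg (· ∪ V) h
  · rw [Finset.filter_false_of_mem]
    · simp; positivity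
    · intro T hT hVT
      have := Finset.card_le_card hVT
      rw [(Finset.mem_powersetCard.1 hT).2] at this
      exact hVq this

theorem card_powersetCard_filter_disjoint {U V : Finset ζ} (hV : V ⊆ U) (l : ℕ) :
    ((U.powersetCard l).filter fun S => Disjoint V S).card = (U.card - V.card).choose l := by
  rw [← Finset.card_sdiff_of_subset hV, ← Finset.card_powersetCard]
  congr 1
  ext S
  simp only [Finset.mem_filter, Finset.mem_powersetCard, Finset.subset_sdiff]
  constructor
  · rintro ⟨⟨h1, h2⟩, h3⟩
    exact ⟨⟨h1, h3.symm⟩, h2⟩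
  · rintro ⟨⟨h1, h3⟩, h2⟩
    exact ⟨⟨h1, h2⟩, h3.symm⟩

theorem card_powersetCard_filter_disjoint_le {U V : Finset ζ} (hV : V ⊆ U) (l : ℕ)
    (hl : l ≤ U.card) :
    (((U.powersetCard l).filter fun S => Disjoint V S).card : ℝ) ≤
      U.card.choose l * (((U.card - l : ℕ) : ℝ) / U.card) ^ V.card := by
  rw [card_powersetCard_filter_disjoint hV]
  by_cases h : V.card ≤ U.card - l
  · have := choose_sub_le h (Nat.sub_le U.card l)
    rw [Nat.choose_symm hl] at this
    have h2 : (U.card - V.card).choose (U.card - l - V.card) = (U.card - V.card).choose l := by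
      rw [← Nat.choose_symm (n := U.card - V.card) (k := l) (by omega)]
      congr 1
      omega
    rwa [h2] at this
  · have := Finset.card_le_card hV
    rw [Nat.choose_eq_zero_of_lt (by omega)]
    simp; positivity

end Binomial

/-! ### The number of leading sets on one side of a block -/

section LeadCount

variable {Z P A : Type*} [Fintype Z] [DecidableEq Z] [DecidableEq A]

/-- The number of triples of two paths with a common start and a set with `l` elements that avoids
both. -/
def avoidPairs (U : Finset Z) (l : ℕ) (W : Finset P) (start : P → A) (m : P → Finset Z) : ℕ :=
  ∑ p ∈ W ×ˢ W with start p.1 = start p.2,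
    ((U.powersetCard l).filter fun S => Disjoint (m p.1 ∪ m p.2) S).card

/-- The number of triples of two paths and a set with `q` elements that contains both. -/
def containPairs (U : Finset Z) (q : ℕ) (W : Finset P) (m : P → Finset Z) : ℕ :=
  ∑ p ∈ W ×ˢ W, ((U.powersetCard q).filter fun T => m p.1 ∪ m p.2 ⊆ T).card

/-- Two applications of the Cauchy–Schwarz inequality: one bounds the number of pairs of a start and
a set `S` avoided by some path from that start, the other the number of leading sets obtained from
these pairs. -/
theorem pow_four_le_card_leadSets [Fintype A] {U : Finset Z} {l k : ℕ} {W : Finset P}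
    {start : P → A} {m : P → Finset Z} (hm : ∀ x ∈ W, m x ⊆ U) (hk : ∀ x ∈ W, (m x).card = k) :
    (W.card * (U.card - k).choose l) ^ 4 ≤
      (leadSets U l W start m).card * containPairs U (l + k) W m *
        avoidPairs U l W start m ^ 2 := by
  classical
  rcases W.eq_empty_or_nonempty with rfl | ⟨x₀, -⟩
  · simp
  have : Nonempty P := ⟨x₀⟩
  let R := U.powersetCard l
  let s : A × Finset Z → Finset P := fun q =>
    W.filter fun x => start x = q.1 ∧ Disjoint (m x) q.2
  let X : Finset (A × Finset Z) := ((Finset.univ : Finset A) ×ˢ R).filter fun q => (s q).Nonempty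
  have hsum : ∑ q ∈ X, (s q).card = W.card * (U.card - k).choose l := by
    have h0 : ∑ q ∈ X, (s q).card = ∑ q ∈ (Finset.univ : Finset A) ×ˢ R, (s q).card := by
      refine Finset.sum_filter_of_ne fun q _ h => ?_
      rwa [← Finset.card_pos, Nat.pos_iff_ne_zero]
    rw [h0]
    simp only [s, Finset.card_filter]
    rw [Finset.sum_comm, Finset.card_eq_sum_ones W, Finset.sum_mul]
    refine Finset.sum_congr rfl fun x hx => ?_
    rw [one_mul, ← hk x hx, ← card_powersetCard_filter_disjoint (hm x hx) l, Finset.card_filter,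
      Finset.sum_product, Finset.sum_eq_single (start x)]
    · simp [R]
    · intro a _ ha
      simp [Ne.symm ha]
    · simp
  have hsq : ∑ q ∈ X, (s q).card ^ 2 ≤ avoidPairs U l W start m := by
    have h0 : ∑ q ∈ X, (s q).card ^ 2 ≤ ∑ q ∈ (Finset.univ : Finset A) ×ˢ R, (s q).card ^ 2 :=
      Finset.sum_le_sum_of_subset (Finset.filter_subset _ _)
    refine h0.trans (le_of_eq ?_)
    have h1 : ∀ q, (s q).card ^ 2 = ∑ p ∈ W ×ˢ W,
        if (start p.1 = q.1 ∧ Disjoint (m p.1) q.2) ∧ (start p.2 = q.1 ∧ Disjoint (m p.2) q.2)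
          then 1 else 0 := by
      intro q
      rw [sq, ← Finset.card_product, ← Finset.filter_product, Finset.card_filter]
    simp only [h1]
    rw [Finset.sum_comm, avoidPairs, Finset.sum_filter]
    refine Finset.sum_congr rfl fun p _ => ?_
    rw [Finset.sum_product, Finset.sum_eq_single (start p.1)]
    · by_cases h : start p.1 = start p.2
      · simp only [h, true_and, if_true, Finset.card_filter, Finset.disjoint_union_left, R]
      · simp [h, Ne.symm h]
    · intro a _ ha
      simp [Ne.symm ha]
    · simp
  have hCS1 : (W.card * (U.card - k).choose l) ^ 2 ≤ X.card * avoidPairs U l W start m := by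
    rw [← hsum]
    exact (sq_sum_le_card_mul_sum_sq (α := ℕ)).trans (Nat.mul_le_mul_left _ hsq)
  -- For each pair in `X` select a path of largest weight.
  have hsel : ∀ q ∈ X, ∃ x ∈ s q, ∀ x' ∈ s q, setWeight (m x') ≤ setWeight (m x) := fun q hq =>
    Finset.exists_max_image (s q) (fun x => setWeight (m x)) (Finset.mem_filter.1 hq).2
  choose! sel hsel_mem hsel_max using hsel
  let Φ : A × Finset Z → Finset Z := fun q => q.2 ∪ m (sel q)
  let L := leadSets U l W start m
  have hXs : ∀ q ∈ X, q.2 ⊆ U ∧ q.2.card = l ∧ sel q ∈ W ∧ start (sel q) = q.1 ∧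
      Disjoint (m (sel q)) q.2 := by
    intro q hq
    have h1 := Finset.mem_powersetCard.1
      (Finset.mem_product.1 (Finset.mem_filter.1 hq).1).2
    have h2 := Finset.mem_filter.1 (hsel_mem q hq)
    exact ⟨h1.1, h1.2, h2.1, h2.2.1, h2.2.2⟩
  have hΦL : ∀ q ∈ X, Φ q ∈ L := by
    intro q hq
    obtain ⟨h1, h2, h3, h4, h5⟩ := hXs q hq
    simp only [L, leadSets, Finset.mem_filter, Finset.mem_univ, true_and]
    refine ⟨q.2, Finset.mem_powersetCard.2 ⟨h1, h2⟩, sel q, h3, h5, rfl, fun x' hx' hst hd => ?_⟩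
    exact hsel_max q hq x' (Finset.mem_filter.2 ⟨hx', hst.trans h4, hd⟩)
  have hLsub : L ⊆ U.powersetCard (l + k) := by
    intro T hT
    simp only [L, leadSets, Finset.mem_filter, Finset.mem_univ, true_and] at hT
    obtain ⟨S, hS, x, hx, hd, rfl, -⟩ := hT
    have hS := Finset.mem_powersetCard.1 hS
    rw [Finset.mem_powersetCard, Finset.card_union_of_disjoint hd.symm, hS.2, hk x hx]
    exact ⟨Finset.union_subset hS.1 (hm x hx), rfl⟩
  have hfib : ∀ T, (X.filter fun q => Φ q = T).card ≤ (W.filter fun x => m x ⊆ T).card := by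
    intro T
    refine Finset.card_le_card_of_injOn sel ?_ ?_
    · intro q hq
      have hq := Finset.mem_filter.1 hq
      refine Finset.mem_coe.2 (Finset.mem_filter.2 ⟨(hXs q hq.1).2.2.1, ?_⟩)
      rw [← hq.2]
      exact Finset.subset_union_right
    · intro q hq q' hq' h
      have hq := Finset.mem_filter.1 hq
      have hq' := Finset.mem_filter.1 hq'
      obtain ⟨-, -, -, h4, h5⟩ := hXs q hq.1
      obtain ⟨-, -, -, h4', h5'⟩ := hXs q' hq'.1
      refine Prod.ext (by rw [← h4, ← h4', h]) ?_
      have e1 : q.2 = T \ m (sel q) := by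
        rw [← hq.2, Finset.union_sdiff_cancel_right h5.symm]
      have e2 : q'.2 = T \ m (sel q') := by
        rw [← hq'.2, Finset.union_sdiff_cancel_right h5'.symm]
      rw [e1, e2, h]
  have hXcard : X.card = ∑ T ∈ L, (X.filter fun q => Φ q = T).card :=
    Finset.card_eq_sum_card_fiberwise hΦL
  have hCS2 : X.card ^ 2 ≤ L.card * containPairs U (l + k) W m := by
    calc X.card ^ 2 ≤ (∑ T ∈ L, (W.filter fun x => m x ⊆ T).card) ^ 2 := by
          rw [hXcard]
          exact Nat.pow_le_pow_left (Finset.sum_le_sum fun T _ => hfib T) 2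
      _ ≤ L.card * ∑ T ∈ L, (W.filter fun x => m x ⊆ T).card ^ 2 :=
          sq_sum_le_card_mul_sum_sq (α := ℕ)
      _ ≤ L.card * ∑ T ∈ U.powersetCard (l + k), (W.filter fun x => m x ⊆ T).card ^ 2 :=
          Nat.mul_le_mul_left _ (Finset.sum_le_sum_of_subset hLsub)
      _ = L.card * containPairs U (l + k) W m := by
          congr 1
          have h1 : ∀ T, (W.filter fun x => m x ⊆ T).card ^ 2 = ∑ p ∈ W ×ˢ W,
              if m p.1 ∪ m p.2 ⊆ T then 1 else 0 := by
            intro T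
            rw [sq, ← Finset.card_product, ← Finset.filter_product, Finset.card_filter]
            simp only [Finset.union_subset_iff]
          simp only [h1]
          rw [Finset.sum_comm, containPairs]
          simp only [Finset.card_filter]
  calc (W.card * (U.card - k).choose l) ^ 4 = ((W.card * (U.card - k).choose l) ^ 2) ^ 2 := by ring
    _ ≤ (X.card * avoidPairs U l W start m) ^ 2 := Nat.pow_le_pow_left hCS1 2
    _ = X.card ^ 2 * avoidPairs U l W start m ^ 2 := by ring
    _ ≤ _ := Nat.mul_le_mul_right _ hCS2

end LeadCount

/-! ### Sums over walks -/

section WalkSum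

/-- A supersolution `h` of the transfer operators `K j` bounds the total weight of all walks. -/
theorem sum_walks_le {S : Type*} [Fintype S] {k : ℕ} (K : Fin k → S → S → ℝ) (φ : S → ℝ)
    (h : ℕ → S → ℝ) (hK : ∀ j s s', 0 ≤ K j s s') (hφ : ∀ s, 0 ≤ φ s)
    (hh : ∀ (j : Fin k) (s : S), ∑ s', K j s s' * h (j.val + 1) s' ≤ h j.val s) :
    ∑ x : Fin (k + 1) → S,
        φ (x 0) * (∏ j : Fin k, K j (x j.castSucc) (x j.succ)) * h k (x (Fin.last k)) ≤
      ∑ s, φ s * h 0 s := by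
  induction k with
  | zero =>
    rw [← (Equiv.funUnique (Fin 1) S).symm.sum_comp]
    simp [Equiv.funUnique]
  | succ k ih =>
    have ih := ih (fun j => K j.castSucc) (fun j s s' => hK _ s s') (fun j s => hh j.castSucc s)
    refine le_trans ?_ ih
    rw [← (Fin.snocEquiv fun _ : Fin (k + 2) => S).sum_comp, Fintype.sum_prod_type_right]
    refine Finset.sum_le_sum fun x _ => ?_
    have h1 : ∀ s : S, φ ((Fin.snocEquiv fun _ : Fin (k + 2) => S) (s, x) 0) *
        (∏ j : Fin (k + 1), K j ((Fin.snocEquiv fun _ : Fin (k + 2) => S) (s, x) j.castSucc)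
          ((Fin.snocEquiv fun _ : Fin (k + 2) => S) (s, x) j.succ)) *
        h (k + 1) ((Fin.snocEquiv fun _ : Fin (k + 2) => S) (s, x) (Fin.last (k + 1))) =
        (φ (x 0) * ∏ j : Fin k, K j.castSucc (x j.castSucc) (x j.succ)) *
          (K (Fin.last k) (x (Fin.last k)) s * h (k + 1) s) := by
      intro s
      rw [Fin.prod_univ_castSucc]
      have h0 : (0 : Fin (k + 2)) = (0 : Fin (k + 1)).castSucc := rfl
      simp only [Fin.snocEquiv_apply, Fin.snoc_castSucc, Fin.succ_castSucc, Fin.succ_last,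
        Fin.snoc_last, h0]
      ring
    simp only [h1]
    rw [← Finset.mul_sum]
    refine mul_le_mul_of_nonneg_left (hh (Fin.last k) (x (Fin.last k))) ?_
    exact mul_nonneg (hφ _) (Finset.prod_nonneg fun j _ => hK _ _ _)

end WalkSum

/-! ### Random layered graphs -/

/-- A layered graph with `k + 1` layers of `n` vertices: each vertex of layer `j < k` is joined to
exactly `w j` vertices of layer `j + 1`. It encodes the kept entries on one side of a block; the
columns of the `j`-th left matrix, respectively the rows of the `j`-th right matrix, are the vertices
of layer `j - 1`. -/
abbrev LayeredGraph (n k : ℕ) (w : ℕ → ℕ) : Type :=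
  ∀ j : Fin k, Fin n → {S : Finset (Fin n) // S.card = w j.val}

namespace LayeredGraph

variable {n k : ℕ} {w : ℕ → ℕ}

/-- The walks from layer `0` to layer `k`. -/
def walks (v : LayeredGraph n k w) : Finset (Fin (k + 1) → Fin n) :=
  Finset.univ.filter fun x => ∀ j : Fin k, x j.succ ∈ (v j (x j.castSucc)).val

theorem mem_walks {v : LayeredGraph n k w} {x : Fin (k + 1) → Fin n} :
    x ∈ v.walks ↔ ∀ j : Fin k, x j.succ ∈ (v j (x j.castSucc)).val := by
  simp [walks]

theorem card_walks (v : LayeredGraph n k w) :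
    v.walks.card = n * ∏ i ∈ Finset.range k, w i := by
  have hprod : ∀ x : Fin (k + 1) → Fin n, (∏ j : Fin k,
      if x j.succ ∈ (v j (x j.castSucc)).val then (1 : ℝ) else 0) =
      if x ∈ v.walks then 1 else 0 := by
    intro x
    by_cases hx : x ∈ v.walks
    · rw [if_pos hx]
      exact Finset.prod_eq_one fun j _ => if_pos (mem_walks.1 hx j)
    · rw [if_neg hx]
      rw [mem_walks, not_forall] at hx
      obtain ⟨j, hj⟩ := hx
      exact Finset.prod_eq_zero (Finset.mem_univ j) (if_neg hj)
  have hstep : ∀ (c : ℝ) (j : Fin k) (s : Fin n), ∑ s' : Fin n,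
      (if s' ∈ (v j s).val then (1 : ℝ) else 0) * (c * ∏ i ∈ Finset.Ico (j.val + 1) k, (w i : ℝ)) =
      c * ∏ i ∈ Finset.Ico j.val k, (w i : ℝ) := by
    intro c j s
    rw [← Finset.sum_mul, Finset.prod_eq_prod_Ico_succ_bot j.isLt, Finset.sum_boole,
      Finset.filter_univ_mem, (v j s).2]
    ring
  have hle := fun c : ℝ => sum_walks_le
    (fun (j : Fin k) s s' => if s' ∈ (v j s).val then (1 : ℝ) else 0)
    (fun _ : Fin n => 1) (fun j _ => c * ∏ i ∈ Finset.Ico j k, (w i : ℝ))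
    (fun j s s' => by positivity) (fun _ => zero_le_one) (fun j s => (hstep c j s).le)
  simp only [hprod, Finset.Ico_self, Finset.prod_empty, one_mul, mul_one, ← Finset.sum_mul,
    Finset.sum_boole, Finset.sum_const, nsmul_eq_mul, Finset.filter_univ_mem, Finset.card_univ,
    Fintype.card_fin] at hle
  have h1 := hle 1
  have h2 := hle (-1)
  rw [← Finset.range_eq_Ico] at h1 h2
  have h3 : (v.walks.card : ℝ) = n * ∏ i ∈ Finset.range k, (w i : ℝ) := by linarith
  exact_mod_cast h3

/-- The number of edges used by two walks together: a level counts once if both walks use the same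
edge there. -/
def unionLen (p : (Fin (k + 1) → Fin n) × (Fin (k + 1) → Fin n)) : ℕ :=
  ∑ j : Fin k, if p.1 j.castSucc = p.2 j.castSucc ∧ p.1 j.succ = p.2 j.succ then 1 else 2

section OneLine

variable {q : ℕ}

theorem sum_subtype_card (f : Finset (Fin n) → ℝ) :
    ∑ t : {S : Finset (Fin n) // S.card = q}, f t.val =
      ∑ S ∈ (Finset.univ : Finset (Fin n)).powersetCard q, f S := by
  refine (Finset.sum_subtype _ (fun S => ?_) f).symm
  simp [Finset.mem_powersetCard]

theorem card_subtype_card :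
    Fintype.card {S : Finset (Fin n) // S.card = q} = n.choose q := by
  have := sum_subtype_card (n := n) (q := q) fun _ => 1
  simp only [Finset.sum_const, Finset.card_univ, nsmul_eq_mul, mul_one, Finset.card_powersetCard,
    Fintype.card_fin] at this
  exact_mod_cast this

/-- The number of lines of `q` kept positions that contain a given set of positions. -/
theorem sum_line_le (hq : q ≤ n) (V : Finset (Fin n)) :
    ∑ t : {S : Finset (Fin n) // S.card = q}, (if V ⊆ t.val then (1 : ℝ) else 0) ≤
      Fintype.card {S : Finset (Fin n) // S.card = q} * ((q : ℝ) / n) ^ V.card := by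
  rw [sum_subtype_card fun S => if V ⊆ S then (1 : ℝ) else 0, Finset.sum_boole, card_subtype_card]
  simpa using card_powersetCard_filter_subset_le (Finset.subset_univ V) q (by simpa using hq)

/-- The kernel that bounds the probability that two steps, from `s.1` to `s'.1` and from `s.2` to
`s'.2`, are both possible in a random layer with `q` edges at each vertex. -/
noncomputable def stepProb (n q : ℕ) (s s' : Fin n × Fin n) : ℝ :=
  if s.1 = s.2 ∧ s'.1 = s'.2 then (q : ℝ) / n else ((q : ℝ) / n) ^ 2

theorem sum_layer_le (hq : q ≤ n) (s s' : Fin n × Fin n) :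
    ∑ y : Fin n → {S : Finset (Fin n) // S.card = q},
        (if s'.1 ∈ (y s.1).val ∧ s'.2 ∈ (y s.2).val then (1 : ℝ) else 0) ≤
      Fintype.card (Fin n → {S : Finset (Fin n) // S.card = q}) * stepProb n q s s' := by
  classical
  let N : ℝ := Fintype.card {S : Finset (Fin n) // S.card = q}
  -- The positions asked for in line `c`.
  let D : Fin n → Finset (Fin n) := fun c =>
    (if s.1 = c then {s'.1} else ∅) ∪ (if s.2 = c then {s'.2} else ∅)
  have h1 : ∀ y : Fin n → {S : Finset (Fin n) // S.card = q},
      (if s'.1 ∈ (y s.1).val ∧ s'.2 ∈ (y s.2).val then (1 : ℝ) else 0) =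
        ∏ c, if D c ⊆ (y c).val then (1 : ℝ) else 0 := by
    intro y
    rw [Finset.prod_boole]
    congr 1
    simp only [D, Finset.union_subset_iff, Finset.mem_univ, true_implies, eq_iff_iff]
    constructor
    · rintro ⟨ha, hb⟩ c
      constructor
      · split_ifs with h
        · subst h; simpa using ha
        · simp
      · split_ifs with h
        · subst h; simpa using hb
        · simp
    · intro h
      have ha := (h s.1).1
      have hb := (h s.2).2
      rw [if_pos rfl, Finset.singleton_subset_iff] at ha hb
      exact ⟨ha, hb⟩
  have h2 : ∑ y : Fin n → {S : Finset (Fin n) // S.card = q},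
      ∏ c, (if D c ⊆ (y c).val then (1 : ℝ) else 0) ≤
        ∏ c, (N * ((q : ℝ) / n) ^ (D c).card) := by
    have := Finset.prod_univ_sum (fun _ : Fin n =>
      (Finset.univ : Finset {S : Finset (Fin n) // S.card = q}))
      (fun c t => if D c ⊆ t.val then (1 : ℝ) else 0)
    rw [Fintype.piFinset_univ] at this
    rw [← this]
    refine Finset.prod_le_prod (fun c _ => Finset.sum_nonneg fun t _ => by positivity) fun c _ => ?_
    exact sum_line_le hq (D c)
  simp only [h1]
  refine h2.trans (le_of_eq ?_)
  rw [Finset.prod_mul_distrib, Finset.prod_const, Finset.prod_pow_eq_pow_sum, Fintype.card_fun]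
  have hN : N ^ (Finset.univ : Finset (Fin n)).card =
      ((Fintype.card {S : Finset (Fin n) // S.card = q} ^ Fintype.card (Fin n) : ℕ) : ℝ) := by
    push_cast
    rfl
  rw [hN]
  congr 1
  have hsum : ∑ c, (D c).card = if s.1 = s.2 ∧ s'.1 = s'.2 then 1 else 2 := by
    by_cases hs : s.1 = s.2
    · have : ∀ c, (D c).card = if s.2 = c then ({s'.1, s'.2} : Finset (Fin n)).card else 0 := by
        intro c
        simp only [D, hs]
        split_ifs
        · rfl
        · simp
      simp only [this, Finset.sum_ite_eq, Finset.mem_univ, if_true, hs, true_and]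
      split_ifs with h
      · simp [h]
      · exact Finset.card_pair h
    · have : ∀ c, (D c).card = (if s.1 = c then 1 else 0) + (if s.2 = c then 1 else 0) := by
        intro c
        simp only [D]
        by_cases ha : s.1 = c
        · have hb : s.2 ≠ c := fun hb => hs (ha.trans hb.symm)
          simp [ha, hb]
        · by_cases hb : s.2 = c <;> simp [ha, hb]
      simp [this, Finset.sum_add_distrib, hs]
  rw [hsum, stepProb]
  split_ifs <;> simp

end OneLine

/-- The expected weight of the pairs of walks is at most the weight of the pairs of walks for the
product of the kernels. -/
theorem sum_pairs_le (hw : ∀ j < k, w j ≤ n) (φ : Fin n × Fin n → ℝ) (hφ : ∀ s, 0 ≤ φ s)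
    {θ : ℝ} (hθ : 0 ≤ θ) :
    ∑ v : LayeredGraph n k w, ∑ p ∈ v.walks ×ˢ v.walks, φ (p.1 0, p.2 0) * θ ^ unionLen p ≤
      Fintype.card (LayeredGraph n k w) * ∑ x : Fin (k + 1) → Fin n × Fin n,
        φ (x 0) * ∏ j : Fin k, (stepProb n (w j) (x j.castSucc) (x j.succ) *
          θ ^ (if (x j.castSucc).1 = (x j.castSucc).2 ∧ (x j.succ).1 = (x j.succ).2
            then 1 else 2)) := by
  classical
  have h1 : ∀ v : LayeredGraph n k w,
      ∑ p ∈ v.walks ×ˢ v.walks, φ (p.1 0, p.2 0) * θ ^ unionLen p =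
        ∑ p : (Fin (k + 1) → Fin n) × (Fin (k + 1) → Fin n),
          (φ (p.1 0, p.2 0) * θ ^ unionLen p) * ∏ j : Fin k,
            if p.1 j.succ ∈ (v j (p.1 j.castSucc)).val ∧ p.2 j.succ ∈ (v j (p.2 j.castSucc)).val
              then (1 : ℝ) else 0 := by
    intro v
    have h2 : v.walks ×ˢ v.walks = Finset.univ.filter
        fun p : (Fin (k + 1) → Fin n) × (Fin (k + 1) → Fin n) => ∀ j : Fin k,
          p.1 j.succ ∈ (v j (p.1 j.castSucc)).val ∧ p.2 j.succ ∈ (v j (p.2 j.castSucc)).val := by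
      ext p
      simp [mem_walks, forall_and]
    rw [h2, Finset.sum_filter]
    refine Finset.sum_congr rfl fun p _ => ?_
    rw [Finset.prod_boole]
    simp
  simp only [h1]
  rw [Finset.sum_comm, ← (Equiv.arrowProdEquivProdArrow (Fin (k + 1)) (fun _ => Fin n)
    (fun _ => Fin n)).sum_comp, Finset.mul_sum]
  refine Finset.sum_le_sum fun x _ => ?_
  simp only [Equiv.arrowProdEquivProdArrow, Equiv.coe_fn_mk]
  rw [← Finset.mul_sum]
  have h3 : ∑ v : LayeredGraph n k w, ∏ j : Fin k,
      (if (x j.succ).1 ∈ (v j (x j.castSucc).1).val ∧ (x j.succ).2 ∈ (v j (x j.castSucc).2).val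
        then (1 : ℝ) else 0) ≤
      Fintype.card (LayeredGraph n k w) *
        ∏ j : Fin k, stepProb n (w j) (x j.castSucc) (x j.succ) := by
    have := Finset.prod_univ_sum (fun j : Fin k =>
      (Finset.univ : Finset (Fin n → {S : Finset (Fin n) // S.card = w j.val})))
      (fun j y => if (x j.succ).1 ∈ (y (x j.castSucc).1).val ∧
        (x j.succ).2 ∈ (y (x j.castSucc).2).val then (1 : ℝ) else 0)
    rw [Fintype.piFinset_univ] at this
    rw [← this, Fintype.card_pi, Nat.cast_prod, ← Finset.prod_mul_distrib]
    refine Finset.prod_le_prod (fun c _ => Finset.sum_nonneg fun t _ => by positivity) fun j _ => ?_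
    exact sum_layer_le (hw j j.isLt) _ _
  refine (mul_le_mul_of_nonneg_left h3 (mul_nonneg (hφ _) (pow_nonneg hθ _))).trans (le_of_eq ?_)
  rw [Finset.prod_mul_distrib, Finset.prod_pow_eq_pow_sum]
  simp only [unionLen]
  ring

/-- The weight of pairs of walks, for sequences `e` and `f` that bound the weight after level `j`,
relative to two independent walks, when the walks are at the same vertex (`e j`) or at different
vertices (`f j`) of level `j`. -/
theorem sum_pairs_le_of_supersolution (hn : 0 < n) (hw : ∀ j < k, w j ≤ n)
    (hw1 : ∀ j < k, 1 ≤ w j) (φ : Fin n × Fin n → ℝ) (hφ : ∀ s, 0 ≤ φ s) {θ : ℝ} (hθ : 0 < θ)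
    {e f : ℕ → ℝ} (he0 : ∀ j, 0 ≤ e j) (hf0 : ∀ j, 0 ≤ f j) (hek : 1 ≤ e k) (hfk : 1 ≤ f k)
    (he : ∀ j < k, e (j + 1) / (w j * θ) + f (j + 1) ≤ e j)
    (hf : ∀ j < k, e (j + 1) / n + f (j + 1) ≤ f j) :
    ∑ v : LayeredGraph n k w, ∑ p ∈ v.walks ×ˢ v.walks, φ (p.1 0, p.2 0) * θ ^ unionLen p ≤
      Fintype.card (LayeredGraph n k w) * ((∏ i ∈ Finset.range k, (w i * θ)) ^ 2 *
        ∑ s, φ s * (if s.1 = s.2 then e 0 else f 0)) := by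
  refine (sum_pairs_le hw φ hφ hθ.le).trans (mul_le_mul_of_nonneg_left ?_ (Nat.cast_nonneg _))
  let G : ℕ → ℝ := fun j => (∏ i ∈ Finset.Ico j k, (w i * θ)) ^ 2
  let K : Fin k → Fin n × Fin n → Fin n × Fin n → ℝ := fun j s s' =>
    stepProb n (w j) s s' * θ ^ (if s.1 = s.2 ∧ s'.1 = s'.2 then 1 else 2)
  let h : ℕ → Fin n × Fin n → ℝ := fun j s => G j * (if s.1 = s.2 then e j else f j)
  have hK : ∀ j s s', 0 ≤ K j s s' := by
    intro j s s'
    simp only [K, stepProb]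
    split_ifs <;> positivity
  have hG0 : ∀ j, 0 ≤ G j := fun j => sq_nonneg _
  have hnR : (0 : ℝ) < n := by exact_mod_cast hn
  have hdiag : ∑ s' : Fin n × Fin n, (if s'.1 = s'.2 then (1 : ℝ) else 0) = n := by
    rw [Fintype.sum_prod_type]
    simp
  have hall : ∑ s' : Fin n × Fin n, (1 : ℝ) = (n : ℝ) ^ 2 := by
    simp [Fintype.card_prod, sq]
  have hh : ∀ (j : Fin k) (s : Fin n × Fin n), ∑ s', K j s s' * h (j.val + 1) s' ≤ h j.val s := by
    intro j s
    have hwj : (0 : ℝ) < w j := by exact_mod_cast hw1 j j.isLt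
    have hGj : G j.val = (w j * θ) ^ 2 * G (j.val + 1) := by
      simp only [G]
      rw [Finset.prod_eq_prod_Ico_succ_bot j.isLt, mul_pow]
    by_cases hs : s.1 = s.2
    · have hb : ∀ s', K j s s' * h (j.val + 1) s' ≤
          ((w j : ℝ) / n * θ * (G (j.val + 1) * e (j.val + 1))) *
            (if s'.1 = s'.2 then (1 : ℝ) else 0) +
          (((w j : ℝ) / n) ^ 2 * θ ^ 2 * (G (j.val + 1) * f (j.val + 1))) * 1 := by
        intro s'
        have p1 : 0 ≤ (w j : ℝ) / n * θ * (G (j.val + 1) * e (j.val + 1)) := by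
          have := hG0 (j.val + 1); have := he0 (j.val + 1); positivity
        have p2 : 0 ≤ ((w j : ℝ) / n) ^ 2 * θ ^ 2 * (G (j.val + 1) * f (j.val + 1)) := by
          have := hG0 (j.val + 1); have := hf0 (j.val + 1); positivity
        by_cases hs' : s'.1 = s'.2
        · simp only [K, h, stepProb, hs, hs', and_self, if_true, pow_one]
          linarith
        · simp only [K, h, stepProb, hs, hs', and_false, if_false]
          linarith
      refine (Finset.sum_le_sum fun s' _ => hb s').trans ?_
      rw [Finset.sum_add_distrib, ← Finset.mul_sum, ← Finset.mul_sum, hdiag, hall]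
      have h1 : h j.val s = G j.val * e j.val := by simp [h, hs]
      rw [h1]
      refine le_trans (le_of_eq ?_) (mul_le_mul_of_nonneg_left (he j j.isLt) (hG0 _))
      rw [hGj]
      field_simp
    · have hb : ∀ s', K j s s' * h (j.val + 1) s' ≤
          (((w j : ℝ) / n) ^ 2 * θ ^ 2 * (G (j.val + 1) * e (j.val + 1))) *
            (if s'.1 = s'.2 then (1 : ℝ) else 0) +
          (((w j : ℝ) / n) ^ 2 * θ ^ 2 * (G (j.val + 1) * f (j.val + 1))) * 1 := by
        intro s'
        have p2 : 0 ≤ ((w j : ℝ) / n) ^ 2 * θ ^ 2 * (G (j.val + 1) * f (j.val + 1)) := by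
          have := hG0 (j.val + 1); have := hf0 (j.val + 1); positivity
        by_cases hs' : s'.1 = s'.2
        · simp only [K, h, stepProb, hs, hs', false_and, if_true, if_false]
          linarith
        · simp only [K, h, stepProb, hs, hs', and_false, if_false]
          linarith
      refine (Finset.sum_le_sum fun s' _ => hb s').trans ?_
      rw [Finset.sum_add_distrib, ← Finset.mul_sum, ← Finset.mul_sum, hdiag, hall]
      have h1 : h j.val s = G j.val * f j.val := by simp [h, hs]
      rw [h1]
      refine le_trans (le_of_eq ?_) (mul_le_mul_of_nonneg_left (hf j j.isLt) (hG0 _))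
      rw [hGj]
      field_simp
  have key := sum_walks_le K φ h hK hφ hh
  refine le_trans (Finset.sum_le_sum fun x _ => ?_) (key.trans (le_of_eq ?_))
  · have h1 : 1 ≤ h k (x (Fin.last k)) := by
      simp only [h, G, Finset.Ico_self, Finset.prod_empty, one_pow, one_mul]
      split_ifs <;> assumption
    refine le_mul_of_one_le_right ?_ h1
    exact mul_nonneg (hφ _) (Finset.prod_nonneg fun j _ => hK _ _ _)
  · rw [Finset.mul_sum]
    refine Finset.sum_congr rfl fun s _ => ?_
    simp only [h, G, ← Finset.range_eq_Ico]
    ring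

end LayeredGraph

/-! ### Pairs of walks and branching numbers -/

namespace LayeredGraph

variable {n k : ℕ} {w : ℕ → ℕ}

/-- The weights of pairs of walks when all products of the numbers `(w i * θ)⁻¹` over intervals are
small compared to `n`: two independent walks rarely meet, and the pairs with the same start are
governed by the level at which they separate. -/
theorem sum_pairs_bounds (hn : 0 < n) (hw : ∀ j < k, w j ≤ n) (hw1 : ∀ j < k, 1 ≤ w j)
    {θ M : ℝ} (hθ : 0 < θ)
    (hM : ∀ j j', j ≤ j' → j' ≤ k → ∏ i ∈ Finset.Ico j j', ((w i : ℝ) * θ)⁻¹ ≤ M)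
    (hMn : 2 * ((k : ℝ) + 1) ^ 2 * M ≤ n) :
    (∑ v : LayeredGraph n k w, ∑ p ∈ v.walks ×ˢ v.walks with p.1 0 = p.2 0, θ ^ unionLen p ≤
      Fintype.card (LayeredGraph n k w) * (n * ((∏ i ∈ Finset.range k, ((w i : ℝ) * θ)) *
        (2 * ∑ j ∈ Finset.Icc 0 k, ∏ i ∈ Finset.Ico j k, ((w i : ℝ) * θ))))) ∧
    ∑ v : LayeredGraph n k w, ∑ p ∈ v.walks ×ˢ v.walks, θ ^ unionLen p ≤
      Fintype.card (LayeredGraph n k w) * ((∏ i ∈ Finset.range k, ((w i : ℝ) * θ)) ^ 2 *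
        (3 * (n : ℝ) ^ 2)) := by
  classical
  let a : ℕ → ℝ := fun i => (w i : ℝ) * θ
  -- Walks that are together at level `j` separate at some level `j'`; `e j` sums the costs of this, with
  -- a factor `2` for later meetings. Walks apart at level `j` may meet at any later level.
  let e : ℕ → ℝ := fun j => 2 * ∑ j' ∈ Finset.Icc j k, ∏ i ∈ Finset.Ico j j', (a i)⁻¹
  let f : ℕ → ℝ := fun j => 1 + (∑ i ∈ Finset.Ioc j k, e i) / n
  have hnR : (0 : ℝ) < n := by exact_mod_cast hn
  have ha0 : ∀ i, 0 ≤ a i := fun i => by positivity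
  have ha : ∀ i < k, 0 < a i := fun i hi => by
    have : (0 : ℝ) < w i := by exact_mod_cast hw1 i hi
    positivity
  have he0 : ∀ j, 0 ≤ e j := fun j => by
    refine mul_nonneg zero_le_two (Finset.sum_nonneg fun j' _ => Finset.prod_nonneg fun i _ => ?_)
    exact inv_nonneg.2 (ha0 i)
  have hf0 : ∀ j, 0 ≤ f j := fun j => by
    have := Finset.sum_nonneg fun i (_ : i ∈ Finset.Ioc j k) => he0 i
    positivity
  have hM0 : 0 ≤ M := by
    have := hM k k le_rfl le_rfl
    simp only [Finset.Ico_self, Finset.prod_empty] at this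
    linarith
  have heM : ∀ j, e j ≤ 2 * ((k + 1) * M) := by
    intro j
    refine mul_le_mul_of_nonneg_left ?_ zero_le_two
    refine (Finset.sum_le_sum fun j' hj' => hM j j' (Finset.mem_Icc.1 hj').1
      (Finset.mem_Icc.1 hj').2).trans ?_
    rw [Finset.sum_const, nsmul_eq_mul, Nat.card_Icc]
    refine mul_le_mul_of_nonneg_right ?_ hM0
    exact_mod_cast Nat.sub_le _ _
  have hf2 : ∀ j, f j ≤ 2 := by
    intro j
    have h1 : ∑ i ∈ Finset.Ioc j k, e i ≤ n := by
      refine (Finset.sum_le_sum fun i _ => heM i).trans ?_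
      rw [Finset.sum_const, nsmul_eq_mul, Nat.card_Ioc]
      refine le_trans ?_ hMn
      have h2 : ((k - j : ℕ) : ℝ) ≤ (k : ℝ) + 1 := by exact_mod_cast (by omega)
      calc ((k - j : ℕ) : ℝ) * (2 * ((k + 1) * M)) ≤ ((k : ℝ) + 1) * (2 * ((k + 1) * M)) := by
            gcongr
        _ = _ := by ring
    have h3 : (∑ i ∈ Finset.Ioc j k, e i) / n ≤ 1 := (div_le_one hnR).2 h1
    simp only [f]
    linarith
  have hek : 1 ≤ e k := by simp [e]
  have hfk : 1 ≤ f k := by simp [f]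
  have he : ∀ j < k, e (j + 1) / (w j * θ) + f (j + 1) ≤ e j := by
    intro j hj
    have h1 : e j = 2 + e (j + 1) / a j := by
      simp only [e]
      rw [← Finset.add_sum_Ioc_eq_sum_Icc hj.le, Finset.Ico_self, Finset.prod_empty, mul_add,
        mul_one, mul_div_assoc, Finset.sum_div]
      congr 2
      refine Finset.sum_congr ?_ fun j' hj' => ?_
      · ext i; simp
      · rw [Finset.prod_eq_prod_Ico_succ_bot (by simp at hj'; omega), div_eq_mul_inv, mul_comm]
    have := hf2 (j + 1)
    rw [h1]
    linarith
  have hf : ∀ j < k, e (j + 1) / n + f (j + 1) ≤ f j := by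
    intro j hj
    have h1 : ∑ i ∈ Finset.Ioc j k, e i = e (j + 1) + ∑ i ∈ Finset.Ioc (j + 1) k, e i := by
      rw [Finset.add_sum_Ioc_eq_sum_Icc (by omega)]
      refine Finset.sum_congr ?_ fun _ _ => rfl
      ext i; simp
    simp only [f]
    rw [h1, add_div]
    linarith
  have hdiag : ∑ s' : Fin n × Fin n, (if s'.1 = s'.2 then (1 : ℝ) else 0) = n := by
    rw [Fintype.sum_prod_type]
    simp
  have hall : ∑ s' : Fin n × Fin n, (1 : ℝ) = (n : ℝ) ^ 2 := by
    simp [Fintype.card_prod, sq]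
  have hprod0 : 0 ≤ ∏ i ∈ Finset.range k, a i := Finset.prod_nonneg fun i _ => ha0 i
  constructor
  · have h1 := sum_pairs_le_of_supersolution hn hw hw1
      (fun s => if s.1 = s.2 then 1 else 0) (fun s => by positivity) hθ he0 hf0 hek hfk he hf
    have h2 : ∀ v : LayeredGraph n k w,
        ∑ p ∈ v.walks ×ˢ v.walks with p.1 0 = p.2 0, θ ^ unionLen p =
          ∑ p ∈ v.walks ×ˢ v.walks, (if p.1 0 = p.2 0 then (1 : ℝ) else 0) * θ ^ unionLen p := by
      intro v
      rw [Finset.sum_filter]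
      refine Finset.sum_congr rfl fun p _ => ?_
      split_ifs <;> simp
    simp only [h2]
    refine h1.trans (le_of_eq ?_)
    congr 1
    have h3 : ∑ s : Fin n × Fin n, (if s.1 = s.2 then (1 : ℝ) else 0) *
        (if s.1 = s.2 then e 0 else f 0) = n * e 0 := by
      rw [← hdiag, Finset.sum_mul]
      refine Finset.sum_congr rfl fun s _ => ?_
      split_ifs <;> simp
    rw [h3]
    have h4 : (∏ i ∈ Finset.range k, a i) * e 0 =
        2 * ∑ j ∈ Finset.Icc 0 k, ∏ i ∈ Finset.Ico j k, a i := by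
      simp only [e]
      rw [mul_left_comm, Finset.mul_sum]
      congr 1
      refine Finset.sum_congr rfl fun j hj => ?_
      have hjk := (Finset.mem_Icc.1 hj).2
      rw [Finset.range_eq_Ico, ← Finset.prod_Ico_consecutive _ (Nat.zero_le j) hjk,
        Finset.prod_inv_distrib]
      have : ∏ i ∈ Finset.Ico 0 j, a i ≠ 0 :=
        Finset.prod_ne_zero_iff.2 fun i hi => (ha i (by simp at hi; omega)).ne'
      field_simp
    rw [← h4]
    ring
  · have h1 := sum_pairs_le_of_supersolution hn hw hw1
      (fun _ => 1) (fun s => zero_le_one) hθ he0 hf0 hek hfk he hf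
    simp only [one_mul] at h1
    refine h1.trans ?_
    refine mul_le_mul_of_nonneg_left (mul_le_mul_of_nonneg_left ?_ (sq_nonneg _))
      (Nat.cast_nonneg _)
    have h3 : ∀ s : Fin n × Fin n, (if s.1 = s.2 then e 0 else f 0) ≤
        n * (if s.1 = s.2 then (1 : ℝ) else 0) + 2 * 1 := by
      intro s
      have hen : e 0 ≤ n := by
        refine (heM 0).trans (le_trans ?_ hMn)
        have : (k : ℝ) + 1 ≤ ((k : ℝ) + 1) ^ 2 := by
          have : (0 : ℝ) ≤ k := Nat.cast_nonneg k
          nlinarith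
        calc 2 * (((k : ℝ) + 1) * M) ≤ 2 * (((k : ℝ) + 1) ^ 2 * M) := by gcongr
          _ = _ := by ring
      split_ifs
      · linarith
      · have := hf2 0
        linarith
    refine (Finset.sum_le_sum fun s _ => h3 s).trans (le_of_eq ?_)
    rw [Finset.sum_add_distrib, ← Finset.mul_sum, ← Finset.mul_sum, hdiag, hall]
    ring

/-- The sequence of branching numbers `w₀, 2, …, 2, 1, …, 1` that is equal to `1` from the index `κ`
on. -/
structure BranchProfile (w : ℕ → ℕ) (k κ : ℕ) : Prop where
  pos : 1 ≤ κ
  le : κ ≤ k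
  zero : 2 ≤ w 0
  two : ∀ i, 1 ≤ i → i < κ → w i = 2
  one : ∀ i, κ ≤ i → i < k → w i = 1

theorem BranchProfile.two_le {κ : ℕ} (h : BranchProfile w k κ) {i : ℕ} (hi : i < κ) : 2 ≤ w i := by
  rcases Nat.eq_zero_or_pos i with rfl | h0
  · exact h.zero
  · exact (h.two i h0 hi).ge

theorem BranchProfile.one_le {κ : ℕ} (h : BranchProfile w k κ) {i : ℕ} (hi : i < k) : 1 ≤ w i := by
  rcases lt_or_ge i κ with h1 | h1
  · exact le_trans one_le_two (h.two_le h1)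
  · exact (h.one i h1 hi).ge

theorem BranchProfile.prod_eq {κ : ℕ} (h : BranchProfile w k κ) :
    ∏ i ∈ Finset.range k, w i = w 0 * 2 ^ (κ - 1) := by
  rw [Finset.range_eq_Ico, ← Finset.prod_Ico_consecutive _ (Nat.zero_le κ) h.le,
    Finset.prod_eq_prod_Ico_succ_bot h.pos]
  have h1 : ∏ i ∈ Finset.Ico (0 + 1) κ, w i = 2 ^ (κ - 1) := by
    rw [Finset.prod_congr rfl fun i hi => h.two i (Finset.mem_Ico.1 hi).1 (Finset.mem_Ico.1 hi).2]
    simp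
  have h2 : ∏ i ∈ Finset.Ico κ k, w i = 1 :=
    Finset.prod_eq_one fun i hi => h.one i (Finset.mem_Ico.1 hi).1 (Finset.mem_Ico.1 hi).2
  rw [h1, h2, mul_one]

/-- Staying together on some levels costs at most `y` on a level with branching number at least `2`
and at most `2 * y` on the other levels. -/
theorem BranchProfile.prod_inv_le {κ : ℕ} (h : BranchProfile w k κ) {y θ : ℝ} (hy : 1 ≤ y)
    (hθ : 1 / (2 * y) ≤ θ) {j j' : ℕ} (hj' : j' ≤ k) :
    ∏ i ∈ Finset.Ico j j', ((w i : ℝ) * θ)⁻¹ ≤ y ^ k * 2 ^ (k - κ) := by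
  have hy0 : 0 < y := by linarith
  have hθ0 : 0 < θ := lt_of_lt_of_le (by positivity) hθ
  let c : ℕ → ℝ := fun i => y * if i < κ then 1 else 2
  have hc1 : ∀ i, 1 ≤ c i := by
    intro i
    simp only [c]
    split_ifs <;> linarith
  have hyθ : 1 ≤ 2 * y * θ := by
    rwa [div_le_iff₀' (by positivity)] at hθ
  have h1 : ∏ i ∈ Finset.Ico j j', ((w i : ℝ) * θ)⁻¹ ≤ ∏ i ∈ Finset.Ico j j', c i := by
    refine Finset.prod_le_prod (fun i _ => by positivity) fun i hi => ?_
    have hik : i < k := lt_of_lt_of_le (Finset.mem_Ico.1 hi).2 hj'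
    have hwi : (1 : ℝ) ≤ w i := by exact_mod_cast h.one_le hik
    have hwθ : 0 < (w i : ℝ) * θ := by positivity
    rw [inv_le_iff_one_le_mul₀ hwθ]
    simp only [c]
    split_ifs with hκ
    · have : (2 : ℝ) ≤ w i := by exact_mod_cast h.two_le hκ
      have : 2 * (y * θ) ≤ w i * (y * θ) := by gcongr
      linarith
    · have : 1 * (y * θ) ≤ w i * (y * θ) := by gcongr
      linarith
  have h2 : ∏ i ∈ Finset.Ico j j', c i ≤ ∏ i ∈ Finset.range k, c i := by
    have hsub : Finset.Ico j j' ⊆ Finset.range k := by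
      intro i hi
      have := (Finset.mem_Ico.1 hi).2
      exact Finset.mem_range.2 (by omega)
    rw [← Finset.prod_sdiff hsub]
    refine le_mul_of_one_le_left (Finset.prod_nonneg fun i _ => zero_le_one.trans (hc1 i)) ?_
    calc (1 : ℝ) = ∏ i ∈ Finset.range k \ Finset.Ico j j', 1 := by simp
      _ ≤ _ := Finset.prod_le_prod (fun _ _ => zero_le_one) fun i _ => hc1 i
  refine h1.trans (h2.trans (le_of_eq ?_))
  simp only [c]
  rw [Finset.prod_mul_distrib, Finset.prod_const, Finset.card_range, Finset.range_eq_Ico,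
    ← Finset.prod_Ico_consecutive _ (Nat.zero_le κ) h.le]
  have h3 : ∏ i ∈ Finset.Ico 0 κ, (if i < κ then (1 : ℝ) else 2) = 1 :=
    Finset.prod_eq_one fun i hi => if_pos (Finset.mem_Ico.1 hi).2
  have h4 : ∏ i ∈ Finset.Ico κ k, (if i < κ then (1 : ℝ) else 2) = 2 ^ (k - κ) := by
    rw [Finset.prod_congr rfl fun i hi => if_neg (not_lt.2 (Finset.mem_Ico.1 hi).1)]
    simp
  rw [h3, h4, one_mul]

/-- If walks survive at most once on average, then so do their final segments. -/
theorem BranchProfile.prod_Ico_le_one {κ : ℕ} (h : BranchProfile w k κ) {θ : ℝ} (hθ : 1 / 2 ≤ θ)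
    (hθ1 : θ ≤ 1) (hμ : ∏ i ∈ Finset.range k, ((w i : ℝ) * θ) ≤ 1) {j : ℕ} (hj : j ≤ k) :
    ∏ i ∈ Finset.Ico j k, ((w i : ℝ) * θ) ≤ 1 := by
  have hθ0 : 0 ≤ θ := by linarith
  rcases le_or_gt κ j with hκ | hκ
  · refine Finset.prod_le_one (fun i _ => by positivity) fun i hi => ?_
    have hi := Finset.mem_Ico.1 hi
    rw [h.one i (by omega) hi.2]
    simpa using hθ1
  · refine le_trans ?_ hμ
    rw [Finset.range_eq_Ico, ← Finset.prod_Ico_consecutive _ (Nat.zero_le j) hj]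
    refine le_mul_of_one_le_left (Finset.prod_nonneg fun i _ => by positivity) ?_
    calc (1 : ℝ) = ∏ i ∈ Finset.Ico 0 j, 1 := by simp
      _ ≤ _ := Finset.prod_le_prod (fun _ _ => zero_le_one) fun i hi => ?_
    have hi := Finset.mem_Ico.1 hi
    have : (2 : ℝ) ≤ w i := by exact_mod_cast h.two_le (by omega)
    nlinarith

end LayeredGraph

/-! ### The restricted polynomial as a product over the blocks -/

section MatrixProducts

open MvPolynomial

variable {R : Type*} [CommRing R] {n : ℕ}

theorem Matrix.list_ofFn_prod_apply {d : ℕ} (M : Fin d → Matrix (Fin n) (Fin n) R) (u v : Fin n) :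
    (List.ofFn M).prod u v = ∑ p : Fin (d + 1) → Fin n with p 0 = u ∧ p (Fin.last d) = v,
      ∏ q : Fin d, M q (p q.castSucc) (p q.succ) := by
  induction d generalizing u with
  | zero =>
    rw [Finset.sum_filter, ← (Equiv.funUnique (Fin 1) (Fin n)).symm.sum_comp]
    simp only [List.ofFn_zero, List.prod_nil, Matrix.one_apply, Finset.univ_eq_empty,
      Finset.prod_empty]
    by_cases h : u = v
    · subst h
      simp [Equiv.funUnique]
    · rw [if_neg h, Finset.sum_eq_zero]
      intro s _
      rw [if_neg]
      rintro ⟨h1, h2⟩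
      exact h (h1.symm.trans h2)
  | succ d ih =>
    rw [List.ofFn_succ, List.prod_cons, Matrix.mul_apply, Finset.sum_filter,
      ← (Fin.consEquiv fun _ : Fin (d + 2) => Fin n).sum_comp, Fintype.sum_prod_type]
    symm
    rw [Finset.sum_eq_single u]
    · simp only [ih, Finset.sum_filter, Finset.mul_sum]
      rw [Finset.sum_comm]
      refine Finset.sum_congr rfl fun p _ => ?_
      symm
      rw [Finset.sum_eq_single (p 0)]
      · have h1 : Fin.last (d + 1) = (Fin.last d).succ := rfl
        rw [Fin.prod_univ_succ]
        simp only [Fin.consEquiv_apply, Fin.cons_zero, h1, Fin.cons_succ, true_and,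
          Fin.castSucc_zero, Fin.castSucc_succ, mul_ite, mul_zero]
      · intro s _ hs
        rw [if_neg, mul_zero]
        exact fun h => hs h.1.symm
      · simp
    · intro s _ hs
      refine Finset.sum_eq_zero fun p _ => if_neg ?_
      exact fun h => hs h.1
    · simp

theorem Matrix.list_prod_single_apply {ι : Type*} (z : Fin n) (q : ι → R) (L : List ι) :
    (L.map fun i => Matrix.single z z (q i)).prod z z = (L.map q).prod := by
  induction L with
  | nil => simp
  | cons i L ih => rw [List.map_cons, List.prod_cons, Matrix.single_mul_apply_same, ih,
      List.map_cons, List.prod_cons]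

end MatrixProducts

namespace Restriction

open MvPolynomial

variable {n k r : ℕ}

/-- The matrix of the transitions from the vertices of layer `j` to those of layer `j + 1` of a side
of block `i`: it is the matrix with index `j + 1` of that side, transposed on the left. -/
noncomputable def stepMatrix (F : Type*) [Field F] (V : Restriction n k r) (i : Fin r)
    (s : BlockSide) (j : ℕ) : Matrix (Fin n) (Fin n) (MvPolynomial (YVar n r ⊕ V.ZVar) F) :=
  if h : j < k then
    match s with
    | .left => Matrix.of fun c c' => V.zValue F i .left ⟨j, h⟩ c' c
    | .right => Matrix.of fun c c' => V.zValue F i .right ⟨j, h⟩ c c'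
  else 1

/-- The sum over all walks from the vertex `a` of a side of block `i` of the products of the
variables along the walk. -/
noncomputable def sidePoly (F : Type*) [Field F] (V : Restriction n k r) (i : Fin r)
    (s : BlockSide) (a : Fin n) : MvPolynomial (YVar n r ⊕ V.ZVar) F :=
  ∑ u, (((List.range k).map (V.stepMatrix F i s)).prod) a u

/-- The `p`-th matrix of block `i` after the restriction. -/
noncomputable def blockMatrix (F : Type*) [Field F] (V : Restriction n k r) (i : Fin r) (p : ℕ) :
    Matrix (Fin n) (Fin n) (MvPolynomial (YVar n r ⊕ V.ZVar) F) :=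
  Matrix.of fun a b =>
    if p = 0 then (if a.val = 0 then 1 else 0)
    else if hL : 1 ≤ p ∧ p ≤ k then V.zValue F i .left ⟨k - p, by omega⟩ a b
    else if p = k + 1 then MvPolynomial.X (Sum.inl (i, a, b))
    else if hR : k + 2 ≤ p ∧ p ≤ 2 * k + 1 then V.zValue F i .right ⟨p - (k + 2), by omega⟩ a b
    else (if b.val = 0 then 1 else 0)

/-- The polynomial computed by block `i`. -/
noncomputable def blockPoly (F : Type*) [Field F] (V : Restriction n k r) (i : Fin r) :
    MvPolynomial (YVar n r ⊕ V.ZVar) F :=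
  ∑ ab : Fin n × Fin n,
    X (Sum.inl (i, ab.1, ab.2)) * (V.sidePoly F i .left ab.1 * V.sidePoly F i .right ab.2)

variable {F : Type*} [Field F]

/-- The outer matrices of a block have a row of ones, respectively a column of ones, and are zero
elsewhere, so the product of the matrices of the block has a single nonzero entry. -/
theorem blockMatrix_list_prod (hn : 0 < n) (V : Restriction n k r) (i : Fin r) :
    ((List.range (2 * k + 3)).map (V.blockMatrix F i)).prod =
      Matrix.single ⟨0, hn⟩ ⟨0, hn⟩ (V.blockPoly F i) := by
  have hsplit : 2 * k + 3 = 1 + (k + (1 + (k + 1))) := by omega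
  have hleft : ((List.range k).map fun p => V.blockMatrix F i (1 + p)).prod =
      (((List.range k).map (V.stepMatrix F i .left)).prod).transpose := by
    rw [Matrix.transpose_list_prod, List.map_map, ← List.map_reverse]
    congr 1
    refine List.ext_getElem (by simp) fun p h1 h2 => ?_
    simp only [List.length_map, List.length_range] at h1
    simp only [List.getElem_map, List.getElem_range, List.getElem_reverse, List.length_range,
      Function.comp_apply, stepMatrix, blockMatrix]
    ext a b
    rw [dif_pos (by omega : k - 1 - p < k)]
    simp only [Matrix.of_apply, Matrix.transpose_apply]
    rw [if_neg (by omega), dif_pos (by omega)]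
    congr 2
    simp only [Fin.mk.injEq]
    omega
  have hright : ((List.range k).map fun p => V.blockMatrix F i (1 + (k + (1 + p)))).prod =
      ((List.range k).map (V.stepMatrix F i .right)).prod := by
    congr 1
    refine List.map_congr_left fun p hp => ?_
    have hp := List.mem_range.1 hp
    simp only [stepMatrix, blockMatrix]
    ext a b
    rw [dif_pos hp]
    simp only [Matrix.of_apply]
    rw [if_neg (by omega), dif_neg (by omega), if_neg (by omega), dif_pos (by omega)]
    congr 2
    simp only [Fin.mk.injEq]
    omega
  have hprod : ((List.range (2 * k + 3)).map (V.blockMatrix F i)).prod =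
      V.blockMatrix F i 0 * ((((List.range k).map (V.stepMatrix F i .left)).prod).transpose *
        (V.blockMatrix F i (k + 1) * (((List.range k).map (V.stepMatrix F i .right)).prod *
          V.blockMatrix F i (2 * k + 2)))) := by
    rw [← hleft, ← hright, hsplit]
    simp only [List.range_add, List.map_append, List.prod_append, List.map_map, List.range_one,
      List.map_cons, List.map_nil, List.prod_cons, List.prod_nil, mul_one, Function.comp_def]
    have e1 : 1 + (k + 0) = k + 1 := by omega
    have e2 : 1 + (k + (k + 1)) = 2 * k + 2 := by omega
    rw [e1, e2]
  rw [hprod]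
  ext1 a b
  simp only [Matrix.mul_apply]
  have h0 : ∀ c, V.blockMatrix F i 0 a c = if a.val = 0 then 1 else 0 := fun c => by
    simp [blockMatrix]
  have hlast : ∀ c, V.blockMatrix F i (2 * k + 2) c b = if b.val = 0 then 1 else 0 := fun c => by
    simp only [blockMatrix, Matrix.of_apply]
    rw [if_neg (by omega), dif_neg (by omega), if_neg (by omega), dif_neg (by omega)]
  have hmid : ∀ c d, V.blockMatrix F i (k + 1) c d = X (Sum.inl (i, c, d)) := fun c d => by
    simp only [blockMatrix, Matrix.of_apply]
    rw [if_neg (by omega), dif_neg (by omega)]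
    simp
  simp only [h0, hlast, hmid, Matrix.transpose_apply]
  by_cases ha : a.val = 0
  · by_cases hb : b.val = 0
    · obtain rfl : a = ⟨0, hn⟩ := Fin.ext ha
      obtain rfl : b = ⟨0, hn⟩ := Fin.ext hb
      rw [Matrix.single_apply_same]
      simp only [if_true, one_mul, mul_one]
      rw [blockPoly, Finset.sum_comm, Fintype.sum_prod_type]
      refine Finset.sum_congr rfl fun c _ => ?_
      rw [← Finset.sum_mul, Finset.mul_sum]
      refine Finset.sum_congr rfl fun d _ => ?_
      rw [sidePoly, sidePoly]
      ring
    · rw [Matrix.single_apply_of_ne]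
      · simp [hb]
      · intro h
        exact hb (congrArg Fin.val h.2).symm
  · rw [Matrix.single_apply_of_ne]
    · simp [ha]
    · intro h
      exact ha (congrArg Fin.val h.1).symm

theorem restrictedIMM_eq_prod (hn : 0 < n) (V : Restriction n k r) :
    V.restrictedIMM F = ∏ i, V.blockPoly F i := by
  have h1 : V.restrictedIMM F = (List.ofFn fun q : Fin (r * (2 * k + 3)) =>
      (Matrix.of fun a b => V.value F (q, a, b))).prod ⟨0, hn⟩ ⟨0, hn⟩ := by
    rw [Matrix.list_ofFn_prod_apply, restrictedIMM, IMM, map_sum]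
    refine Finset.sum_congr ?_ fun p _ => ?_
    · ext p
      simp [Fin.ext_iff]
    · rw [map_prod]
      simp
  rw [h1, List.ofFn_mul, List.prod_flatten, List.map_ofFn]
  have h2 : (List.prod ∘ fun i : Fin r => List.ofFn fun j : Fin (2 * k + 3) =>
      (Matrix.of fun a b => V.value F (⟨i.val * (2 * k + 3) + j.val, by
        calc i.val * (2 * k + 3) + j.val < (i.val + 1) * (2 * k + 3) := by
              rw [add_mul, one_mul]; exact Nat.add_lt_add_left j.isLt _
          _ ≤ r * (2 * k + 3) := Nat.mul_le_mul_right _ i.isLt⟩, a, b))) =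
      fun i => Matrix.single ⟨0, hn⟩ ⟨0, hn⟩ (V.blockPoly F i) := by
    funext i
    rw [Function.comp_apply, ← V.blockMatrix_list_prod hn i]
    congr 1
    refine List.ext_getElem (by simp) fun p h1 h2 => ?_
    simp only [List.length_ofFn] at h1
    simp only [List.getElem_ofFn, List.getElem_map, List.getElem_range]
    have e1 : (i.val * (2 * k + 3) + p) / (2 * k + 3) = i.val := by
      rw [add_comm, Nat.add_mul_div_right _ _ (by omega), Nat.div_eq_of_lt h1, zero_add]
    have e2 : (i.val * (2 * k + 3) + p) % (2 * k + 3) = p := by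
      rw [add_comm, Nat.add_mul_mod_self_right, Nat.mod_eq_of_lt h1]
    ext1 a b
    simp only [Matrix.of_apply, value, blockMatrix, Fin.divNat, Fin.modNat, e1, e2]
  rw [h2, List.ofFn_eq_map, Matrix.list_prod_single_apply, ← List.ofFn_eq_map, List.prod_ofFn]

end Restriction

/-! ### Variables as edges of layered graphs -/

namespace Restriction

open MvPolynomial

variable {n k r : ℕ}

instance (V : Restriction n k r) (i : Fin r) (s : BlockSide) (j : Fin k) (a b : Fin n) :
    Decidable (V.Keeps i s j a b) :=
  match s with
  | .left => inferInstanceAs (Decidable (a ∈ (V i .left j b).val))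
  | .right => inferInstanceAs (Decidable (b ∈ (V i .right j a).val))

/-- The block and side of a `Z`-variable. -/
def blockSide {V : Restriction n k r} (z : V.ZVar) : Fin r × BlockSide := (z.val.1, z.val.2.1)

/-- The layer in which the edge given by a `Z`-variable starts. -/
def layer {V : Restriction n k r} (z : V.ZVar) : Fin k := z.val.2.2.1

/-- The vertex in which the edge given by a `Z`-variable starts: the column on the left side and the
row on the right side. -/
def source {V : Restriction n k r} (z : V.ZVar) : Fin n :=
  match z.val.2.1 with
  | .left => z.val.2.2.2.2
  | .right => z.val.2.2.2.1

/-- The vertex in which the edge given by a `Z`-variable ends. -/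
def target {V : Restriction n k r} (z : V.ZVar) : Fin n :=
  match z.val.2.1 with
  | .left => z.val.2.2.2.1
  | .right => z.val.2.2.2.2

/-- The layered graph of a side of a block. -/
def graph (V : Restriction n k r) (b : Fin r × BlockSide) :
    LayeredGraph n k fun j => keepCount n k (j + 1) := V b.1 b.2

/-- The `Z`-variable of the edge from `c` in layer `j` to `c'`. -/
def edgeVar (V : Restriction n k r) (b : Fin r × BlockSide) (j : Fin k) (c c' : Fin n)
    (h : c' ∈ (V.graph b j c).val) : V.ZVar :=
  match b, h with
  | (i, .left), h => ⟨(i, .left, j, c', c), h⟩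
  | (i, .right), h => ⟨(i, .right, j, c, c'), h⟩

section EdgeVar

variable {V : Restriction n k r} {b : Fin r × BlockSide} {j : Fin k} {c c' : Fin n}
  {h : c' ∈ (V.graph b j c).val}

theorem blockSide_edgeVar : blockSide (V.edgeVar b j c c' h) = b := by
  obtain ⟨i, s⟩ := b; cases s <;> rfl

theorem layer_edgeVar : layer (V.edgeVar b j c c' h) = j := by
  obtain ⟨i, s⟩ := b; cases s <;> rfl

theorem source_edgeVar : source (V.edgeVar b j c c' h) = c := by
  obtain ⟨i, s⟩ := b; cases s <;> rfl

theorem target_edgeVar : target (V.edgeVar b j c c' h) = c' := by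
  obtain ⟨i, s⟩ := b; cases s <;> rfl

end EdgeVar

theorem target_mem {V : Restriction n k r} (z : V.ZVar) :
    target z ∈ (V.graph (blockSide z) (layer z) (source z)).val := by
  obtain ⟨⟨i, s, j, a, b⟩, h⟩ := z
  cases s <;> exact h

theorem zVar_ext {V : Restriction n k r} {z z' : V.ZVar} (h1 : blockSide z = blockSide z')
    (h2 : layer z = layer z') (h3 : source z = source z') (h4 : target z = target z') : z = z' := by
  obtain ⟨⟨i, s, j, a, b⟩, h⟩ := z
  obtain ⟨⟨i', s', j', a', b'⟩, h'⟩ := z'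
  simp only [blockSide, layer, Prod.mk.injEq] at h1 h2
  obtain ⟨rfl, rfl⟩ := h1
  subst h2
  cases s
  · simp only [source, target] at h3 h4
    subst h3 h4
    rfl
  · simp only [source, target] at h3 h4
    subst h3 h4
    rfl

/-- The variables along a walk in a side of a block. -/
def edges (V : Restriction n k r) (b : Fin r × BlockSide) (x : Fin (k + 1) → Fin n) :
    Finset V.ZVar :=
  Finset.univ.filter fun z => blockSide z = b ∧ source z = x (layer z).castSucc ∧
    target z = x (layer z).succ

theorem mem_edges {V : Restriction n k r} {b : Fin r × BlockSide} {x : Fin (k + 1) → Fin n}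
    {z : V.ZVar} : z ∈ V.edges b x ↔ blockSide z = b ∧ source z = x (layer z).castSucc ∧
      target z = x (layer z).succ := by
  simp [edges]

theorem edgeVar_mem_edges {V : Restriction n k r} {b : Fin r × BlockSide}
    {x : Fin (k + 1) → Fin n} {j : Fin k} (h : x j.succ ∈ (V.graph b j (x j.castSucc)).val) :
    V.edgeVar b j (x j.castSucc) (x j.succ) h ∈ V.edges b x := by
  rw [mem_edges, blockSide_edgeVar, source_edgeVar, target_edgeVar, layer_edgeVar]
  exact ⟨rfl, rfl, rfl⟩

theorem card_edges_union {V : Restriction n k r} {b : Fin r × BlockSide}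
    {p : (Fin (k + 1) → Fin n) × (Fin (k + 1) → Fin n)}
    (hp : p ∈ (V.graph b).walks ×ˢ (V.graph b).walks) :
    (V.edges b p.1 ∪ V.edges b p.2).card = LayeredGraph.unionLen p := by
  rw [Finset.mem_product, LayeredGraph.mem_walks, LayeredGraph.mem_walks] at hp
  rw [Finset.card_eq_sum_card_fiberwise (f := layer) (t := Finset.univ)
    (fun z _ => Finset.mem_coe.2 (Finset.mem_univ _)), LayeredGraph.unionLen]
  refine Finset.sum_congr rfl fun j _ => ?_
  have h1 : ((V.edges b p.1 ∪ V.edges b p.2).filter fun z => layer z = j) =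
      {V.edgeVar b j (p.1 j.castSucc) (p.1 j.succ) (hp.1 j),
        V.edgeVar b j (p.2 j.castSucc) (p.2 j.succ) (hp.2 j)} := by
    ext z
    simp only [Finset.mem_filter, Finset.mem_union, Finset.mem_insert, Finset.mem_singleton]
    constructor
    · rintro ⟨h | h, rfl⟩
      · left
        rw [mem_edges] at h
        refine zVar_ext ?_ ?_ ?_ ?_
        · rw [blockSide_edgeVar, h.1]
        · rw [layer_edgeVar]
        · rw [source_edgeVar, h.2.1]
        · rw [target_edgeVar, h.2.2]
      · right
        rw [mem_edges] at h
        refine zVar_ext ?_ ?_ ?_ ?_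
        · rw [blockSide_edgeVar, h.1]
        · rw [layer_edgeVar]
        · rw [source_edgeVar, h.2.1]
        · rw [target_edgeVar, h.2.2]
    · rintro (rfl | rfl)
      · exact ⟨Or.inl (edgeVar_mem_edges _), layer_edgeVar⟩
      · exact ⟨Or.inr (edgeVar_mem_edges _), layer_edgeVar⟩
  rw [h1]
  split_ifs with h
  · have h2 : V.edgeVar b j (p.1 j.castSucc) (p.1 j.succ) (hp.1 j) =
        V.edgeVar b j (p.2 j.castSucc) (p.2 j.succ) (hp.2 j) := by
      refine zVar_ext ?_ ?_ ?_ ?_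
      · rw [blockSide_edgeVar, blockSide_edgeVar]
      · rw [layer_edgeVar, layer_edgeVar]
      · rw [source_edgeVar, source_edgeVar, h.1]
      · rw [target_edgeVar, target_edgeVar, h.2]
    rw [h2, Finset.pair_eq_singleton, Finset.card_singleton]
  · refine Finset.card_pair fun h2 => h ⟨?_, ?_⟩
    · have := congrArg source h2
      rwa [source_edgeVar, source_edgeVar] at this
    · have := congrArg target h2
      rwa [target_edgeVar, target_edgeVar] at this

theorem card_edges {V : Restriction n k r} {b : Fin r × BlockSide} {x : Fin (k + 1) → Fin n}
    (hx : x ∈ (V.graph b).walks) : (V.edges b x).card = k := by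
  have h := card_edges_union (V := V) (b := b) (p := (x, x)) (Finset.mk_mem_product hx hx)
  rw [Finset.union_idempotent] at h
  rw [h]
  simp [LayeredGraph.unionLen]

theorem edges_injOn (hk : 0 < k) (V : Restriction n k r) (b : Fin r × BlockSide) :
    Set.InjOn (V.edges b) (V.graph b).walks := by
  intro x hx x' _ h
  have hx := LayeredGraph.mem_walks.1 hx
  have key : ∀ j : Fin k, x j.castSucc = x' j.castSucc ∧ x j.succ = x' j.succ := by
    intro j
    have h1 := edgeVar_mem_edges (hx j)
    rw [h, mem_edges, source_edgeVar, target_edgeVar, layer_edgeVar] at h1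
    exact h1.2
  funext i
  refine Fin.cases ?_ (fun j => (key j).2) i
  exact (key ⟨0, hk⟩).1

/-- Every side of a block has the same number of variables. -/
theorem card_partOver_blockSide (V : Restriction n k r) (b : Fin r × BlockSide) :
    (partOver (blockSide (V := V)) b Finset.univ).card =
      n * ∑ j ∈ Finset.range k, keepCount n k (j + 1) := by
  have h1 : (partOver (blockSide (V := V)) b Finset.univ).card =
      ((Finset.univ : Finset (Fin k × Fin n)).sigma fun jc => (V.graph b jc.1 jc.2).val).card := by
    refine Finset.card_bij (fun z _ => ⟨(layer z, source z), target z⟩) ?_ ?_ ?_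
    · intro z hz
      have hz := (Finset.mem_filter.1 hz).2
      rw [Finset.mem_sigma]
      refine ⟨Finset.mem_univ _, ?_⟩
      have := target_mem z
      rwa [hz] at this
    · intro z hz z' hz' h
      have hz := (Finset.mem_filter.1 hz).2
      have hz' := (Finset.mem_filter.1 hz').2
      simp only [Sigma.mk.injEq, Prod.mk.injEq, heq_eq_eq] at h
      exact zVar_ext (hz.trans hz'.symm) h.1.1 h.1.2 h.2
    · rintro ⟨⟨j, c⟩, c'⟩ h
      rw [Finset.mem_sigma] at h
      refine ⟨V.edgeVar b j c c' h.2, ?_, ?_⟩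
      · exact Finset.mem_filter.2 ⟨Finset.mem_univ _, blockSide_edgeVar⟩
      · rw [layer_edgeVar, source_edgeVar, target_edgeVar]
  rw [h1, Finset.card_sigma, Fintype.sum_prod_type]
  have h2 : ∀ (j : Fin k) (c : Fin n), (V.graph b j c).val.card = keepCount n k (j.val + 1) :=
    fun j c => (V.graph b j c).2
  simp only [h2, Finset.sum_const, Finset.card_univ, Fintype.card_fin, smul_eq_mul]
  rw [← Finset.mul_sum, Finset.sum_range]

variable {F : Type*} [Field F]

/-- The polynomial of all walks from `a` in a side of a block, in the `Z`-variables alone. -/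
noncomputable def walkPoly (F : Type*) [Field F] (V : Restriction n k r) (b : Fin r × BlockSide)
    (a : Fin n) : MvPolynomial V.ZVar F :=
  ∑ x ∈ (V.graph b).walks with x 0 = a, monomial (indExp (V.edges b x)) 1

theorem stepMatrix_apply (V : Restriction n k r) (b : Fin r × BlockSide) (j : Fin k)
    (c c' : Fin n) : V.stepMatrix F b.1 b.2 j.val c c' =
      if h : c' ∈ (V.graph b j c).val then X (Sum.inr (V.edgeVar b j c c' h)) else 0 := by
  obtain ⟨i, s⟩ := b
  simp only [stepMatrix, dif_pos j.isLt]
  cases s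
  · simp only [Matrix.of_apply, zValue]
    by_cases h : c' ∈ (V i .left j c).val
    · have h' : V.Keeps i .left j c' c := h
      have h'' : c' ∈ (V.graph (i, .left) j c).val := h
      rw [dif_pos h', dif_pos h'']
      rfl
    · have h' : ¬ V.Keeps i .left j c' c := h
      have h'' : ¬ c' ∈ (V.graph (i, .left) j c).val := h
      rw [dif_neg h', dif_neg h'']
  · simp only [Matrix.of_apply, zValue]
    by_cases h : c' ∈ (V i .right j c).val
    · have h' : V.Keeps i .right j c c' := h
      have h'' : c' ∈ (V.graph (i, .right) j c).val := h
      rw [dif_pos h', dif_pos h'']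
      rfl
    · have h' : ¬ V.Keeps i .right j c c' := h
      have h'' : ¬ c' ∈ (V.graph (i, .right) j c).val := h
      rw [dif_neg h', dif_neg h'']

/-- The products of variables along walks are the monomials of the edge sets of these walks. -/
theorem sidePoly_eq_rename (V : Restriction n k r) (b : Fin r × BlockSide) (a : Fin n) :
    V.sidePoly F b.1 b.2 a = rename Sum.inr (V.walkPoly F b a) := by
  classical
  have h1 : (List.range k).map (V.stepMatrix F b.1 b.2) =
      List.ofFn fun j : Fin k => V.stepMatrix F b.1 b.2 j.val := by
    refine List.ext_getElem (by simp) fun p h1 h2 => ?_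
    simp
  rw [sidePoly, h1]
  simp only [Matrix.list_ofFn_prod_apply]
  have h2 : ∑ u, ∑ p : Fin (k + 1) → Fin n with p 0 = a ∧ p (Fin.last k) = u,
      ∏ q : Fin k, V.stepMatrix F b.1 b.2 q.val (p q.castSucc) (p q.succ) =
      ∑ p : Fin (k + 1) → Fin n with p 0 = a,
        ∏ q : Fin k, V.stepMatrix F b.1 b.2 q.val (p q.castSucc) (p q.succ) := by
    rw [← Finset.sum_fiberwise (g := fun p : Fin (k + 1) → Fin n => p (Fin.last k))]
    refine Finset.sum_congr rfl fun u _ => ?_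
    rw [Finset.filter_filter]
  rw [h2, walkPoly, map_sum]
  have h3 : ((V.graph b).walks.filter fun x => x 0 = a) ⊆
      Finset.univ.filter fun p : Fin (k + 1) → Fin n => p 0 = a :=
    Finset.filter_subset_filter _ (Finset.subset_univ _)
  rw [← Finset.sum_subset h3]
  · refine Finset.sum_congr rfl fun x hx => ?_
    have hx := LayeredGraph.mem_walks.1 (Finset.mem_filter.1 hx).1
    rw [monomial_indExp, map_prod]
    refine Finset.prod_bij' (fun q _ => V.edgeVar b q _ _ (hx q)) (fun z _ => layer z)
      (fun q _ => edgeVar_mem_edges _) (fun z _ => Finset.mem_univ _) (fun q _ => layer_edgeVar)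
      (fun z hz => ?_) (fun q _ => ?_)
    · rw [mem_edges] at hz
      refine zVar_ext ?_ ?_ ?_ ?_
      · rw [blockSide_edgeVar, hz.1]
      · rw [layer_edgeVar]
      · rw [source_edgeVar, hz.2.1]
      · rw [target_edgeVar, hz.2.2]
    · rw [stepMatrix_apply, dif_pos (hx q), rename_X]
  · intro x hx hx'
    have hnw : x ∉ (V.graph b).walks := fun h =>
      hx' (Finset.mem_filter.2 ⟨h, (Finset.mem_filter.1 hx).2⟩)
    rw [LayeredGraph.mem_walks, not_forall] at hnw
    obtain ⟨j, hj⟩ := hnw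
    refine Finset.prod_eq_zero (Finset.mem_univ j) ?_
    rw [stepMatrix_apply, dif_neg hj]

/-- The exponent of the `Y`-monomial that selects the entry `(α (i, left), α (i, right))` of the middle
matrix of every block `i`. -/
noncomputable def yExp (α : Fin r × BlockSide → Fin n) : YVar n r →₀ ℕ :=
  ∑ i, Finsupp.single (i, α (i, .left), α (i, .right)) 1

theorem degree_yExp (α : Fin r × BlockSide → Fin n) : (yExp α).degree = r := by
  simp [yExp, map_sum]

theorem yExp_injective : Function.Injective (yExp (n := n) (r := r)) := by
  intro α α' h
  have key : ∀ i, α' (i, .left) = α (i, .left) ∧ α' (i, .right) = α (i, .right) := by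
    intro i
    have h1 := DFunLike.congr_fun h (i, α (i, .left), α (i, .right))
    simp only [yExp, Finsupp.finsetSum_apply, Finsupp.single_apply, Prod.mk.injEq] at h1
    by_contra hne
    have h2 : ∀ j ∈ (Finset.univ : Finset (Fin r)), (if j = i ∧ α' (j, .left) = α (i, .left) ∧
        α' (j, .right) = α (i, .right) then 1 else 0) = 0 := by
      intro j _
      rw [if_neg]
      rintro ⟨rfl, h3⟩
      exact hne h3
    rw [Finset.sum_eq_zero h2, Finset.sum_eq_zero_iff] at h1
    have := h1 i (Finset.mem_univ i)
    simp at this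
  funext ⟨i, s⟩
  cases s
  · exact (key i).1.symm
  · exact (key i).2.symm

theorem prod_blockSide {M : Type*} [CommMonoid M] (f : Fin r × BlockSide → M) :
    ∏ b, f b = ∏ i, f (i, .left) * f (i, .right) := by
  rw [Fintype.prod_prod_type]
  refine Finset.prod_congr rfl fun i _ => ?_
  have : (Finset.univ : Finset BlockSide) = {BlockSide.left, BlockSide.right} := rfl
  rw [this, Finset.prod_pair (by simp)]

/-- The coefficient of a `Y`-monomial that selects one entry of each middle matrix: the sum over all
tuples of walks from the vertices given by the entries. -/
theorem coeff_yExp_restrictedIMM (hn : 0 < n) (V : Restriction n k r)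
    (α : Fin r × BlockSide → Fin n) :
    coeff (yExp α) (sumAlgEquiv F (YVar n r) V.ZVar (V.restrictedIMM F)) =
      pathPoly F (fun b => (V.graph b).walks) (fun x => x 0) V.edges α := by
  classical
  have hside : ∀ i s a, sumAlgEquiv F (YVar n r) V.ZVar (V.sidePoly F i s a) =
      C (V.walkPoly F (i, s) a) := by
    intro i s a
    have h1 := V.sidePoly_eq_rename (F := F) (i, s) a
    have h2 := DFunLike.congr_fun (sumAlgEquiv_comp_rename_inr (R := F) (S₁ := YVar n r)
      (S₂ := V.ZVar)) (V.walkPoly F (i, s) a)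
    simp only at h1
    rw [h1]
    exact h2
  -- The entries of the middle matrices are indexed by the start vertices of both sides.
  let ε : (Fin r × BlockSide → Fin n) ≃ (Fin r → Fin n × Fin n) :=
    { toFun := fun α i => (α (i, .left), α (i, .right))
      invFun := fun γ b => match b.2 with
        | .left => (γ b.1).1
        | .right => (γ b.1).2
      left_inv := fun α => by
        funext ⟨i, s⟩
        cases s <;> rfl
      right_inv := fun γ => rfl }
  have hexp : sumAlgEquiv F (YVar n r) V.ZVar (V.restrictedIMM F) =
      ∑ α' : Fin r × BlockSide → Fin n,
        monomial (yExp α') 1 * C (∏ b, V.walkPoly F b (α' b)) := by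
    rw [V.restrictedIMM_eq_prod hn, map_prod]
    simp only [blockPoly, map_sum, map_mul, sumAlgEquiv_X_inl, hside]
    rw [Finset.prod_univ_sum, Fintype.piFinset_univ, ← ε.sum_comp]
    refine Finset.sum_congr rfl fun α' _ => ?_
    rw [Finset.prod_mul_distrib, prod_blockSide, map_prod, yExp, monomial_sum_one]
    simp only [map_mul]
    rfl
  rw [hexp, coeff_sum, Finset.sum_eq_single α]
  · rw [mul_comm, coeff_C_mul, coeff_monomial, if_pos rfl, mul_one]
    simp only [walkPoly]
    rw [Finset.prod_univ_sum, pathPoly]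
    refine Finset.sum_congr ?_ fun x hx => ?_
    · ext x
      simp [forall_and]
    · simp only [monomial_indExp]
      rw [Finset.prod_biUnion]
      intro b _ b' _ hbb'
      rw [Function.onFun, Finset.disjoint_left]
      intro z hz hz'
      exact hbb' ((mem_edges.1 hz).1.symm.trans (mem_edges.1 hz').1)
  · intro α' _ hne
    rw [mul_comm, coeff_C_mul, coeff_monomial, if_neg (fun h => hne (yExp_injective h)), mul_zero]
  · simp

end Restriction

/-! ### The choice of the parameters -/

section Parameters

variable {n k : ℕ}

theorem one_le_of_large (hbig : (10 : ℝ) ^ 12 ≤ (n : ℝ) ^ (0.02 : ℝ)) : (1 : ℝ) ≤ n := by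
  have h0 : n ≠ 0 := by
    rintro rfl
    rw [Nat.cast_zero, Real.zero_rpow (by norm_num)] at hbig
    norm_num at hbig
  exact_mod_cast Nat.one_le_iff_ne_zero.2 h0

theorem large_rpow (hbig : (10 : ℝ) ^ 12 ≤ (n : ℝ) ^ (0.02 : ℝ)) {a : ℝ} (ha : 0.02 ≤ a) :
    (10 : ℝ) ^ 12 ≤ (n : ℝ) ^ a :=
  hbig.trans (Real.rpow_le_rpow_of_exponent_le (one_le_of_large hbig) ha)

/-- The index from which on only one entry per line is kept. -/
noncomputable def lastTwo (n k : ℕ) : ℕ := ⌊(k : ℝ) - 0.34 * Real.logb 2 n⌋₊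

theorem keepCount_one (n k : ℕ) : keepCount n k 1 = ⌊(n : ℝ) ^ (0.05 : ℝ)⌋₊ := by
  simp [keepCount]

theorem two_le_logb (hbig : (10 : ℝ) ^ 12 ≤ (n : ℝ) ^ (0.02 : ℝ)) : 2 ≤ Real.logb 2 n := by
  have h1 := one_le_of_large hbig
  have h2 := large_rpow hbig (a := 1) (by norm_num)
  rw [Real.rpow_one] at h2
  have h3 : (4 : ℝ) ≤ n := by linarith
  rw [Real.le_logb_iff_rpow_le one_lt_two (by linarith)]
  norm_num
  exact_mod_cast h3

theorem branchProfile_keepCount (hbig : (10 : ℝ) ^ 12 ≤ (n : ℝ) ^ (0.02 : ℝ))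
    (hk : Real.logb 2 n ≤ k) :
    LayeredGraph.BranchProfile (fun j => keepCount n k (j + 1)) k (lastTwo n k) := by
  have hL := two_le_logb hbig
  have hx0 : (0 : ℝ) ≤ (k : ℝ) - 0.34 * Real.logb 2 n := by linarith
  refine ⟨?_, ?_, ?_, ?_, ?_⟩
  · rw [lastTwo, Nat.le_floor_iff hx0]
    push_cast
    linarith
  · refine Nat.floor_le_of_le ?_
    linarith
  · change 2 ≤ keepCount n k 1
    rw [keepCount_one, Nat.le_floor_iff (by positivity)]
    have := large_rpow hbig (a := 0.05) (by norm_num)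
    push_cast
    linarith
  · intro i hi hiκ
    have h1 : ((i + 1 : ℕ) : ℝ) ≤ (k : ℝ) - 0.34 * Real.logb 2 n :=
      (Nat.le_floor_iff hx0).1 hiκ
    change keepCount n k (i + 1) = 2
    rw [keepCount, if_neg (by omega), if_pos h1]
  · intro i hiκ hik
    have hpos : 1 ≤ lastTwo n k := by
      rw [lastTwo, Nat.le_floor_iff hx0]
      push_cast
      linarith
    have h1 : (k : ℝ) - 0.34 * Real.logb 2 n < ((i + 1 : ℕ) : ℝ) :=
      (Nat.floor_lt hx0).1 (Nat.lt_succ_of_le hiκ)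
    change keepCount n k (i + 1) = 1
    rw [keepCount, if_neg (by omega), if_neg (not_le.2 h1)]

/-- There are about `0.34 * logb 2 n` levels with one kept entry per line; branching there as well
would multiply the number of walks by about `n ^ 0.34`. -/
theorem two_pow_sub_lastTwo (hbig : (10 : ℝ) ^ 12 ≤ (n : ℝ) ^ (0.02 : ℝ))
    (hk : Real.logb 2 n ≤ k) :
    (n : ℝ) ^ (0.34 : ℝ) ≤ 2 ^ (k - lastTwo n k) ∧
      (2 : ℝ) ^ (k - lastTwo n k) ≤ 2 * (n : ℝ) ^ (0.34 : ℝ) := by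
  have hn := one_le_of_large hbig
  have hL := two_le_logb hbig
  have hx0 : (0 : ℝ) ≤ (k : ℝ) - 0.34 * Real.logb 2 n := by linarith
  have hle : lastTwo n k ≤ k := (branchProfile_keepCount hbig hk).le
  have e1 : (2 : ℝ) ^ (0.34 * Real.logb 2 n) = (n : ℝ) ^ (0.34 : ℝ) := by
    rw [mul_comm, Real.rpow_mul zero_le_two, Real.rpow_logb two_pos (by norm_num) (by linarith)]
  have h1 : (lastTwo n k : ℝ) ≤ (k : ℝ) - 0.34 * Real.logb 2 n := Nat.floor_le hx0
  have h2 : (k : ℝ) - 0.34 * Real.logb 2 n < lastTwo n k + 1 := Nat.lt_floor_add_one _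
  rw [← Real.rpow_natCast 2 (k - lastTwo n k), Nat.cast_sub hle, ← e1]
  constructor
  · exact Real.rpow_le_rpow_of_exponent_le one_le_two (by linarith)
  · rw [← Real.rpow_one_add' zero_le_two (by positivity)]
    exact Real.rpow_le_rpow_of_exponent_le one_le_two (by linarith)

/-- A size `l` such that the ratio `y` of the numbers of elements outside and inside a set with `l`
elements satisfies `y ^ k ≈ n ^ 0.58`. -/
theorem exists_shift_size {N : ℕ} (hbig : (10 : ℝ) ^ 12 ≤ (n : ℝ) ^ (0.02 : ℝ))
    (hk : Real.logb 2 n ≤ k) (hk1 : (k : ℝ) + 1 ≤ (n : ℝ) ^ (0.01 : ℝ)) (hN : n ≤ N) :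
    ∃ l : ℕ, 0 < l ∧ 2 * k ^ 2 ≤ l ∧ l + 2 * k ^ 2 ≤ N ∧ l + k ≤ N ∧
      1 ≤ ((N : ℝ) - l) / l ∧ (n : ℝ) ^ (0.58 : ℝ) ≤ (((N : ℝ) - l) / l) ^ k ∧
      (((N : ℝ) - l) / l) ^ k ≤ 2 * (n : ℝ) ^ (0.58 : ℝ) := by
  have hn := one_le_of_large hbig
  have hn0 : (0 : ℝ) < n := by linarith
  have hL := two_le_logb hbig
  have hk0 : (0 : ℝ) < k := by linarith
  have hNR : (n : ℝ) ≤ N := by exact_mod_cast hN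
  have hN0 : (0 : ℝ) < N := by linarith
  -- `k ^ 2` is much smaller than `n`.
  have hk2 : 1000 * (k : ℝ) ^ 2 ≤ n := by
    have h1 : (k : ℝ) ^ 2 ≤ (n : ℝ) ^ (0.02 : ℝ) := by
      have : (n : ℝ) ^ (0.02 : ℝ) = ((n : ℝ) ^ (0.01 : ℝ)) ^ 2 := by
        rw [← Real.rpow_natCast, ← Real.rpow_mul hn0.le]
        norm_num
      rw [this]
      gcongr
      linarith
    have h2 : (n : ℝ) = (n : ℝ) ^ (0.02 : ℝ) * (n : ℝ) ^ (0.98 : ℝ) := by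
      rw [← Real.rpow_add hn0]
      norm_num
    have h3 := large_rpow hbig (a := 0.98) (by norm_num)
    have h4 : (0 : ℝ) ≤ (n : ℝ) ^ (0.02 : ℝ) := by positivity
    nlinarith
  have hkk : (k : ℝ) ≤ (k : ℝ) ^ 2 := by nlinarith
  have hk1' : (1 : ℝ) ≤ k := by linarith
  set η : ℝ := (n : ℝ) ^ (0.58 / k : ℝ) with hη
  have hηk : η ^ k = (n : ℝ) ^ (0.58 : ℝ) := by
    rw [hη, ← Real.rpow_natCast, ← Real.rpow_mul hn0.le]
    congr 1
    field_simp
  have hη1 : 1 ≤ η := Real.one_le_rpow hn (by positivity)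
  have hη2 : η ≤ 2 := by
    have h1 : (n : ℝ) = (2 : ℝ) ^ Real.logb 2 n :=
      (Real.rpow_logb two_pos (by norm_num) hn0).symm
    rw [hη]
    calc (n : ℝ) ^ (0.58 / k : ℝ) = (2 : ℝ) ^ (Real.logb 2 n * (0.58 / k)) := by
          rw [Real.rpow_mul zero_le_two, ← h1]
      _ ≤ (2 : ℝ) ^ (1 : ℝ) := by
          refine Real.rpow_le_rpow_of_exponent_le one_le_two ?_
          rw [mul_div_assoc', div_le_one hk0]
          nlinarith
      _ = 2 := Real.rpow_one 2
  set l : ℕ := ⌊(N : ℝ) / (1 + η)⌋₊ with hl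
  have hl1 : (l : ℝ) ≤ N / (1 + η) := Nat.floor_le (by positivity)
  have hl2 : (N : ℝ) / (1 + η) < l + 1 := Nat.lt_floor_add_one _
  have hlN : (l : ℝ) * (1 + η) ≤ N := (le_div_iff₀ (by linarith)).1 hl1
  have hNl : (N : ℝ) < (l + 1) * (1 + η) := (div_lt_iff₀ (by linarith)).1 hl2
  have hl4 : (N : ℝ) ≤ 4 * l := by nlinarith
  have hlpos : (0 : ℝ) < l := by linarith
  have hl2N : 2 * (l : ℝ) ≤ N := by nlinarith
  refine ⟨l, by exact_mod_cast hlpos, ?_, ?_, ?_, ?_, ?_, ?_⟩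
  · have : 2 * (k : ℝ) ^ 2 ≤ l := by linarith
    exact_mod_cast this
  · have : (l : ℝ) + 2 * (k : ℝ) ^ 2 ≤ N := by linarith
    exact_mod_cast this
  · have : (l : ℝ) + k ≤ N := by linarith
    exact_mod_cast this
  · rw [le_div_iff₀ hlpos]
    linarith
  · rw [← hηk]
    refine pow_le_pow_left₀ (by linarith) ?_ k
    rw [le_div_iff₀ hlpos]
    linarith
  · have h1 : ((N : ℝ) - l) / l ≤ η * (1 + 3 / l) := by
      rw [div_le_iff₀ hlpos]
      have : η * (1 + 3 / (l : ℝ)) * l = η * l + 3 * η := by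
        field_simp
      rw [this]
      linarith
    have h2 : (1 + 3 / (l : ℝ)) ^ k ≤ 2 := by
      have h3 : (1 + 3 / (l : ℝ)) ^ k ≤ Real.exp (3 / l * k) := by
        have := Real.add_one_le_exp (3 / (l : ℝ))
        calc (1 + 3 / (l : ℝ)) ^ k ≤ Real.exp (3 / l) ^ k := by
              refine pow_le_pow_left₀ (by positivity) (by linarith) k
          _ = Real.exp (3 / l * k) := by rw [mul_comm, Real.exp_nat_mul]
      have h4 : 3 / (l : ℝ) * k ≤ Real.log 2 := by
        have h5 := Real.log_two_gt_d9
        rw [div_mul_eq_mul_div, div_le_iff₀ hlpos]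
        nlinarith
      calc _ ≤ _ := h3
        _ ≤ Real.exp (Real.log 2) := Real.exp_le_exp.2 h4
        _ = 2 := Real.exp_log two_pos
    calc (((N : ℝ) - l) / l) ^ k ≤ (η * (1 + 3 / l)) ^ k := by
          refine pow_le_pow_left₀ ?_ h1 k
          exact div_nonneg (by linarith) hlpos.le
      _ = η ^ k * (1 + 3 / (l : ℝ)) ^ k := mul_pow _ _ _
      _ ≤ η ^ k * 2 := by gcongr
      _ = _ := by rw [hηk, mul_comm]

/-- The average number of walks from a vertex that avoid a set with `l` elements is at most `1`. -/
theorem survival_le_one {y θ : ℝ} (hbig : (10 : ℝ) ^ 12 ≤ (n : ℝ) ^ (0.02 : ℝ))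
    (hk : Real.logb 2 n ≤ k) (hy : 1 ≤ y) (hyk : y ^ k ≤ 2 * (n : ℝ) ^ (0.58 : ℝ))
    (hθ : θ = y / (1 + y)) :
    ∏ i ∈ Finset.range k, ((keepCount n k (i + 1) : ℝ) * θ) ≤ 1 := by
  have hn := one_le_of_large hbig
  have hn0 : (0 : ℝ) < n := by linarith
  have hprof := branchProfile_keepCount hbig hk
  have h2 := (two_pow_sub_lastTwo hbig hk).1
  have hθ0 : 0 ≤ θ := by rw [hθ]; positivity
  have hW : ∏ i ∈ Finset.range k, (keepCount n k (i + 1) : ℝ) =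
      ⌊(n : ℝ) ^ (0.05 : ℝ)⌋₊ * 2 ^ (lastTwo n k - 1) := by
    have h := hprof.prod_eq
    rw [← keepCount_one n k]
    exact_mod_cast h
  rw [Finset.prod_mul_distrib, hW, Finset.prod_const, Finset.card_range]
  have hfl : (⌊(n : ℝ) ^ (0.05 : ℝ)⌋₊ : ℝ) ≤ (n : ℝ) ^ (0.05 : ℝ) := Nat.floor_le (by positivity)
  -- By the inequality of arithmetic and geometric means `θ ≤ √y / 2`.
  have hθ2 : θ ^ 2 ≤ y / 4 := by
    rw [hθ, div_pow, div_le_div_iff₀ (by positivity) (by norm_num)]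
    nlinarith [mul_nonneg (by linarith : (0 : ℝ) ≤ y) (sq_nonneg (y - 1))]
  have hθk : (θ ^ k) ^ 2 * ((2 : ℝ) ^ k) ^ 2 ≤ 2 * (n : ℝ) ^ (0.58 : ℝ) := by
    calc (θ ^ k) ^ 2 * ((2 : ℝ) ^ k) ^ 2 = (θ ^ 2 * 4) ^ k := by
          rw [mul_pow, ← pow_mul, ← pow_mul, ← pow_mul, mul_comm k 2]
          congr 1
          rw [pow_mul]
          norm_num
      _ ≤ y ^ k := by
          refine pow_le_pow_left₀ (by positivity) (by linarith) k
      _ ≤ _ := hyk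
  have e2 : (2 : ℝ) ^ k = 2 ^ (lastTwo n k - 1) * 2 ^ (k - lastTwo n k) * 2 := by
    rw [← pow_add, ← pow_succ]
    congr 1
    have := hprof.pos
    have := hprof.le
    omega
  -- It suffices to compare squares.
  have hsq : ((n : ℝ) ^ (0.05 : ℝ) * 2 ^ (lastTwo n k - 1) * θ ^ k) ^ 2 ≤ 1 := by
    have hA : (0 : ℝ) < 2 ^ (k - lastTwo n k) := by positivity
    have e3 : ((n : ℝ) ^ (0.05 : ℝ)) ^ 2 * (2 * (n : ℝ) ^ (0.58 : ℝ)) =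
        2 * ((n : ℝ) ^ (0.34 : ℝ)) ^ 2 := by
      rw [← Real.rpow_natCast, ← Real.rpow_natCast, ← Real.rpow_mul hn0.le, ← Real.rpow_mul hn0.le,
        mul_left_comm, ← Real.rpow_add hn0]
      norm_num
    have h5 : ((n : ℝ) ^ (0.05 : ℝ) * 2 ^ (lastTwo n k - 1) * θ ^ k) ^ 2 *
        (4 * (2 ^ (k - lastTwo n k)) ^ 2) ≤ 2 * (2 ^ (k - lastTwo n k)) ^ 2 := by
      calc ((n : ℝ) ^ (0.05 : ℝ) * 2 ^ (lastTwo n k - 1) * θ ^ k) ^ 2 *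
            (4 * (2 ^ (k - lastTwo n k)) ^ 2) =
            ((n : ℝ) ^ (0.05 : ℝ)) ^ 2 * ((θ ^ k) ^ 2 * ((2 : ℝ) ^ k) ^ 2) := by
              rw [e2]; ring
        _ ≤ ((n : ℝ) ^ (0.05 : ℝ)) ^ 2 * (2 * (n : ℝ) ^ (0.58 : ℝ)) := by gcongr
        _ = 2 * ((n : ℝ) ^ (0.34 : ℝ)) ^ 2 := e3
        _ ≤ _ := by gcongr
    by_contra hcon
    push Not at hcon
    have : 1 * (4 * ((2 : ℝ) ^ (k - lastTwo n k)) ^ 2) <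
        ((n : ℝ) ^ (0.05 : ℝ) * 2 ^ (lastTwo n k - 1) * θ ^ k) ^ 2 *
          (4 * (2 ^ (k - lastTwo n k)) ^ 2) := by gcongr
    have h6 : 0 < ((2 : ℝ) ^ (k - lastTwo n k)) ^ 2 := by positivity
    linarith
  have h7 : (n : ℝ) ^ (0.05 : ℝ) * 2 ^ (lastTwo n k - 1) * θ ^ k ≤ 1 := by
    refine le_of_sq_le_sq ?_ zero_le_one
    rwa [one_pow]
  refine le_trans ?_ h7
  gcongr

/-- Walks in a random layered graph meet rarely: the condition of the bounds for pairs of walks. -/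
theorem meeting_small {y : ℝ} (hbig : (10 : ℝ) ^ 12 ≤ (n : ℝ) ^ (0.02 : ℝ))
    (hk : Real.logb 2 n ≤ k) (hk1 : (k : ℝ) + 1 ≤ (n : ℝ) ^ (0.01 : ℝ)) (hy : 1 ≤ y)
    (hyk : y ^ k ≤ 2 * (n : ℝ) ^ (0.58 : ℝ)) :
    2 * ((k : ℝ) + 1) ^ 2 * (y ^ k * 2 ^ (k - lastTwo n k)) ≤ n := by
  have hn := one_le_of_large hbig
  have hn0 : (0 : ℝ) < n := by linarith
  have h2 := (two_pow_sub_lastTwo hbig hk).2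
  have h3 := large_rpow hbig (a := 0.06) (by norm_num)
  have hy0 : 0 ≤ y ^ k := pow_nonneg (by linarith) k
  calc 2 * ((k : ℝ) + 1) ^ 2 * (y ^ k * 2 ^ (k - lastTwo n k)) ≤
        2 * ((n : ℝ) ^ (0.01 : ℝ)) ^ 2 * (2 * (n : ℝ) ^ (0.58 : ℝ) * (2 * (n : ℝ) ^ (0.34 : ℝ))) := by
        gcongr
    _ = 8 * (n : ℝ) ^ (0.94 : ℝ) := by
        have : (n : ℝ) ^ (0.94 : ℝ) =
            ((n : ℝ) ^ (0.01 : ℝ)) ^ 2 * ((n : ℝ) ^ (0.58 : ℝ) * (n : ℝ) ^ (0.34 : ℝ)) := by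
          rw [← Real.rpow_natCast, ← Real.rpow_mul hn0.le, ← Real.rpow_add hn0, ← Real.rpow_add hn0]
          norm_num
        rw [this]
        ring
    _ ≤ (n : ℝ) ^ (0.06 : ℝ) * (n : ℝ) ^ (0.94 : ℝ) := by
        gcongr
        linarith
    _ = n := by
        rw [← Real.rpow_add hn0]
        norm_num

theorem sum_keepCount_le (hbig : (10 : ℝ) ^ 12 ≤ (n : ℝ) ^ (0.02 : ℝ))
    (hk : Real.logb 2 n ≤ k) (hk1 : (k : ℝ) + 1 ≤ (n : ℝ) ^ (0.01 : ℝ)) :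
    ((n * ∑ j ∈ Finset.range k, keepCount n k (j + 1) : ℕ) : ℝ) ≤ 2 * (n : ℝ) ^ (1.05 : ℝ) ∧
      n ≤ n * ∑ j ∈ Finset.range k, keepCount n k (j + 1) := by
  have hn := one_le_of_large hbig
  have hn0 : (0 : ℝ) < n := by linarith
  have hprof := branchProfile_keepCount hbig hk
  have hkpos : 0 < k := lt_of_lt_of_le hprof.pos hprof.le
  obtain ⟨k', rfl⟩ : ∃ k', k = k' + 1 := ⟨k - 1, by omega⟩
  constructor
  · have h1 : ∀ i ∈ Finset.range k', keepCount n (k' + 1) (i + 1 + 1) ≤ 2 := by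
      intro i hi
      have hi := Finset.mem_range.1 hi
      rcases lt_or_ge (i + 1) (lastTwo n (k' + 1)) with h | h
      · exact (hprof.two (i + 1) (by omega) h).le
      · exact (hprof.one (i + 1) h (by omega)).le.trans one_le_two
    have h2 : ∑ j ∈ Finset.range (k' + 1), keepCount n (k' + 1) (j + 1) ≤
        2 * k' + ⌊(n : ℝ) ^ (0.05 : ℝ)⌋₊ := by
      rw [Finset.sum_range_succ', keepCount_one]
      refine Nat.add_le_add_right ((Finset.sum_le_sum h1).trans ?_) _
      simp [mul_comm]
    have h3 : (⌊(n : ℝ) ^ (0.05 : ℝ)⌋₊ : ℝ) ≤ (n : ℝ) ^ (0.05 : ℝ) := Nat.floor_le (by positivity)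
    have h4 : 2 * (k' : ℝ) ≤ (n : ℝ) ^ (0.05 : ℝ) := by
      push_cast at hk1
      have e1 : (n : ℝ) ^ (0.05 : ℝ) = (n : ℝ) ^ (0.04 : ℝ) * (n : ℝ) ^ (0.01 : ℝ) := by
        rw [← Real.rpow_add hn0]; norm_num
      have h5 := large_rpow hbig (a := 0.04) (by norm_num)
      have h6 : (0 : ℝ) ≤ (n : ℝ) ^ (0.01 : ℝ) := by positivity
      rw [e1]
      nlinarith
    have h5 : ((∑ j ∈ Finset.range (k' + 1), keepCount n (k' + 1) (j + 1) : ℕ) : ℝ) ≤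
        2 * (n : ℝ) ^ (0.05 : ℝ) := by
      have : ((∑ j ∈ Finset.range (k' + 1), keepCount n (k' + 1) (j + 1) : ℕ) : ℝ) ≤
          ((2 * k' + ⌊(n : ℝ) ^ (0.05 : ℝ)⌋₊ : ℕ) : ℝ) := by exact_mod_cast h2
      push_cast at this ⊢
      linarith
    rw [Nat.cast_mul]
    calc (n : ℝ) * ((∑ j ∈ Finset.range (k' + 1), keepCount n (k' + 1) (j + 1) : ℕ) : ℝ) ≤
          n * (2 * (n : ℝ) ^ (0.05 : ℝ)) := by gcongr
      _ = 2 * ((n : ℝ) ^ (1 : ℝ) * (n : ℝ) ^ (0.05 : ℝ)) := by rw [Real.rpow_one]; ring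
      _ = 2 * (n : ℝ) ^ (1.05 : ℝ) := by rw [← Real.rpow_add hn0]; norm_num
  · refine Nat.le_mul_of_pos_right n ?_
    rw [Finset.sum_range_succ']
    have : 2 ≤ keepCount n (k' + 1) (0 + 1) := hprof.zero
    omega

/-- The final comparison of exponents: `0.58 * 2 = 1.16` from the two sides of a block, against
`0.016 + 1.05` and small terms from the upper bound. -/
theorem size_bound_of_pow_le {r δ N τ t : ℕ} {y s : ℝ}
    (hbig : (10 : ℝ) ^ 12 ≤ (n : ℝ) ^ (0.02 : ℝ)) (hr : 1 ≤ r) (hs : 0 ≤ s)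
    (hd : (((2 * k + 3) * r : ℕ) : ℝ) ≤ (n : ℝ) ^ (0.01 : ℝ))
    (hδ : (δ : ℝ) ≤ (n : ℝ) ^ (0.016 : ℝ)) (hN : (N : ℝ) ≤ 2 * (n : ℝ) ^ (1.05 : ℝ))
    (ht : (t : ℝ) ≤ 2 * 10 ^ (-5 : ℤ) * k) (hτ : τ = t * r) (hy : 1 ≤ y)
    (hy1 : (n : ℝ) ^ (0.58 : ℝ) ≤ y ^ k) (hy2 : y ^ k ≤ 2 * (n : ℝ) ^ (0.58 : ℝ))
    (hmain : (y ^ k) ^ (2 * r) ≤ 8000 * s * ((δ : ℝ) * (2 * r * N) + 1) ^ r *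
      (((τ : ℝ) + 1) * (768 * ((k : ℝ) + 1) ^ 2)) ^ (2 * r) * y ^ τ) :
    (n : ℝ) ^ ((0.01 : ℝ) * r) ≤ s := by
  have hn := one_le_of_large hbig
  have hn0 : (0 : ℝ) < n := by linarith
  have hpos : ∀ a : ℝ, 0 < (n : ℝ) ^ a := fun a => Real.rpow_pos_of_pos hn0 a
  have hrR : (1 : ℝ) ≤ r := by exact_mod_cast hr
  set d : ℝ := ((k : ℝ) + 1) * r with hd_def
  have hd' : d ≤ (n : ℝ) ^ (0.01 : ℝ) := by
    refine le_trans ?_ hd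
    push_cast
    rw [hd_def]
    have : (k : ℝ) + 1 ≤ 2 * k + 3 := by
      have : (0 : ℝ) ≤ k := Nat.cast_nonneg k
      linarith
    gcongr
  have hk0 : (0 : ℝ) ≤ k := Nat.cast_nonneg k
  have ht1 : (t : ℝ) ≤ k := by
    refine ht.trans ?_
    norm_num
    linarith
  have hτd : (τ : ℝ) + 1 ≤ d := by
    rw [hτ, hd_def]
    push_cast
    nlinarith
  have hkd : (k : ℝ) + 1 ≤ d := by
    rw [hd_def]
    nlinarith
  have hrd : (r : ℝ) ≤ d := by
    rw [hd_def]
    nlinarith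
  have hd0 : 0 ≤ d := by positivity
  have hdpow : d ^ 6 ≤ (n : ℝ) ^ (0.06 : ℝ) := by
    calc d ^ 6 ≤ ((n : ℝ) ^ (0.01 : ℝ)) ^ 6 := by gcongr
      _ = (n : ℝ) ^ (0.06 : ℝ) := by
        rw [← Real.rpow_natCast, ← Real.rpow_mul hn0.le]; norm_num
  -- The number of choices for one of the `r` operands, and the other losses per block.
  have hbr : ((δ : ℝ) * (2 * r * N) + 1) * (((τ : ℝ) + 1) * (768 * ((k : ℝ) + 1) ^ 2)) ^ 2 ≤
      5 * 768 ^ 2 * (n : ℝ) ^ (1.126 : ℝ) := by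
    have h1 : (δ : ℝ) * (2 * r * N) + 1 ≤ 5 * r * (n : ℝ) ^ (1.066 : ℝ) := by
      have e1 : (n : ℝ) ^ (1.066 : ℝ) = (n : ℝ) ^ (0.016 : ℝ) * (n : ℝ) ^ (1.05 : ℝ) := by
        rw [← Real.rpow_add hn0]; norm_num
      have h2 : (δ : ℝ) * (2 * r * N) ≤
          (n : ℝ) ^ (0.016 : ℝ) * (2 * r * (2 * (n : ℝ) ^ (1.05 : ℝ))) := by gcongr
      have h3 : 1 ≤ (r : ℝ) * (n : ℝ) ^ (1.066 : ℝ) := by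
        have := Real.one_le_rpow hn (by norm_num : (0 : ℝ) ≤ 1.066)
        nlinarith
      rw [e1] at h3 ⊢
      linarith
    have h4 : (r : ℝ) * (((τ : ℝ) + 1) ^ 2 * ((k : ℝ) + 1) ^ 4) ≤ d ^ 6 := by
      have h5 : (r : ℝ) * ((k : ℝ) + 1) ^ 4 ≤ d ^ 4 := by
        rw [hd_def, mul_pow, mul_comm]
        gcongr
        calc (r : ℝ) = (r : ℝ) ^ 1 := (pow_one _).symm
          _ ≤ (r : ℝ) ^ 4 := pow_le_pow_right₀ hrR (by norm_num)
      calc (r : ℝ) * (((τ : ℝ) + 1) ^ 2 * ((k : ℝ) + 1) ^ 4) =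
            ((τ : ℝ) + 1) ^ 2 * (r * ((k : ℝ) + 1) ^ 4) := by ring
        _ ≤ d ^ 2 * d ^ 4 := by gcongr
        _ = d ^ 6 := by ring
    calc ((δ : ℝ) * (2 * r * N) + 1) * (((τ : ℝ) + 1) * (768 * ((k : ℝ) + 1) ^ 2)) ^ 2 ≤
          (5 * r * (n : ℝ) ^ (1.066 : ℝ)) * (((τ : ℝ) + 1) * (768 * ((k : ℝ) + 1) ^ 2)) ^ 2 := by
          gcongr
      _ = 5 * 768 ^ 2 * (n : ℝ) ^ (1.066 : ℝ) * (r * (((τ : ℝ) + 1) ^ 2 * ((k : ℝ) + 1) ^ 4)) := by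
          ring
      _ ≤ 5 * 768 ^ 2 * (n : ℝ) ^ (1.066 : ℝ) * (n : ℝ) ^ (0.06 : ℝ) := by
          gcongr
          exact h4.trans hdpow
      _ = 5 * 768 ^ 2 * (n : ℝ) ^ (1.126 : ℝ) := by
          rw [mul_assoc, ← Real.rpow_add hn0]; norm_num
  have hyt : y ^ t ≤ (n : ℝ) ^ (0.001 : ℝ) := by
    have hy0 : (0 : ℝ) ≤ y := by linarith
    have h1 : y ^ k ≤ (n : ℝ) ^ (0.6 : ℝ) := by
      have h2 := large_rpow hbig (a := 0.02) le_rfl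
      calc y ^ k ≤ 2 * (n : ℝ) ^ (0.58 : ℝ) := hy2
        _ ≤ (n : ℝ) ^ (0.02 : ℝ) * (n : ℝ) ^ (0.58 : ℝ) := by
            gcongr
            linarith
        _ = (n : ℝ) ^ (0.6 : ℝ) := by rw [← Real.rpow_add hn0]; norm_num
    calc y ^ t = y ^ (t : ℝ) := (Real.rpow_natCast y t).symm
      _ ≤ y ^ ((k : ℝ) * (2 * 10 ^ (-5 : ℤ))) :=
          Real.rpow_le_rpow_of_exponent_le hy (by linarith)
      _ = (y ^ k) ^ ((2 * 10 ^ (-5 : ℤ) : ℝ)) := by rw [Real.rpow_mul hy0, Real.rpow_natCast]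
      _ ≤ ((n : ℝ) ^ (0.6 : ℝ)) ^ ((2 * 10 ^ (-5 : ℤ) : ℝ)) :=
          Real.rpow_le_rpow (by positivity) h1 (by positivity)
      _ ≤ (n : ℝ) ^ (0.001 : ℝ) := by
          rw [← Real.rpow_mul hn0.le]
          exact Real.rpow_le_rpow_of_exponent_le hn (by norm_num)
  have h8000 : (8000 : ℝ) ≤ 8000 ^ r := by
    calc (8000 : ℝ) = 8000 ^ 1 := (pow_one _).symm
      _ ≤ 8000 ^ r := pow_le_pow_right₀ (by norm_num) hr
  have hfin : ((n : ℝ) ^ (1.16 : ℝ)) ^ r ≤ s * ((n : ℝ) ^ (1.147 : ℝ)) ^ r := by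
    calc ((n : ℝ) ^ (1.16 : ℝ)) ^ r = ((n : ℝ) ^ (0.58 : ℝ)) ^ (2 * r) := by
          rw [pow_mul]
          congr 1
          rw [← Real.rpow_natCast, ← Real.rpow_mul hn0.le]
          norm_num
      _ ≤ (y ^ k) ^ (2 * r) := by gcongr
      _ ≤ _ := hmain
      _ = 8000 * s * (((δ : ℝ) * (2 * r * N) + 1) *
            (((τ : ℝ) + 1) * (768 * ((k : ℝ) + 1) ^ 2)) ^ 2 * y ^ t) ^ r := by
          generalize ((τ : ℝ) + 1) * (768 * ((k : ℝ) + 1) ^ 2) = Q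
          rw [mul_pow, mul_pow, ← pow_mul, ← pow_mul, hτ]
          ring
      _ ≤ 8000 ^ r * s * (5 * 768 ^ 2 * (n : ℝ) ^ (1.126 : ℝ) * (n : ℝ) ^ (0.001 : ℝ)) ^ r := by
          gcongr
      _ = s * (8000 * 5 * 768 ^ 2 * (n : ℝ) ^ (1.127 : ℝ)) ^ r := by
          have : (n : ℝ) ^ (1.127 : ℝ) = (n : ℝ) ^ (1.126 : ℝ) * (n : ℝ) ^ (0.001 : ℝ) := by
            rw [← Real.rpow_add hn0]; norm_num
          rw [this, mul_comm (8000 ^ r) s, mul_assoc, ← mul_pow]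
          ring
      _ ≤ s * ((n : ℝ) ^ (0.02 : ℝ) * (n : ℝ) ^ (1.127 : ℝ)) ^ r := by
          gcongr
          refine le_trans ?_ hbig
          norm_num
      _ = s * ((n : ℝ) ^ (1.147 : ℝ)) ^ r := by
          rw [← Real.rpow_add hn0]; norm_num
  have h9 : (n : ℝ) ^ ((0.01 : ℝ) * r) * ((n : ℝ) ^ (1.147 : ℝ)) ^ r ≤
      ((n : ℝ) ^ (1.16 : ℝ)) ^ r := by
    rw [Real.rpow_mul hn0.le, Real.rpow_natCast, ← mul_pow, ← Real.rpow_add hn0]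
    gcongr
    norm_num
  exact le_of_mul_le_mul_right (h9.trans hfin) (pow_pos (hpos _) r)

end Parameters

/-! ### Good restrictions -/

namespace LayeredGraph

variable {n k : ℕ} {w : ℕ → ℕ}

/-- The total weight of the pairs of walks with the same start. -/
noncomputable def pairsEq (v : LayeredGraph n k w) (θ : ℝ) : ℝ :=
  ∑ p ∈ v.walks ×ˢ v.walks with p.1 0 = p.2 0, θ ^ unionLen p

/-- The total weight of all pairs of walks. -/
noncomputable def pairsAll (v : LayeredGraph n k w) (θ : ℝ) : ℝ :=
  ∑ p ∈ v.walks ×ˢ v.walks, θ ^ unionLen p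

theorem pairsEq_nonneg (v : LayeredGraph n k w) {θ : ℝ} (hθ : 0 ≤ θ) : 0 ≤ v.pairsEq θ :=
  Finset.sum_nonneg fun _ _ => pow_nonneg hθ _

theorem pairsAll_nonneg (v : LayeredGraph n k w) {θ : ℝ} (hθ : 0 ≤ θ) : 0 ≤ v.pairsAll θ :=
  Finset.sum_nonneg fun _ _ => pow_nonneg hθ _

end LayeredGraph

/-- Markov's inequality for a product of independent and identically distributed nonnegative random
variables. -/
theorem card_prod_gt_le {Ω B : Type*} [Fintype Ω] [Fintype B] [DecidableEq B] (f : Ω → ℝ)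
    (hf : ∀ v, 0 ≤ f v) {β : ℝ} (hβ : 0 < β) (h : ∑ v, f v ≤ Fintype.card Ω * β) :
    open Classical in
    ((Finset.univ.filter fun V : B → Ω =>
      20 * β ^ Fintype.card B < ∏ b, f (V b)).card : ℝ) ≤ Fintype.card (B → Ω) / 20 := by
  classical
  have h1 : ∑ V : B → Ω, ∏ b, f (V b) ≤ Fintype.card (B → Ω) * β ^ Fintype.card B := by
    have h2 := Finset.prod_univ_sum (fun _ : B => (Finset.univ : Finset Ω)) fun _ v => f v
    rw [Fintype.piFinset_univ] at h2
    rw [← h2, Finset.prod_const, Finset.card_univ, Fintype.card_fun, Nat.cast_pow, ← mul_pow]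
    exact pow_le_pow_left₀ (Finset.sum_nonneg fun v _ => hf v) h _
  set E := Finset.univ.filter fun V : B → Ω => 20 * β ^ Fintype.card B < ∏ b, f (V b) with hE
  have h3 : (E.card : ℝ) * (20 * β ^ Fintype.card B) ≤ ∑ V : B → Ω, ∏ b, f (V b) := by
    rw [← nsmul_eq_mul, ← Finset.sum_const]
    refine (Finset.sum_le_sum fun V hV => (Finset.mem_filter.1 hV).2.le).trans ?_
    exact Finset.sum_le_sum_of_subset_of_nonneg (Finset.filter_subset _ _)
      fun V _ _ => Finset.prod_nonneg fun b _ => hf _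
  have hp : 0 < β ^ Fintype.card B := pow_pos hβ _
  rw [le_div_iff₀ (by norm_num)]
  have h4 := h3.trans h1
  have h5 : (E.card : ℝ) * 20 * β ^ Fintype.card B ≤ Fintype.card (B → Ω) * β ^ Fintype.card B := by
    linarith
  exact le_of_mul_le_mul_right h5 hp

namespace Restriction

open MvPolynomial

variable {n k r : ℕ}

/-- With probability at least `0.9` two products of functions of the sides of the blocks are at most
twenty times as large as the bounds for their expectations. -/
theorem prob_ge_of_sum_le (f g : LayeredGraph n k (fun j => keepCount n k (j + 1)) → ℝ)
    (hf0 : ∀ v, 0 ≤ f v) (hg0 : ∀ v, 0 ≤ g v) {β γ : ℝ} (hβ : 0 < β) (hγ : 0 < γ)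
    (hf : ∑ v, f v ≤ Fintype.card (LayeredGraph n k fun j => keepCount n k (j + 1)) * β)
    (hg : ∑ v, g v ≤ Fintype.card (LayeredGraph n k fun j => keepCount n k (j + 1)) * γ)
    (hne : Nonempty (LayeredGraph n k fun j => keepCount n k (j + 1)))
    {E : Set (Restriction n k r)}
    (hE : ∀ V : Restriction n k r, ∏ b, f (V.graph b) ≤ 20 * β ^ (2 * r) →
      ∏ b, g (V.graph b) ≤ 20 * γ ^ (2 * r) → V ∈ E) : 0.9 ≤ prob E := by
  classical
  have hB : Fintype.card (Fin r × BlockSide) = 2 * r := by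
    rw [Fintype.card_prod, Fintype.card_fin, mul_comm]
    rfl
  let Ω := LayeredGraph n k fun j => keepCount n k (j + 1)
  let e : Restriction n k r ≃ (Fin r × BlockSide → Ω) :=
    (Equiv.curry (Fin r) BlockSide Ω).symm
  have hcard : Nat.card (Restriction n k r) = Fintype.card (Fin r × BlockSide → Ω) := by
    rw [Nat.card_congr e, Nat.card_eq_fintype_card]
  have h1 := card_prod_gt_le (B := Fin r × BlockSide) f hf0 hβ hf
  have h2 := card_prod_gt_le (B := Fin r × BlockSide) g hg0 hγ hg
  rw [hB] at h1 h2
  set A₁ := Finset.univ.filter fun V : Fin r × BlockSide → Ω => 20 * β ^ (2 * r) < ∏ b, f (V b)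
  set A₂ := Finset.univ.filter fun V : Fin r × BlockSide → Ω => 20 * γ ^ (2 * r) < ∏ b, g (V b)
  have hgood : Fintype.card (Fin r × BlockSide → Ω) - (A₁.card + A₂.card) ≤ Nat.card E := by
    have h3 : (A₁ ∪ A₂)ᶜ.card ≤ Nat.card E := by
      have h4 : Nat.card E = (Finset.univ.filter fun V => e.symm V ∈ E).card := by
        rw [← Fintype.card_subtype, ← Nat.card_eq_fintype_card]
        exact Nat.card_congr (e.subtypeEquiv fun V => by simp)
      rw [h4]
      refine Finset.card_le_card fun V hV => ?_
      rw [Finset.mem_compl, Finset.mem_union, not_or] at hV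
      simp only [A₁, A₂, Finset.mem_filter, Finset.mem_univ, true_and, not_lt] at hV
      exact Finset.mem_filter.2 ⟨Finset.mem_univ _, hE (e.symm V) hV.1 hV.2⟩
    refine le_trans ?_ h3
    rw [Finset.card_compl]
    exact Nat.sub_le_sub_left (Finset.card_union_le _ _) _
  have hpos : (0 : ℝ) < Fintype.card (Fin r × BlockSide → Ω) := by
    have : 0 < Fintype.card (Fin r × BlockSide → Ω) := Fintype.card_pos
    exact_mod_cast this
  rw [prob, hcard, le_div_iff₀ hpos]
  have h5 : (Fintype.card (Fin r × BlockSide → Ω) : ℝ) ≤ Nat.card E + (A₁.card + A₂.card) := by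
    have : Fintype.card (Fin r × BlockSide → Ω) ≤ Nat.card E + (A₁.card + A₂.card) := by omega
    exact_mod_cast this
  linarith

/-! ### Degree and number of variables -/

variable {F : Type*} [Field F]

theorem card_zVar (V : Restriction n k r) :
    Fintype.card V.ZVar = 2 * r * (n * ∑ j ∈ Finset.range k, keepCount n k (j + 1)) := by
  classical
  rw [← Finset.card_univ, Finset.card_eq_sum_card_fiberwise (f := blockSide) (t := Finset.univ)
    (fun z _ => Finset.mem_coe.2 (Finset.mem_univ _))]
  have h : ∀ b ∈ (Finset.univ : Finset (Fin r × BlockSide)),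
      ((Finset.univ : Finset V.ZVar).filter fun z => blockSide z = b).card =
        n * ∑ j ∈ Finset.range k, keepCount n k (j + 1) := fun b _ => V.card_partOver_blockSide b
  rw [Finset.sum_congr rfl h, Finset.sum_const, smul_eq_mul, Finset.card_univ, Fintype.card_prod,
    Fintype.card_fin, mul_comm r]
  rfl

theorem isHomogeneous_walkPoly (V : Restriction n k r) (b : Fin r × BlockSide) (a : Fin n) :
    (V.walkPoly F b a).IsHomogeneous k := by
  refine IsHomogeneous.sum _ _ _ fun x hx => ?_
  have h := IsHomogeneous.prod (V.edges b x) (fun z => (X z : MvPolynomial V.ZVar F)) (fun _ => 1)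
    fun z _ => isHomogeneous_X _ _
  rw [Finset.sum_const, smul_eq_mul, mul_one, card_edges (Finset.mem_filter.1 hx).1] at h
  rwa [monomial_indExp]

theorem isHomogeneous_restrictedIMM (hn : 0 < n) (V : Restriction n k r) :
    (V.restrictedIMM F).IsHomogeneous ((2 * k + 1) * r) := by
  have hside : ∀ i s a, (V.sidePoly F i s a).IsHomogeneous k := fun i s a => by
    have := (V.isHomogeneous_walkPoly (F := F) (i, s) a).rename_isHomogeneous (f := Sum.inr)
      (τ := YVar n r ⊕ V.ZVar)
    rwa [← V.sidePoly_eq_rename] at this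
  have hblock : ∀ i, (V.blockPoly F i).IsHomogeneous (2 * k + 1) := fun i => by
    refine IsHomogeneous.sum _ _ _ fun ab _ => ?_
    have := (isHomogeneous_X F (Sum.inl (i, ab.1, ab.2) : YVar n r ⊕ V.ZVar)).mul
      ((hside i .left ab.1).mul (hside i .right ab.2))
    rwa [show 1 + (k + k) = 2 * k + 1 by omega] at this
  have h := IsHomogeneous.prod Finset.univ (fun i => V.blockPoly F i) (fun _ => 2 * k + 1)
    fun i _ => hblock i
  rw [V.restrictedIMM_eq_prod hn]
  simpa [mul_comm] using h

theorem totalDegree_restrictedIMM (hn : 0 < n) (hk : 0 < k)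
    (hw : ∀ j < k, 1 ≤ keepCount n k (j + 1)) (V : Restriction n k r) :
    (V.restrictedIMM F).totalDegree = (2 * k + 1) * r := by
  classical
  refine (V.isHomogeneous_restrictedIMM hn).totalDegree ?_
  intro h0
  have hwalk : ∀ b, ∃ x, x ∈ (V.graph b).walks := by
    intro b
    rw [← Finset.Nonempty, ← Finset.card_pos, LayeredGraph.card_walks]
    exact Nat.mul_pos hn (Finset.prod_pos fun j hj => hw j (Finset.mem_range.1 hj))
  choose x hx using hwalk
  have h1 := V.coeff_yExp_restrictedIMM (F := F) hn fun b => x b 0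
  rw [h0, map_zero, coeff_zero] at h1
  exact pathPoly_ne_zero (F := F) (β := blockSide) (start := fun x : Fin (k + 1) → Fin n => x 0)
    (fun b x _ z hz => (mem_edges.1 hz).1) (V.edges_injOn hk) hx h1.symm

/-! ### The lower bound for good restrictions -/

/-- The bound for the number of leading sets of one side in terms of pairs of walks. -/
theorem pow_four_le_leadSets {l N : ℕ} (V : Restriction n k r) (b : Fin r × BlockSide)
    (hN : N = n * ∑ j ∈ Finset.range k, keepCount n k (j + 1)) (hl : l + k ≤ N) :
    ((n : ℝ) * (∏ i ∈ Finset.range k, keepCount n k (i + 1) : ℕ) * ((N - k).choose l : ℕ)) ^ 4 ≤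
      (leadSets (partOver blockSide b Finset.univ) l (V.graph b).walks (fun x => x 0)
        (V.edges b)).card * (N.choose (l + k) * (V.graph b).pairsAll (((l + k : ℕ) : ℝ) / N)) *
        (N.choose l * (V.graph b).pairsEq (((N - l : ℕ) : ℝ) / N)) ^ 2 := by
  classical
  have hU : (partOver (blockSide (V := V)) b Finset.univ).card = N := by
    rw [hN]; exact V.card_partOver_blockSide b
  have hsub : ∀ x, V.edges b x ⊆ partOver blockSide b Finset.univ := fun x z hz =>
    Finset.mem_filter.2 ⟨Finset.mem_univ _, (mem_edges.1 hz).1⟩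
  have h1 := pow_four_le_card_leadSets (U := partOver blockSide b Finset.univ) (l := l) (k := k)
    (W := (V.graph b).walks) (start := fun x => x 0) (m := V.edges b) (fun x _ => hsub x)
    (fun x hx => card_edges hx)
  rw [hU, LayeredGraph.card_walks] at h1
  have h2 : (containPairs (partOver blockSide b Finset.univ) (l + k) (V.graph b).walks
      (V.edges b) : ℝ) ≤ N.choose (l + k) * (V.graph b).pairsAll (((l + k : ℕ) : ℝ) / N) := by
    rw [containPairs, LayeredGraph.pairsAll, Finset.mul_sum, Nat.cast_sum]
    refine Finset.sum_le_sum fun p hp => ?_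
    rw [← card_edges_union hp]
    have := card_powersetCard_filter_subset_le (Finset.union_subset (hsub p.1) (hsub p.2)) (l + k)
      (by rw [hU]; exact hl)
    rwa [hU] at this
  have h3 : (avoidPairs (partOver blockSide b Finset.univ) l (V.graph b).walks (fun x => x 0)
      (V.edges b) : ℝ) ≤ N.choose l * (V.graph b).pairsEq (((N - l : ℕ) : ℝ) / N) := by
    rw [avoidPairs, LayeredGraph.pairsEq, Finset.mul_sum, Nat.cast_sum]
    refine Finset.sum_le_sum fun p hp => ?_
    rw [← card_edges_union (Finset.mem_filter.1 hp).1]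
    have := card_powersetCard_filter_disjoint_le (Finset.union_subset (hsub p.1) (hsub p.2)) l
      (by rw [hU]; omega)
    rwa [hU] at this
  have h4 : ((n : ℝ) * (∏ i ∈ Finset.range k, keepCount n k (i + 1) : ℕ) *
      ((N - k).choose l : ℕ)) ^ 4 ≤
      (leadSets (partOver blockSide b Finset.univ) l (V.graph b).walks (fun x => x 0)
        (V.edges b)).card * containPairs (partOver blockSide b Finset.univ) (l + k)
          (V.graph b).walks (V.edges b) *
        (avoidPairs (partOver blockSide b Finset.univ) l (V.graph b).walks (fun x => x 0)
          (V.edges b) : ℝ) ^ 2 := by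
    exact_mod_cast h1
  have h5 := (V.graph b).pairsAll_nonneg (θ := ((l + k : ℕ) : ℝ) / N) (by positivity)
  refine h4.trans ?_
  gcongr

/-- The number of leading sets is at most the number of gates times the number of vectors for each
top gate. -/
theorem prod_leadSets_le_size {l N δ t τ : ℕ} {y : ℝ} (hn : 0 < n) (hk : 0 < k)
    (V : Restriction n k r) (hN : N = n * ∑ j ∈ Finset.range k, keepCount n k (j + 1))
    (hτ : τ = t * r) (hy : 1 ≤ y)
    (hch : ∀ u : ℕ, ((N.choose (l + u) : ℕ) : ℝ) ≤ N.choose l * y ^ u)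
    (Φ : DepthFour F (YVar n r ⊕ V.ZVar)) (hδ : Φ.IsMultiIc δ)
    (ht : ∀ j, ∀ e ∈ (Φ.sumPoly j).support, (e.support.filter fun v => v.isRight).card ≤ t)
    (hΦ : Φ.eval = V.restrictedIMM F) :
    ((∏ b, (leadSets (partOver blockSide b Finset.univ) l (V.graph b).walks (fun x => x 0)
      (V.edges b)).card : ℕ) : ℝ) ≤ Φ.size * (((δ : ℝ) * (2 * r * N) + 1) ^ r *
        (((τ : ℝ) + 1) ^ (2 * r) * ((N.choose l : ℝ) ^ (2 * r) * y ^ τ))) := by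
  classical
  have hB : Fintype.card (Fin r × BlockSide) = 2 * r := by
    rw [Fintype.card_prod, Fintype.card_fin, mul_comm]
    rfl
  obtain ⟨G, hGcard, hG⟩ := Φ.exists_spanning_projShift (r := r) hδ ht
    (𝒮 := Finset.univ.filter fun S => ∀ b, (partOver (blockSide (V := V)) b S).card = l)
    (E := enlargements (blockSide (V := V)) l τ) (by
      intro S hS U hSU hU
      simp only [enlargements, Finset.mem_filter, Finset.mem_univ, true_and] at hS ⊢
      exact ⟨S, U, hS, hSU, by rw [hτ]; exact hU, rfl⟩)
  have h1 := prod_card_leadSets_le (F := F) (β := blockSide (V := V)) (l := l)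
    (W := fun b => (V.graph b).walks) (start := fun x : Fin (k + 1) → Fin n => x 0) (m := V.edges)
    (fun b x _ z hz => (mem_edges.1 hz).1) (V.edges_injOn hk) G (by
      intro S hS α
      have := hG S (by simpa using hS) (yExp α) (degree_yExp α).le
      rwa [hΦ, V.coeff_yExp_restrictedIMM hn] at this)
  have h2 := card_enlargements_le (β := blockSide (V := V)) (l := l) (τ := τ) (N := N) hy
    (fun b => by rw [hN]; exact V.card_partOver_blockSide b) hch
  rw [hB] at h2
  have h3 := h1.trans hGcard
  rw [V.card_zVar, ← hN] at h3
  have h4 : ((∏ b, (leadSets (partOver blockSide b Finset.univ) l (V.graph b).walks (fun x => x 0)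
      (V.edges b)).card : ℕ) : ℝ) ≤ Φ.numProd * (((δ : ℝ) * (2 * r * N) + 1) ^ r *
        (enlargements (blockSide (V := V)) l τ).card) := by
    exact_mod_cast h3
  refine h4.trans ?_
  have h5 : (Φ.numProd : ℝ) ≤ Φ.size := by
    have : Φ.numProd ≤ Φ.size := by unfold DepthFour.size; omega
    exact_mod_cast this
  gcongr

end Restriction

/-! ### Combining the bounds -/

section Combine

theorem half_le_pow {a k : ℕ} (h0 : 0 < a + k) (h : 2 * k ^ 2 ≤ a + k) :
    (1 : ℝ) / 2 ≤ ((a : ℝ) / ((a + k : ℕ) : ℝ)) ^ k := by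
  have hpos : (0 : ℝ) < ((a + k : ℕ) : ℝ) := by exact_mod_cast h0
  have hR : 2 * (k : ℝ) ^ 2 ≤ ((a + k : ℕ) : ℝ) := by exact_mod_cast h
  have e1 : (a : ℝ) / ((a + k : ℕ) : ℝ) = 1 + -((k : ℝ) / ((a + k : ℕ) : ℝ)) := by
    field_simp
    push_cast
    ring
  have hle : (k : ℝ) / ((a + k : ℕ) : ℝ) ≤ 1 := by
    rw [div_le_one hpos]
    push_cast
    linarith [(Nat.cast_nonneg a : (0 : ℝ) ≤ a)]
  have h1 := one_add_mul_le_pow (a := -((k : ℝ) / ((a + k : ℕ) : ℝ))) (by linarith) k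
  rw [e1]
  refine le_trans ?_ h1
  have h2 : (k : ℝ) * ((k : ℝ) / ((a + k : ℕ) : ℝ)) ≤ 1 / 2 := by
    rw [mul_div_assoc', div_le_iff₀ hpos]
    linarith
  linarith

/-- Enlarging the sets by one element multiplies their number by at most the ratio of the numbers of
elements outside and inside. -/
theorem choose_add_le {N l : ℕ} (hl : 0 < l) (hlN : l ≤ N) (u : ℕ) :
    ((N.choose (l + u) : ℕ) : ℝ) ≤ N.choose l * (((N : ℝ) - l) / l) ^ u := by
  have hl0 : (0 : ℝ) < l := by exact_mod_cast hl
  have hlR : (l : ℝ) ≤ N := by exact_mod_cast hlN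
  induction u with
  | zero => simp
  | succ u ih =>
    have h1 : (N.choose (l + u + 1) : ℝ) * ((l + u + 1 : ℕ) : ℝ) =
        N.choose (l + u) * ((N - (l + u) : ℕ) : ℝ) := by
      exact_mod_cast Nat.choose_succ_right_eq N (l + u)
    have h2 : ((N - (l + u) : ℕ) : ℝ) ≤ ((N : ℝ) - l) / l * ((l + u + 1 : ℕ) : ℝ) := by
      have h3 : ((N - (l + u) : ℕ) : ℝ) ≤ (N : ℝ) - l := by
        rw [← Nat.cast_sub hlN]
        exact_mod_cast (by omega)
      refine h3.trans ?_
      rw [div_mul_eq_mul_div, le_div_iff₀ hl0]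
      refine mul_le_mul_of_nonneg_left ?_ (by linarith)
      exact_mod_cast (by omega)
    have hp : (0 : ℝ) < ((l + u + 1 : ℕ) : ℝ) := by positivity
    rw [← add_assoc, pow_succ, ← mul_assoc]
    refine le_of_mul_le_mul_right ?_ hp
    rw [h1, mul_assoc]
    exact mul_le_mul ih h2 (Nat.cast_nonneg _)
      (mul_nonneg (Nat.cast_nonneg _) (pow_nonneg (div_nonneg (by linarith) hl0.le) _))

/-- The number of sets with `l` elements that avoid a fixed set with `k` elements is at least half of
what it would be if the `k` elements were avoided independently; the same number counts the sets with
`l + k` elements that contain the fixed set. Comparing it with the upper bound `choose_sub_le` gives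
the ratio of the numbers of sets with `l + k` and with `l` elements. -/
theorem choose_estimates {N l k : ℕ} (hl : 0 < l) (hlk : 2 * k ^ 2 ≤ l)
    (hlN : l + 2 * k ^ 2 ≤ N) (hlkN : l + k ≤ N) (hlN' : l < N) :
    (N.choose l : ℝ) * (((N - l : ℕ) : ℝ) / N) ^ k / 2 ≤ ((N - k).choose l : ℕ) ∧
    (N.choose (l + k) : ℝ) * (((l + k : ℕ) : ℝ) / N) ^ k / 2 ≤ ((N - k).choose l : ℕ) ∧
    (N.choose l : ℝ) * (((N : ℝ) - l) / l) ^ k / 4 ≤ N.choose (l + k) := by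
  have hN0 : (0 : ℝ) < N := by exact_mod_cast (by omega : 0 < N)
  have hl0 : (0 : ℝ) < l := by exact_mod_cast hl
  -- Both lower bounds come from `le_choose_sub`, for the set and for its complement.
  have h1 := le_choose_sub (N := N) (q := N - l) (u := k) (by omega) (by omega)
  rw [Nat.choose_symm (by omega : l ≤ N)] at h1
  have e1 : (N - k).choose (N - l - k) = (N - k).choose l := by
    rw [← Nat.choose_symm (by omega : l ≤ N - k)]
    congr 1
    omega
  rw [e1] at h1
  have h2 := le_choose_sub (N := N) (q := l + k) (u := k) (by omega) hlkN
  rw [Nat.add_sub_cancel] at h2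
  have h3 := choose_sub_le (N := N) (q := l + k) (u := k) (by omega) hlkN
  rw [Nat.add_sub_cancel] at h3
  have hA := half_le_pow (a := N - l - k) (k := k) (by omega) (by omega)
  have hB := half_le_pow (a := l) (k := k) (by omega) (by omega)
  have eA : N - l - k + k = N - l := by omega
  rw [eA] at hA
  have hNl0 : (0 : ℝ) < ((N - l : ℕ) : ℝ) := by exact_mod_cast (by omega : 0 < N - l)
  have hlk0 : (0 : ℝ) < ((l + k : ℕ) : ℝ) := by exact_mod_cast (by omega : 0 < l + k)
  have c1 : (((N - l : ℕ) : ℝ) / N) ^ k / 2 ≤ (((N - l - k : ℕ) : ℝ) / N) ^ k := by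
    have : (((N - l - k : ℕ) : ℝ) / N) ^ k =
        (((N - l : ℕ) : ℝ) / N) ^ k * (((N - l - k : ℕ) : ℝ) / ((N - l : ℕ) : ℝ)) ^ k := by
      rw [← mul_pow]
      congr 1
      field_simp
    rw [this, div_eq_mul_one_div]
    gcongr
  have c2 : (((l + k : ℕ) : ℝ) / N) ^ k / 2 ≤ ((l : ℝ) / N) ^ k := by
    have : ((l : ℝ) / N) ^ k =
        (((l + k : ℕ) : ℝ) / N) ^ k * ((l : ℝ) / ((l + k : ℕ) : ℝ)) ^ k := by
      rw [← mul_pow]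
      congr 1
      field_simp
    rw [this, div_eq_mul_one_div]
    gcongr
  have b1 : (N.choose l : ℝ) * (((N - l : ℕ) : ℝ) / N) ^ k / 2 ≤ ((N - k).choose l : ℕ) := by
    refine le_trans ?_ h1
    rw [mul_div_assoc]
    gcongr
  refine ⟨b1, ?_, ?_⟩
  · refine le_trans ?_ h2
    rw [mul_div_assoc]
    gcongr
  · have c3 : (((N - l : ℕ) : ℝ) / N) ^ k = (((N : ℝ) - l) / l) ^ k * ((l : ℝ) / N) ^ k := by
      rw [← mul_pow, Nat.cast_sub hlN'.le]
      congr 1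
      field_simp
    have hy : 0 ≤ (((N : ℝ) - l) / l) ^ k := by
      have : (l : ℝ) ≤ N := by exact_mod_cast hlN'.le
      exact pow_nonneg (div_nonneg (by linarith) hl0.le) k
    have hpos : 0 < (((l + k : ℕ) : ℝ) / N) ^ k := by positivity
    refine le_of_mul_le_mul_right ?_ hpos
    refine le_trans ?_ (b1.trans h3)
    rw [c3]
    calc (N.choose l : ℝ) * (((N : ℝ) - l) / l) ^ k / 4 * (((l + k : ℕ) : ℝ) / N) ^ k =
          (N.choose l : ℝ) * (((N : ℝ) - l) / l) ^ k / 2 * ((((l + k : ℕ) : ℝ) / N) ^ k / 2) := by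
          ring
      _ ≤ (N.choose l : ℝ) * (((N : ℝ) - l) / l) ^ k / 2 * ((l : ℝ) / N) ^ k := by gcongr
      _ = _ := by ring

/-- The product of the Cauchy–Schwarz bounds over all sides of blocks. The averages `μ₁`, `μ₂` and the
number `ν` of vertices cancel, and a lower bound for the number of leading sets remains. -/
theorem pow_le_prod_of_pow_four_le {ι : Type*} [Fintype ι] {L A D : ι → ℝ} (hL : ∀ b, 0 ≤ L b)
    (hA0 : ∀ b, 0 ≤ A b) (hD0 : ∀ b, 0 ≤ D b) {ν X C C' μ₁ μ₂ κ : ℝ} {R : ℕ}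
    (hR : Fintype.card ι = R) (hν : 0 < ν) (hC : 0 < C) (hC' : 0 < C') (hμ₁ : 0 < μ₁)
    (hμ₂ : 0 < μ₂) (h : ∀ b, X ^ 4 ≤ L b * (C' * A b) * (C * D b) ^ 2)
    (hA : ∏ b, A b ≤ 20 * (μ₂ ^ 2 * (3 * ν ^ 2)) ^ R)
    (hD : ∏ b, D b ≤ 20 * (ν * (μ₁ * (2 * κ))) ^ R)
    (h1 : ν * (C * μ₁ / 2) ≤ X) (h2 : ν * (C' * μ₂ / 2) ≤ X) :
    C' ^ R ≤ 8000 * (∏ b, L b) * (192 * κ ^ 2) ^ R := by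
  have hX : ν ^ 4 * C ^ 2 * μ₁ ^ 2 * μ₂ ^ 2 * C' / 16 * C' ≤ X ^ 4 := by
    calc ν ^ 4 * C ^ 2 * μ₁ ^ 2 * μ₂ ^ 2 * C' / 16 * C' =
          (ν * (C * μ₁ / 2)) ^ 2 * (ν * (C' * μ₂ / 2)) ^ 2 := by ring
      _ ≤ X ^ 2 * X ^ 2 := by gcongr
      _ = X ^ 4 := by ring
  set Q : ℝ := ν ^ 4 * C ^ 2 * μ₁ ^ 2 * μ₂ ^ 2 * C' / 16 with hQ
  have hQ0 : 0 < Q := by positivity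
  have hP0 : 0 ≤ ∏ b, L b := Finset.prod_nonneg fun b _ => hL b
  have hA0' : 0 ≤ ∏ b, A b := Finset.prod_nonneg fun b _ => hA0 b
  have hD0' : 0 ≤ ∏ b, D b := Finset.prod_nonneg fun b _ => hD0 b
  have h3 : (Q * C') ^ R ≤ (∏ b, L b) * (C' ^ R * ∏ b, A b) * (C ^ R * ∏ b, D b) ^ 2 := by
    calc (Q * C') ^ R ≤ (X ^ 4) ^ R := by gcongr
      _ = ∏ _b : ι, X ^ 4 := by rw [Finset.prod_const, Finset.card_univ, hR]
      _ ≤ ∏ b, (L b * (C' * A b) * (C * D b) ^ 2) :=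
          Finset.prod_le_prod (fun b _ => by positivity) fun b _ => h b
      _ = _ := by
          rw [Finset.prod_mul_distrib, Finset.prod_mul_distrib, Finset.prod_mul_distrib,
            Finset.prod_pow, Finset.prod_mul_distrib, Finset.prod_const, Finset.prod_const,
            Finset.card_univ, hR]
  have h4 : (Q * C') ^ R ≤ 8000 * (∏ b, L b) * (192 * κ ^ 2) ^ R * Q ^ R := by
    calc (Q * C') ^ R ≤ _ := h3
      _ ≤ (∏ b, L b) * (C' ^ R * (20 * (μ₂ ^ 2 * (3 * ν ^ 2)) ^ R)) *
          (C ^ R * (20 * (ν * (μ₁ * (2 * κ))) ^ R)) ^ 2 := by gcongr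
      _ = 8000 * (∏ b, L b) * ((C' * (μ₂ ^ 2 * (3 * ν ^ 2))) *
            (C * (ν * (μ₁ * (2 * κ)))) ^ 2) ^ R := by
          generalize μ₂ ^ 2 * (3 * ν ^ 2) = a
          generalize ν * (μ₁ * (2 * κ)) = b
          rw [mul_pow (C' * a), mul_pow C' a, ← pow_mul, mul_comm 2 R, pow_mul, mul_pow C b]
          ring
      _ = 8000 * (∏ b, L b) * ((192 * κ ^ 2) * Q) ^ R := by
          congr 2
          rw [hQ]
          ring
      _ = _ := by rw [mul_pow _ Q]; ring
  rw [mul_pow, mul_comm] at h4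
  exact le_of_mul_le_mul_right h4 (pow_pos hQ0 R)

end Combine

theorem mainTheorem2 :
    ∃ c : ℝ, 0 < c ∧ ∃ K : ℝ, 0 < K ∧ ∃ n₀ : ℕ,
      ∀ (F : Type*) [Field F] (n k r δ : ℕ),
        n₀ ≤ n →
        K * Real.logb 2 n ≤ k →
        K ≤ r →
        (((2 * k + 3) * r : ℕ) : ℝ) ≤ (n : ℝ) ^ (0.01 : ℝ) →
        (δ : ℝ) ≤ (n : ℝ) ^ (0.016 : ℝ) →
        (∀ V : Restriction n k r,
          Nat.card (Restriction.YVar n r ⊕ V.ZVar) ≤ n ^ 3 ∧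
          (V.restrictedIMM F).totalDegree = (2 * k + 1) * r) ∧
        0.9 ≤ Restriction.prob {V : Restriction n k r |
          ∀ Φ : DepthFour F (Restriction.YVar n r ⊕ V.ZVar),
            Φ.IsMultiIc δ →
            Φ.HasBottomZSupportLE (2 * 10 ^ (-5 : ℤ) * (k : ℝ)) →
            Φ.eval = V.restrictedIMM F →
            (n : ℝ) ^ (c * (r : ℝ)) ≤ (Φ.size : ℝ)} := by
  -- The number `10 ^ 12` bounds the absolute constants that `n ^ 0.02` has to absorb.
  refine ⟨0.01, by norm_num, 1, one_pos, ⌈((10 : ℝ) ^ 12) ^ (50 : ℝ)⌉₊, ?_⟩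
  intro F _ n k r δ hn₀ hk hr hd hδ
  have hbig : (10 : ℝ) ^ 12 ≤ (n : ℝ) ^ (0.02 : ℝ) := by
    have h1 : ((10 : ℝ) ^ 12) ^ (50 : ℝ) ≤ n := (Nat.le_ceil _).trans (by exact_mod_cast hn₀)
    calc (10 : ℝ) ^ 12 = (((10 : ℝ) ^ 12) ^ (50 : ℝ)) ^ (0.02 : ℝ) := by
          rw [← Real.rpow_mul (by positivity), show (50 : ℝ) * 0.02 = 1 by norm_num, Real.rpow_one]
      _ ≤ (n : ℝ) ^ (0.02 : ℝ) := Real.rpow_le_rpow (by positivity) h1 (by norm_num)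
  rw [one_mul] at hk
  have hn := one_le_of_large hbig
  have hn0 : (0 : ℝ) < n := by linarith
  have hnpos : 0 < n := by exact_mod_cast hn0
  have hr1 : 1 ≤ r := by exact_mod_cast hr
  have hk1 : (k : ℝ) + 1 ≤ (n : ℝ) ^ (0.01 : ℝ) := by
    refine le_trans ?_ hd
    have : k + 1 ≤ (2 * k + 3) * r :=
      le_trans (by omega) (Nat.le_mul_of_pos_right (2 * k + 3) hr1)
    exact_mod_cast this
  have hrn : (r : ℝ) ≤ (n : ℝ) ^ (0.01 : ℝ) := by
    refine le_trans ?_ hd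
    have : r ≤ (2 * k + 3) * r := Nat.le_mul_of_pos_left r (by omega)
    exact_mod_cast this
  have hprof := branchProfile_keepCount hbig hk
  have hkpos : 0 < k := lt_of_lt_of_le hprof.pos hprof.le
  obtain ⟨hN2, hnN⟩ := sum_keepCount_le hbig hk hk1
  set N := n * ∑ j ∈ Finset.range k, keepCount n k (j + 1) with hN
  have hw1 : ∀ j < k, 1 ≤ keepCount n k (j + 1) := fun j hj => hprof.one_le hj
  constructor
  · intro V
    refine ⟨?_, Restriction.totalDegree_restrictedIMM hnpos hkpos hw1 V⟩
    have h1 : Nat.card (Restriction.YVar n r ⊕ V.ZVar) = r * (n * n) + 2 * r * N := by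
      rw [Nat.card_sum, Nat.card_eq_fintype_card, Nat.card_eq_fintype_card, V.card_zVar]
      simp [N]
    have h2 : (r : ℝ) * (n * n) + 2 * r * N ≤ (n : ℝ) ^ 3 := by
      have e3 : (n : ℝ) ^ 3 = (n : ℝ) ^ (0.99 : ℝ) * ((n : ℝ) ^ (0.01 : ℝ) * (n * n)) := by
        have : (n : ℝ) * n = (n : ℝ) ^ (2 : ℝ) := by
          rw [← Nat.cast_two, Real.rpow_natCast, sq]
        rw [this, ← Real.rpow_add hn0, ← Real.rpow_add hn0, ← Real.rpow_natCast]
        norm_num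
      have h3 := large_rpow hbig (a := 0.99) (by norm_num)
      have h4 : (n : ℝ) ^ (1.05 : ℝ) ≤ n * n := by
        calc (n : ℝ) ^ (1.05 : ℝ) ≤ (n : ℝ) ^ (2 : ℝ) :=
              Real.rpow_le_rpow_of_exponent_le hn (by norm_num)
          _ = n * n := by rw [← Nat.cast_two, Real.rpow_natCast, sq]
      calc (r : ℝ) * (n * n) + 2 * r * N ≤ r * (n * n) + 2 * r * (2 * (n * n)) := by
            gcongr
            linarith
        _ = 5 * (r * (n * n)) := by ring
        _ ≤ (n : ℝ) ^ (0.99 : ℝ) * ((n : ℝ) ^ (0.01 : ℝ) * (n * n)) := by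
            gcongr
            linarith
        _ = (n : ℝ) ^ 3 := e3.symm
    rw [h1]
    exact_mod_cast h2
  · obtain ⟨l, hl, hlk, hlN, hlkN, hy, hy1, hy2⟩ := exists_shift_size hbig hk hk1 hnN
    set y : ℝ := ((N : ℝ) - l) / l with hydef
    have hl0 : (0 : ℝ) < l := by exact_mod_cast hl
    have hlN' : l < N := by omega
    have hN0 : (0 : ℝ) < N := by exact_mod_cast (by omega : 0 < N)
    have hyl : y * l = N - l := by rw [hydef]; field_simp
    obtain ⟨hH1, hH2, hC'⟩ := choose_estimates hl hlk hlN hlkN hlN'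
    -- The densities of the complement of a shift and of a leading set.
    set θ₁ : ℝ := ((N - l : ℕ) : ℝ) / N with hθ₁
    set θ₂ : ℝ := ((l + k : ℕ) : ℝ) / N with hθ₂
    have hθ₁y : θ₁ = y / (1 + y) := by
      have hNl : (N : ℝ) = l * (1 + y) := by linarith
      rw [hθ₁, Nat.cast_sub hlN'.le, ← hyl, div_eq_div_iff hN0.ne' (by linarith), hNl]
      ring
    have hθ₁half : 1 / 2 ≤ θ₁ := by
      rw [hθ₁y, div_le_div_iff₀ (by norm_num) (by linarith)]
      linarith
    have hθ₁one : θ₁ ≤ 1 := by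
      rw [hθ₁y, div_le_one (by linarith)]
      linarith
    have hθ₁low : 1 / (2 * y) ≤ θ₁ := by
      refine le_trans ?_ hθ₁half
      rw [div_le_div_iff₀ (by linarith) (by norm_num)]
      linarith
    have hθ₂low : 1 / (2 * y) ≤ θ₂ := by
      rw [hθ₂, div_le_div_iff₀ (by linarith) hN0]
      push_cast
      nlinarith [(Nat.cast_nonneg k : (0 : ℝ) ≤ k)]
    have hθ₁0 : 0 < θ₁ := by linarith
    have hθ₂0 : 0 < θ₂ := lt_of_lt_of_le (by positivity) hθ₂low
    have hwn : ∀ j < k, keepCount n k (j + 1) ≤ n := by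
      intro j hj
      have h10 : 2 ≤ n := by
        have := large_rpow hbig (a := 1) (by norm_num)
        rw [Real.rpow_one] at this
        have h2n : ((2 : ℕ) : ℝ) ≤ n := by push_cast; linarith
        exact_mod_cast h2n
      rcases Nat.eq_zero_or_pos j with rfl | hj0
      · rw [keepCount_one]
        refine Nat.floor_le_of_le ?_
        calc (n : ℝ) ^ (0.05 : ℝ) ≤ (n : ℝ) ^ (1 : ℝ) :=
              Real.rpow_le_rpow_of_exponent_le hn (by norm_num)
          _ = n := Real.rpow_one _
      · rcases lt_or_ge j (lastTwo n k) with h | h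
        · exact (hprof.two j hj0 h).le.trans h10
        · exact (hprof.one j h hj).le.trans hnpos
    -- Both densities are at least `1 / (2 * y)`, so walks rarely meet for either of them.
    have hMn := meeting_small hbig hk hk1 hy hy2
    have hpairs₁ := (LayeredGraph.sum_pairs_bounds (w := fun j => keepCount n k (j + 1)) hnpos hwn
      hw1 hθ₁0 (fun j j' _ hj' => hprof.prod_inv_le hy hθ₁low hj') hMn).1
    have hpairs₂ := (LayeredGraph.sum_pairs_bounds (w := fun j => keepCount n k (j + 1)) hnpos hwn
      hw1 hθ₂0 (fun j j' _ hj' => hprof.prod_inv_le hy hθ₂low hj') hMn).2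
    have hμle := survival_le_one hbig hk hy hy2 hθ₁y
    have hμform : ∀ θ : ℝ, ∏ i ∈ Finset.range k, ((keepCount n k (i + 1) : ℝ) * θ) =
        (∏ i ∈ Finset.range k, keepCount n k (i + 1) : ℕ) * θ ^ k := by
      intro θ
      rw [Finset.prod_mul_distrib, Finset.prod_const, Finset.card_range, Nat.cast_prod]
    have hW0 : (0 : ℝ) < (∏ i ∈ Finset.range k, keepCount n k (i + 1) : ℕ) := by
      exact_mod_cast Finset.prod_pos fun i hi => hw1 i (Finset.mem_range.1 hi)
    -- A side has `n * W` walks.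
    set W : ℝ := ((∏ i ∈ Finset.range k, keepCount n k (i + 1) : ℕ) : ℝ) with hW
    have hμ₁ : 0 < W * θ₁ ^ k := by positivity
    have hμ₂ : 0 < W * θ₂ ^ k := by positivity
    have hβ : ∑ v : LayeredGraph n k (fun j => keepCount n k (j + 1)), v.pairsEq θ₁ ≤
        Fintype.card (LayeredGraph n k fun j => keepCount n k (j + 1)) *
          (n * (W * θ₁ ^ k * (2 * ((k : ℝ) + 1)))) := by
      refine hpairs₁.trans ?_
      rw [hμform]
      gcongr
      refine (Finset.sum_le_sum fun j hj =>
        hprof.prod_Ico_le_one hθ₁half hθ₁one hμle (Finset.mem_Icc.1 hj).2).trans ?_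
      simp
    have hγ : ∑ v : LayeredGraph n k (fun j => keepCount n k (j + 1)), v.pairsAll θ₂ ≤
        Fintype.card (LayeredGraph n k fun j => keepCount n k (j + 1)) *
          ((W * θ₂ ^ k) ^ 2 * (3 * (n : ℝ) ^ 2)) := by
      rw [hμform] at hpairs₂
      exact hpairs₂
    have hne : Nonempty (LayeredGraph n k fun j => keepCount n k (j + 1)) := by
      refine ⟨fun j _ => ?_⟩
      have h1 : keepCount n k (j.val + 1) ≤ (Finset.univ : Finset (Fin n)).card := by
        simpa using hwn j j.isLt
      exact ⟨(Finset.exists_subset_card_eq h1).choose,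
        (Finset.exists_subset_card_eq h1).choose_spec.2⟩
    refine Restriction.prob_ge_of_sum_le (fun v => v.pairsEq θ₁) (fun v => v.pairsAll θ₂)
      (fun v => v.pairsEq_nonneg hθ₁0.le) (fun v => v.pairsAll_nonneg hθ₂0.le)
      (by positivity) (by positivity) hβ hγ hne ?_
    intro V hV₁ hV₂ Φ hΦδ hΦt hΦ
    -- The support bound is a real number; supports are counted by its integer part.
    set t := ⌊2 * 10 ^ (-5 : ℤ) * (k : ℝ)⌋₊ with ht
    have htle : (t : ℝ) ≤ 2 * 10 ^ (-5 : ℤ) * k := Nat.floor_le (by positivity)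
    have hsize := Restriction.prod_leadSets_le_size (l := l) (t := t) hnpos hkpos V hN rfl hy
      (choose_add_le hl hlN'.le) Φ hΦδ (fun j e he => Nat.le_floor (hΦt j e he)) hΦ
    have hC0 : (0 : ℝ) < N.choose l := by exact_mod_cast Nat.choose_pos hlN'.le
    have hC'0 : (0 : ℝ) < N.choose (l + k) := by exact_mod_cast Nat.choose_pos hlkN
    have hB : Fintype.card (Fin r × BlockSide) = 2 * r := by
      rw [Fintype.card_prod, Fintype.card_fin, mul_comm]
      rfl
    have hlow := pow_le_prod_of_pow_four_le (fun b => Nat.cast_nonneg _)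
      (fun b => (V.graph b).pairsAll_nonneg hθ₂0.le)
      (fun b => (V.graph b).pairsEq_nonneg hθ₁0.le) hB hn0 hC0 hC'0 hμ₁ hμ₂
      (fun b => Restriction.pow_four_le_leadSets V b hN hlkN) hV₂ hV₁
      (by
        rw [mul_assoc (n : ℝ)]
        refine mul_le_mul_of_nonneg_left ?_ hn0.le
        calc (N.choose l : ℝ) * (W * θ₁ ^ k) / 2 = W * (N.choose l * θ₁ ^ k / 2) := by ring
          _ ≤ _ := mul_le_mul_of_nonneg_left hH1 hW0.le)
      (by
        rw [mul_assoc (n : ℝ)]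
        refine mul_le_mul_of_nonneg_left ?_ hn0.le
        calc (N.choose (l + k) : ℝ) * (W * θ₂ ^ k) / 2 = W * (N.choose (l + k) * θ₂ ^ k / 2) := by
              ring
          _ ≤ _ := mul_le_mul_of_nonneg_left hH2 hW0.le)
    rw [Nat.cast_prod] at hsize
    refine size_bound_of_pow_le (s := Φ.size) hbig hr1 (Nat.cast_nonneg _) hd hδ hN2 htle rfl hy
      hy1 hy2 ?_
    have hCR : (0 : ℝ) < (N.choose l : ℝ) ^ (2 * r) := pow_pos hC0 _
    refine le_of_mul_le_mul_right ?_ hCR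
    calc (y ^ k) ^ (2 * r) * (N.choose l : ℝ) ^ (2 * r) =
          4 ^ (2 * r) * (N.choose l * y ^ k / 4) ^ (2 * r) := by
          rw [← mul_pow, ← mul_pow]
          congr 1
          ring
      _ ≤ 4 ^ (2 * r) * (N.choose (l + k) : ℝ) ^ (2 * r) := by gcongr
      _ ≤ 4 ^ (2 * r) * (8000 * (Φ.size * (((δ : ℝ) * (2 * r * N) + 1) ^ r *
          ((((t * r : ℕ) : ℝ) + 1) ^ (2 * r) * ((N.choose l : ℝ) ^ (2 * r) * y ^ (t * r))))) *
            (192 * ((k : ℝ) + 1) ^ 2) ^ (2 * r)) := by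
          refine mul_le_mul_of_nonneg_left (hlow.trans ?_) (by positivity)
          gcongr
      _ = _ := by
          rw [show (768 : ℝ) * ((k : ℝ) + 1) ^ 2 = 4 * (192 * ((k : ℝ) + 1) ^ 2) by ring,
            mul_pow _ (4 * _), mul_pow 4]
          ring
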